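/- Let $\mathbb k$ be a field of characteristic $0$. For a graded vector space $V=\bigoplus_{n\ge 0}V^n$ let $\Lambda V$ be the free graded commutative algebra on $V$, and let $\Lambda^{q}V$, $\Lambda^{\ge q}V$, $\Lambda^{>q}V$ be the subspaces of elements of wordlength $q$, at least $q$, greater than $q$. A commutative differential graded algebra $(\Lambda V,d)$ is a KS complex if $V$ is the union of graded subspaces $0=V(-1)\subset V(0)\subset V(1)\subset\cdots$ with $dV(r)\subset\Lambda V(r-1)$. It is a minimal Sullivan algebra if moreover $V^0=0$ and $dV\subset\Lambda^{\ge 2}V$. For a $\mathbb Z$-graded differential graded module $M$ over $(\Lambda V,d)$, the Toomer invariant $e_{\Lambda V}(M)\in\{0,1,2,\dots,\infty\}$ is the least $m$ such that, for a semifree resolution $P\xrightarrow{\simeq}M$ over $\Lambda V$, the projection $P\to P/(\Lambda^{>m}V\cdot P)$ is injective on cohomology; it does not depend on the choice of $P$. Let $(\Lambda V,d)=\Lambda Z\otimes\Lambda W$, $V=Z\oplus W$, be a relative Sullivan algebra whose base $(\Lambda Z,d_Z)$ is a KS complex with $H^0(\Lambda Z)=\mathbb k$. That is, $W$ is concentrated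 in positive degrees, $d$ restricts to $d_Z$ on $\Lambda Z$, and $W$ is the union of graded subspaces $0=W(-1)\subset W(0)\subset W(1)\subset\cdots$ with $dW(r)\subset(\mathbb k\oplus(\Lambda Z)^{\ge 1})\otimes\Lambda W(r-1)$. Let $(\Lambda W,\bar d)$ be its fiber, where $\bar d$ is the $\mathbb k\otimes\Lambda W$ component of $d$. Regard $\Lambda V$ as a module over $\Lambda Z$ through the inclusion, and the ideal $\Lambda^{\ge q}W$ as a differential graded module over $(\Lambda W,\bar d)$. **Theorem 1.3.** Let $m,n\ge 0$ be integers. Suppose that $e_{\Lambda Z}(\Lambda V)=m$ and that $e_{\Lambda W}(\Lambda^{\ge q}W)\le n$ for all $q\ge 0$. Then $$e_{\Lambda V}(\Lambda V)\le (m+1)(n+2)-2 .$$ If, in addition, $\Lambda V$ itself is a minimal Sullivan algebra, then $$e_{\Lambda V}(\Lambda V)\le (m+1)(n+1)-1 .$$ -/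

import Mathlib

universe u

noncomputable section

/-! ### Free graded commutative algebras

A graded vector space is a vector space `V` with a family of subspaces `𝒱 n` (`n : ℕ`), of which `V`
is the internal direct sum. -/

section Free

variable {k : Type u} [Field k] {V : Type u} [AddCommGroup V] [Module k V]

/-- The relations `v w = (-1)^{|v||w|} w v` for homogeneous `v, w ∈ V`. In characteristic `0` they
imply `v ^ 2 = 0` for `v` of odd degree. -/
inductive FreeCGA.Rel (𝒱 : ℕ → Submodule k V) : TensorAlgebra k V → TensorAlgebra k V → Prop
  | comm {p q : ℕ} {v w : V} (hv : v ∈ 𝒱 p) (hw : w ∈ 𝒱 q) :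
      FreeCGA.Rel 𝒱 (TensorAlgebra.ι k v * TensorAlgebra.ι k w)
        ((-1) ^ (p * q) * (TensorAlgebra.ι k w * TensorAlgebra.ι k v))

/-- The free graded commutative algebra `ΛV` on the graded vector space `V`. -/
def FreeCGA (𝒱 : ℕ → Submodule k V) : Type u := RingQuot (FreeCGA.Rel 𝒱)

namespace FreeCGA

instance instRing (𝒱 : ℕ → Submodule k V) : Ring (FreeCGA 𝒱) :=
  inferInstanceAs (Ring (RingQuot (FreeCGA.Rel 𝒱)))

instance instAlgebra (𝒱 : ℕ → Submodule k V) : Algebra k (FreeCGA 𝒱) :=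
  inferInstanceAs (Algebra k (RingQuot (FreeCGA.Rel 𝒱)))

/-- The inclusion `V → ΛV`. -/
def ι (𝒱 : ℕ → Submodule k V) : V →ₗ[k] FreeCGA 𝒱 :=
  (RingQuot.mkAlgHom k (FreeCGA.Rel 𝒱)).toLinearMap ∘ₗ TensorAlgebra.ι k

theorem ι_comm (𝒱 : ℕ → Submodule k V) {p q : ℕ} {v w : V} (hv : v ∈ 𝒱 p) (hw : w ∈ 𝒱 q) :
    ι 𝒱 v * ι 𝒱 w = (-1) ^ (p * q) * (ι 𝒱 w * ι 𝒱 v) := by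
  have h := RingQuot.mkAlgHom_rel k (FreeCGA.Rel.comm (𝒱 := 𝒱) hv hw)
  rw [map_mul, map_mul, map_mul, map_pow, map_neg, map_one] at h
  exact h

/-- The algebra morphism `ΛV → ΛV'` induced by a degree-preserving linear map `V → V'`. -/
def map {V' : Type u} [AddCommGroup V'] [Module k V'] (𝒱 : ℕ → Submodule k V)
    (𝒱' : ℕ → Submodule k V') (f : V →ₗ[k] V') (hf : ∀ n, ∀ v ∈ 𝒱 n, f v ∈ 𝒱' n) :
    FreeCGA 𝒱 →ₐ[k] FreeCGA 𝒱' :=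
  RingQuot.liftAlgHom k ⟨TensorAlgebra.lift k (ι 𝒱' ∘ₗ f), by
    rintro _ _ ⟨hv, hw⟩
    simpa using ι_comm 𝒱' (hf _ _ hv) (hf _ _ hw)⟩

/-- `(ΛV)^n`, the elements of degree `n`: the span of the products of homogeneous elements of `V`
whose degrees add up to `n`. -/
def degree (𝒱 : ℕ → Submodule k V) (n : ℕ) : Submodule k (FreeCGA 𝒱) :=
  Submodule.span k {x | ∃ l : List (ℕ × V), (∀ p ∈ l, p.2 ∈ 𝒱 p.1) ∧
    (l.map Prod.fst).sum = n ∧ x = (l.map fun p => ι 𝒱 p.2).prod}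

/-- The same grading indexed by `ℤ`, zero in negative degrees. -/
def degreeInt (𝒱 : ℕ → Submodule k V) (i : ℤ) : Submodule k (FreeCGA 𝒱) :=
  ⨆ (n : ℕ) (_ : (n : ℤ) = i), degree 𝒱 n

/-- `Λ^q V`, the elements of wordlength `q`: the span of the products of `q` elements of `V`. -/
def word (𝒱 : ℕ → Submodule k V) (q : ℕ) : Submodule k (FreeCGA 𝒱) :=
  (LinearMap.range (ι 𝒱)) ^ q

/-- `Λ^{≥ q} V`, the ideal generated by the elements of wordlength at least `q`. -/
def wordGE (𝒱 : ℕ → Submodule k V) (q : ℕ) : Ideal (FreeCGA 𝒱) :=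
  Ideal.span {x | ∃ j, q ≤ j ∧ x ∈ word 𝒱 j}

/-- A differential making `ΛV` a commutative differential graded algebra. -/
structure Differential (𝒱 : ℕ → Submodule k V) where
  toLin : FreeCGA 𝒱 →ₗ[k] FreeCGA 𝒱
  degree_succ : ∀ n, ∀ a ∈ degree 𝒱 n, toLin a ∈ degree 𝒱 (n + 1)
  sq_zero : ∀ a, toLin (toLin a) = 0
  leibniz : ∀ n, ∀ a ∈ degree 𝒱 n, ∀ b,
    toLin (a * b) = toLin a * b + (-1) ^ n * (a * toLin b)

end FreeCGA

end Free

/-! ### DG modules, semifree modules and the Toomer invariant -/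

section Modules

variable {k : Type u} [Field k] {V : Type u} [AddCommGroup V] [Module k V]
  {𝒱 : ℕ → Submodule k V}

/-- `M`, with the `ℤ`-grading `ℳ` and the differential `dM`, is a DG module over `(ΛV, d)`. -/
structure IsDGModule (d : FreeCGA.Differential 𝒱) {M : Type u} [AddCommGroup M] [Module k M]
    [Module (FreeCGA 𝒱) M] (ℳ : ℤ → Submodule k M) (dM : M →ₗ[k] M) : Prop where
  scalarTower : IsScalarTower k (FreeCGA 𝒱) M
  isInternal : DirectSum.IsInternal ℳ
  smul_mem : ∀ (n : ℕ) (i : ℤ), ∀ a ∈ FreeCGA.degree 𝒱 n, ∀ x ∈ ℳ i, a • x ∈ ℳ (n + i)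
  degree_succ : ∀ i, ∀ x ∈ ℳ i, dM x ∈ ℳ (i + 1)
  sq_zero : ∀ x, dM (dM x) = 0
  leibniz : ∀ n, ∀ a ∈ FreeCGA.degree 𝒱 n, ∀ x : M,
    dM (a • x) = d.toLin a • x + (-1 : FreeCGA 𝒱) ^ n • (a • dM x)

/-- `P` is a semifree DG module over `(ΛV, d)`: it has a homogeneous `ΛV`-basis `b` such that, for
`P(r)` the submodule generated by the `b i` of rank at most `r`, the `b i` of rank `r` are cocycles
modulo `P(r - 1)`. So each `P(r) / P(r - 1)` is free on a basis of cocycles. -/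
def IsSemifree (d : FreeCGA.Differential 𝒱) {P : Type u} [AddCommGroup P] [Module k P]
    [Module (FreeCGA 𝒱) P] (𝒢 : ℤ → Submodule k P) (dP : P →ₗ[k] P) : Prop :=
  IsDGModule d 𝒢 dP ∧
    ∃ (I : Type u) (b : Module.Basis I (FreeCGA 𝒱) P) (deg : I → ℤ) (rank : I → ℕ),
      (∀ i, b i ∈ 𝒢 (deg i)) ∧
        ∀ i, dP (b i) ∈ Submodule.span (FreeCGA 𝒱) {x | ∃ j, rank j < rank i ∧ x = b j}

/-- `f : P → M` is a quasi-isomorphism of DG modules over `ΛV`. -/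
structure IsQuasiIso {P M : Type u} [AddCommGroup P] [Module k P] [Module (FreeCGA 𝒱) P]
    [AddCommGroup M] [Module k M] [Module (FreeCGA 𝒱) M]
    (𝒢 : ℤ → Submodule k P) (dP : P →ₗ[k] P) (ℳ : ℤ → Submodule k M) (dM : M →ₗ[k] M)
    (f : P →ₗ[FreeCGA 𝒱] M) : Prop where
  degree : ∀ i, ∀ x ∈ 𝒢 i, f x ∈ ℳ i
  comm : ∀ x, f (dP x) = dM (f x)
  /-- injectivity on cohomology -/
  injective : ∀ x, dP x = 0 → (∃ y, f x = dM y) → ∃ z, x = dP z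
  /-- surjectivity on cohomology -/
  surjective : ∀ y, dM y = 0 → ∃ x z, dP x = 0 ∧ y = f x + dM z

/-- The submodule `Λ^{≥ q} V · P` of a `ΛV`-module `P`. -/
def wordSubmodule (𝒱 : ℕ → Submodule k V) (q : ℕ) (P : Type u) [AddCommGroup P]
    [Module (FreeCGA 𝒱) P] : Submodule (FreeCGA 𝒱) P :=
  Submodule.span (FreeCGA 𝒱) {y | ∃ a ∈ FreeCGA.wordGE 𝒱 q, ∃ x : P, y = a • x}

/-- The projection `P → P / (Λ^{> m} V · P)` is injective on cohomology: a cocycle of `P` which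
becomes a coboundary in the quotient is a coboundary in `P`. -/
def ProjectionInjective (𝒱 : ℕ → Submodule k V) (m : ℕ) {P : Type u} [AddCommGroup P] [Module k P]
    [Module (FreeCGA 𝒱) P] (dP : P →ₗ[k] P) : Prop :=
  ∀ x : P, dP x = 0 → (∃ y, x - dP y ∈ wordSubmodule 𝒱 (m + 1) P) → ∃ z, x = dP z

/-- The Toomer invariant of a semifree module `P`: the least `m` such that the projection
`P → P / (Λ^{> m} V · P)` is injective on cohomology, and `∞` if there is none. -/
def semifreeToomer (𝒱 : ℕ → Submodule k V) {P : Type u} [AddCommGroup P] [Module k P]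
    [Module (FreeCGA 𝒱) P] (dP : P →ₗ[k] P) : ℕ∞ :=
  sInf {e | ∃ m : ℕ, e = (m : ℕ∞) ∧ ProjectionInjective 𝒱 m dP}

/-- The Toomer invariant `e_{ΛV}(M)` of a DG module `M`: the Toomer invariant of a semifree
resolution `P → M`. Semifree resolutions always exist, and all of them have the same invariant, so
the set below has exactly one element, which `sSup` selects. -/
def toomer (d : FreeCGA.Differential 𝒱) {M : Type u} [AddCommGroup M] [Module k M]
    [Module (FreeCGA 𝒱) M] (ℳ : ℤ → Submodule k M) (dM : M →ₗ[k] M) : ℕ∞ :=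
  sSup {e | ∃ (P : Type u) (_ : AddCommGroup P) (_ : Module k P) (_ : Module (FreeCGA 𝒱) P)
    (𝒢 : ℤ → Submodule k P) (dP : P →ₗ[k] P) (f : P →ₗ[FreeCGA 𝒱] M),
      IsSemifree d 𝒢 dP ∧ IsQuasiIso 𝒢 dP ℳ dM f ∧ e = semifreeToomer 𝒱 dP}

/-- `e_{ΛV}(ΛV)`. -/
def toomerSelf (d : FreeCGA.Differential 𝒱) : ℕ∞ :=
  toomer d (FreeCGA.degreeInt 𝒱) d.toLin

end Modules

/-! ### The DG module `Λ^{≥ q} V` -/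

section WordIdeal

variable {k : Type u} [Field k] {V : Type u} [AddCommGroup V] [Module k V]
  {𝒱 : ℕ → Submodule k V}

namespace FreeCGA

theorem induction {p : FreeCGA 𝒱 → Prop} (h1 : ∀ c, p (algebraMap k _ c))
    (hι : ∀ v, p (ι 𝒱 v)) (ha : ∀ a b, p a → p b → p (a + b)) (hm : ∀ a b, p a → p b → p (a * b))
    (a : FreeCGA 𝒱) : p a := by
  obtain ⟨t, rfl⟩ := RingQuot.mkAlgHom_surjective k (FreeCGA.Rel 𝒱) a
  induction t using TensorAlgebra.induction with
  | algebraMap c => rw [AlgHom.commutes]; exact h1 c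
  | ι v => exact hι v
  | mul a b iha ihb => rw [map_mul]; exact hm _ _ iha ihb
  | add a b iha ihb => rw [map_add]; exact ha _ _ iha ihb

theorem mem_wordGE {q : ℕ} {x : FreeCGA 𝒱} :
    x ∈ wordGE 𝒱 q ↔ x ∈ ⨆ (j : ℕ) (_ : q ≤ j), word 𝒱 j := by
  have hS : ∀ {j : ℕ} {y : FreeCGA 𝒱}, q ≤ j → y ∈ word 𝒱 j →
      y ∈ ⨆ (j : ℕ) (_ : q ≤ j), word 𝒱 j := fun {j} {y} hj hy =>
    (le_iSup₂ (f := fun (j : ℕ) (_ : q ≤ j) => word 𝒱 j) j hj) hy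
  constructor
  · intro hx
    refine Submodule.span_induction (p := fun x _ => x ∈ ⨆ (j : ℕ) (_ : q ≤ j), word 𝒱 j)
      (by rintro y ⟨j, hj, hy⟩; exact hS hj hy) (zero_mem _) (fun _ _ _ _ h₁ h₂ => add_mem h₁ h₂) ?_ hx
    intro c y _ hy
    rw [smul_eq_mul]
    clear hx
    refine induction (p := fun c => ∀ y ∈ ⨆ (j : ℕ) (_ : q ≤ j), word 𝒱 j,
      c * y ∈ ⨆ (j : ℕ) (_ : q ≤ j), word 𝒱 j) ?_ ?_ ?_ ?_ c y hy
    · intro c y hy; rw [← Algebra.smul_def]; exact Submodule.smul_mem _ _ hy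
    · intro v y hy
      have : (⨆ (j : ℕ) (_ : q ≤ j), word 𝒱 j) ≤
          (⨆ (j : ℕ) (_ : q ≤ j), word 𝒱 j).comap (LinearMap.mulLeft k (ι 𝒱 v)) := by
        refine iSup₂_le fun j hj z hz => ?_
        refine hS (j := j + 1) (by omega) ?_
        unfold word at *
        rw [pow_succ']
        exact Submodule.mul_mem_mul ⟨v, rfl⟩ hz
      exact this hy
    · intro a b iha ihb y hy; rw [add_mul]; exact add_mem (iha y hy) (ihb y hy)
    · intro a b iha ihb y hy; rw [mul_assoc]; exact iha _ (ihb y hy)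
  · intro hx
    have : (⨆ (j : ℕ) (_ : q ≤ j), word 𝒱 j) ≤ (wordGE 𝒱 q).restrictScalars k :=
      iSup₂_le fun j hj y hy => Ideal.subset_span ⟨j, hj, hy⟩
    exact this hx

theorem degree_succ_le (n : ℕ) : degree 𝒱 (n + 1) ≤ (wordGE 𝒱 1).restrictScalars k := by
  refine Submodule.span_le.2 ?_
  rintro _ ⟨l, -, hl, rfl⟩
  refine Ideal.subset_span ⟨l.length, ?_, ?_⟩
  · cases l with
    | nil => simp at hl
    | cons => simp
  · clear hl
    unfold word
    induction l with
    | nil => exact Submodule.one_le.1 le_rfl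
    | cons p l ih =>
      rw [List.map_cons, List.prod_cons, List.length_cons, pow_succ']
      exact Submodule.mul_mem_mul ⟨_, rfl⟩ ih

theorem wordGE_mul {i j : ℕ} {x y : FreeCGA 𝒱} (hx : x ∈ wordGE 𝒱 i) (hy : y ∈ wordGE 𝒱 j) :
    x * y ∈ wordGE 𝒱 (i + j) := by
  have hx' := mem_wordGE.1 hx
  have h : (⨆ (a : ℕ) (_ : i ≤ a), word 𝒱 a) ≤
      ((wordGE 𝒱 (i + j)).restrictScalars k).comap (LinearMap.mulRight k y) := by
    refine iSup₂_le fun a ha x hx => ?_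
    have hy' := mem_wordGE.1 hy
    have h : (⨆ (b : ℕ) (_ : j ≤ b), word 𝒱 b) ≤
        ((wordGE 𝒱 (i + j)).restrictScalars k).comap (LinearMap.mulLeft k x) := by
      refine iSup₂_le fun b hb z hz => ?_
      refine Ideal.subset_span ⟨a + b, by omega, ?_⟩
      unfold word at *
      rw [pow_add]
      exact Submodule.mul_mem_mul hx hz
    exact h hy'
  exact h hx'

/-- The differential does not lower the wordlength: the letters have non-negative degree, so their
differentials have positive degree and hence wordlength at least `1`. -/
theorem Differential.mem_wordGE (h𝒱 : DirectSum.IsInternal 𝒱) (d : Differential 𝒱)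
    (q : ℕ) : ∀ x ∈ wordGE 𝒱 q, d.toLin x ∈ wordGE 𝒱 q := by
  have hword : ∀ j, word 𝒱 j ≤ ((wordGE 𝒱 j).restrictScalars k).comap d.toLin := by
    intro j
    induction j with
    | zero =>
      intro x _
      have h1 : (1 : FreeCGA 𝒱) ∈ wordGE 𝒱 0 :=
        Ideal.subset_span ⟨0, le_rfl, by unfold word; exact Submodule.one_le.1 le_rfl⟩
      have h2 := Ideal.mul_mem_left (wordGE 𝒱 0) (d.toLin x) h1
      rw [mul_one] at h2
      exact h2
    | succ j ih =>
      unfold word at *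
      rw [pow_succ']
      refine Submodule.mul_le.2 ?_
      rintro _ ⟨v, rfl⟩ y hy
      have hy' : y ∈ wordGE 𝒱 j := Ideal.subset_span ⟨j, le_rfl, hy⟩
      have hv : v ∈ ⨆ n, 𝒱 n := by rw [h𝒱.submodule_iSup_eq_top]; trivial
      have h : (⨆ n, 𝒱 n) ≤ (((wordGE 𝒱 (j + 1)).restrictScalars k).comap d.toLin).comap
          (LinearMap.mulRight k y ∘ₗ ι 𝒱) := by
        refine iSup_le fun n v hv => ?_
        have hdeg : ι 𝒱 v ∈ degree 𝒱 n :=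
          Submodule.subset_span ⟨[(n, v)], by simpa using hv, by simp, by simp⟩
        have h1 : ι 𝒱 v ∈ wordGE 𝒱 1 :=
          Ideal.subset_span ⟨1, le_rfl, by unfold word; rw [pow_one]; exact ⟨v, rfl⟩⟩
        change d.toLin (ι 𝒱 v * y) ∈ wordGE 𝒱 (j + 1)
        rw [d.leibniz n _ hdeg, add_comm j 1]
        exact add_mem (wordGE_mul (degree_succ_le n (d.degree_succ n _ hdeg)) hy')
          (Ideal.mul_mem_left _ _ (wordGE_mul h1 (ih hy)))
      exact h hv
  intro x hx
  have h : (⨆ (j : ℕ) (_ : q ≤ j), word 𝒱 j) ≤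
      ((wordGE 𝒱 q).restrictScalars k).comap d.toLin := by
    refine iSup₂_le fun j hj y hy => ?_
    have h' : wordGE 𝒱 j ≤ wordGE 𝒱 q :=
      Ideal.span_mono fun x ⟨i, hi, hx⟩ => ⟨i, hj.trans hi, hx⟩
    exact h' (hword j hy)
  exact h (FreeCGA.mem_wordGE.1 hx)

end FreeCGA

/-- `e_{ΛV}(Λ^{≥ q} V)`: the ideal `Λ^{≥ q} V` of `ΛV` is a DG module over `ΛV`, with the grading and
the differential of `ΛV`. -/
def toomerWordGE (h𝒱 : DirectSum.IsInternal 𝒱) (d : FreeCGA.Differential 𝒱) (q : ℕ) : ℕ∞ :=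
  toomer d (M := FreeCGA.wordGE 𝒱 q)
    (fun i => (FreeCGA.degreeInt 𝒱 i).comap ((FreeCGA.wordGE 𝒱 q).subtype.restrictScalars k))
    (d.toLin.restrict (p := (FreeCGA.wordGE 𝒱 q).restrictScalars k)
      (q := (FreeCGA.wordGE 𝒱 q).restrictScalars k) (d.mem_wordGE h𝒱 q))

end WordIdeal

/-! ### Sullivan algebras and relative Sullivan algebras -/

section Sullivan

variable {k : Type u} [Field k] {V : Type u} [AddCommGroup V] [Module k V]

/-- `F 0 ⊆ F 1 ⊆ …` is an exhaustive filtration of the graded vector space `V` by graded subspaces,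
starting with `F 0 = 0`. -/
structure IsGradedFiltration (𝒱 : ℕ → Submodule k V) (F : ℕ → Submodule k V) : Prop where
  zero : F 0 = ⊥
  mono : Monotone F
  graded : ∀ r, F r ≤ ⨆ n, F r ⊓ 𝒱 n
  exhaustive : ∀ v, ∃ r, v ∈ F r

/-- The subalgebra of `ΛV` generated by a subspace `U` of `V`. -/
def subLambda (𝒱 : ℕ → Submodule k V) (U : Submodule k V) : Subalgebra k (FreeCGA 𝒱) :=
  Algebra.adjoin k (FreeCGA.ι 𝒱 '' U)

/-- `(ΛV, d)` is a KS complex: `V` has a filtration with `d V(r) ⊆ Λ V(r - 1)`. -/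
def IsKSComplex {𝒱 : ℕ → Submodule k V} (d : FreeCGA.Differential 𝒱) : Prop :=
  ∃ F : ℕ → Submodule k V, IsGradedFiltration 𝒱 F ∧
    ∀ r, ∀ v ∈ F (r + 1), d.toLin (FreeCGA.ι 𝒱 v) ∈ subLambda 𝒱 (F r)

/-- `H^0(ΛV, d) = k`. -/
def IsCohomologicallyConnected {𝒱 : ℕ → Submodule k V} (d : FreeCGA.Differential 𝒱) : Prop :=
  ∀ a ∈ FreeCGA.degree 𝒱 0, d.toLin a = 0 → ∃ c : k, a = algebraMap k (FreeCGA 𝒱) c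

/-- `(ΛV, d)` is a minimal Sullivan algebra: a KS complex with `V` concentrated in positive degrees
and `d V ⊆ Λ^{≥ 2} V`. -/
structure IsMinimalSullivan {𝒱 : ℕ → Submodule k V} (d : FreeCGA.Differential 𝒱) : Prop where
  ks : IsKSComplex d
  pos : 𝒱 0 = ⊥
  minimal : ∀ v, d.toLin (FreeCGA.ι 𝒱 v) ∈ FreeCGA.wordGE 𝒱 2

variable {Z W : Type u} [AddCommGroup Z] [Module k Z] [AddCommGroup W] [Module k W]

/-- The grading of `V = Z ⊕ W`. The algebra `ΛZ ⊗ ΛW` is `Λ(Z ⊕ W)`. -/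
def sumGrading (𝒵 : ℕ → Submodule k Z) (𝒲 : ℕ → Submodule k W) (n : ℕ) : Submodule k (Z × W) :=
  (𝒵 n).prod (𝒲 n)

/-- The inclusion `ΛZ → ΛZ ⊗ ΛW`. -/
def inclBase (𝒵 : ℕ → Submodule k Z) (𝒲 : ℕ → Submodule k W) :
    FreeCGA 𝒵 →ₐ[k] FreeCGA (sumGrading 𝒵 𝒲) :=
  FreeCGA.map 𝒵 _ (LinearMap.inl k Z W) fun _ _ hz => ⟨hz, zero_mem _⟩

/-- The inclusion `ΛW → ΛZ ⊗ ΛW` (not a morphism of differential algebras). -/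
def inclFiber (𝒵 : ℕ → Submodule k Z) (𝒲 : ℕ → Submodule k W) :
    FreeCGA 𝒲 →ₐ[k] FreeCGA (sumGrading 𝒵 𝒲) :=
  FreeCGA.map 𝒲 _ (LinearMap.inr k Z W) fun _ _ hw => ⟨zero_mem _, hw⟩

/-- The projection `ΛZ ⊗ ΛW → k ⊗ ΛW = ΛW`, sending `Z` to zero. -/
def projFiber (𝒵 : ℕ → Submodule k Z) (𝒲 : ℕ → Submodule k W) :
    FreeCGA (sumGrading 𝒵 𝒲) →ₐ[k] FreeCGA 𝒲 :=
  FreeCGA.map _ 𝒲 (LinearMap.snd k Z W) fun _ _ hv => hv.2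

/-- The subspace `k ⊕ (ΛZ)^{≥ 1}` of `ΛZ`, inside `ΛZ ⊗ ΛW`. -/
def baseReduced (𝒵 : ℕ → Submodule k Z) (𝒲 : ℕ → Submodule k W) :
    Submodule k (FreeCGA (sumGrading 𝒵 𝒲)) :=
  (1 ⊔ ⨆ n : ℕ, FreeCGA.degree 𝒵 (n + 1)).map (inclBase 𝒵 𝒲).toLinearMap

/-- `(ΛZ ⊗ ΛW, d)` is a relative Sullivan algebra with base `(ΛZ, dZ)`, a connected KS complex, and
with fiber `(ΛW, dW)`. -/
structure IsRelativeSullivan {𝒵 : ℕ → Submodule k Z} {𝒲 : ℕ → Submodule k W}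
    (dZ : FreeCGA.Differential 𝒵) (d : FreeCGA.Differential (sumGrading 𝒵 𝒲))
    (dW : FreeCGA.Differential 𝒲) : Prop where
  base_ks : IsKSComplex dZ
  base_connected : IsCohomologicallyConnected dZ
  /-- `W` is concentrated in positive degrees. -/
  pos : 𝒲 0 = ⊥
  /-- The inclusion of the base is a morphism of differential algebras. -/
  base : ∀ a, d.toLin (inclBase 𝒵 𝒲 a) = inclBase 𝒵 𝒲 (dZ.toLin a)
  /-- `d W(r) ⊆ (k ⊕ (ΛZ)^{≥ 1}) ⊗ Λ W(r - 1)`. -/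
  filtration : ∃ F : ℕ → Submodule k W, IsGradedFiltration 𝒲 F ∧ ∀ r, ∀ w ∈ F (r + 1),
    d.toLin (FreeCGA.ι _ (0, w)) ∈ baseReduced 𝒵 𝒲 *
      (subLambda (sumGrading 𝒵 𝒲) ((F r).map (LinearMap.inr k Z W))).toSubmodule
  /-- `dW` is the `k ⊗ ΛW` component of `d`. -/
  fiber : ∀ a, dW.toLin a = projFiber 𝒵 𝒲 (d.toLin (inclFiber 𝒵 𝒲 a))

/-- `e_{ΛZ}(ΛZ ⊗ ΛW)`, where `ΛZ` acts through its inclusion. -/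
def toomerOverBase {𝒵 : ℕ → Submodule k Z} {𝒲 : ℕ → Submodule k W}
    (dZ : FreeCGA.Differential 𝒵) (d : FreeCGA.Differential (sumGrading 𝒵 𝒲)) : ℕ∞ :=
  letI : Module (FreeCGA 𝒵) (FreeCGA (sumGrading 𝒵 𝒲)) :=
    Module.compHom _ (inclBase 𝒵 𝒲).toRingHom
  toomer dZ (FreeCGA.degreeInt (sumGrading 𝒵 𝒲)) d.toLin

end Sullivan

end

/-!
The theorem bounds the wordlength `N + 1` from which on all cocycles of `ΛV = ΛZ ⊗ ΛW` are
coboundaries; by `toomerSelf_le` such an `N` bounds `e_{ΛV}(ΛV)`.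

*The fiber.* The hypothesis on the ideals `Λ^{≥ q} W` enters through
`exists_eq_differential_of_toomerWordGE_le`: a cocycle of wordlength at least `q + n + 1` in `ΛW`
is the coboundary of an element of wordlength at least `q`. To prove it one needs a semifree
resolution of `Λ^{≥ q} W` on which the wordlengths can be controlled. It is found in a cylinder of
`ΛW`, a differential on `Λ(W ⊕ (sW ⊕ W))` with letters `r i`, `s i`, `v i`, in which the two
copies of `ΛW` are subcomplexes and `s i` is a homotopy from `v i` to `r i`
(`Cylinder.exists_cylinder`). The monomials with at least `q` letters `v i` span a semifree module
over `ΛW`, acting through the letters `r i`, and the fold map is a quasi-isomorphism from it to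
`Λ^{≥ q} W` (`Cylinder.IsCylinder.isSemifree`, `Cylinder.IsCylinder.isQuasiIso`). A cocycle `x` of
wordlength at least `q + n + 1`, written in the letters `v i`, is cohomologous to an element with
at least `n + 1` letters `r i` and `q` letters `v i`, since letters `v i` can be traded for
letters `r i` one at a time (`Cylinder.IsCylinder.exists_sub_diff_mem`): in the fiber of the
cylinder over the letters `r i`, each cocycle with `t + 1` letters `v i` bounds an element with
`t` of them (`Cylinder.IsCylinder.exists_fiberDiff_eq`). So `x` vanishes modulo `Λ^{> n} W` times
the resolution, and the hypothesis makes it a coboundary there.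

The cylinder is obtained from the simple differential in which the copy `v` of `ΛW` carries the
given differential and the letters `r i`, `s i` form an acyclic complex. The second inclusion of
`ΛW` is the exponential of a derivation applied to the first one, and an automorphism which is
triangular for the levels of the letters moves it to the letters `r i`.

*The total space.* Let `x` be a cocycle of wordlength at least `N + 1` in `ΛV`. Its component of
base wordlength `p` is removed for `p = 0, …, m`, one `p` after the other
(`exists_eq_differential_of_card`). The primitives in the fiber come from a linear homotopy, which
extends to `ΛZ ⊗ ΛW` up to longer words in `Z`
(`FreeCGA.GradedBasis.exists_sub_differential_mem`). Each removal costs `n + 1` letters of the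
fiber, of which one is regained if the differential raises the wordlength. What remains has base
wordlength at least `m + 1`, and it is a coboundary since `e_{ΛZ}(ΛV) = m` and `ΛV` is semifree
over `ΛZ` (`exists_eq_differential_of_toomerOverBase_le`).

All arguments on wordlengths and levels are carried out in the monomial basis of `ΛV`. A subspace
is described by a predicate on multisets of letters (`FreeCGA.GradedBasis.supported`), and
derivations and algebra morphisms are controlled through the way they rewrite letters
(`FreeCGA.Step`).
-/

noncomputable section

namespace FreeCGA

/-! ### Free graded commutative algebras: universal property and monomial basis -/

section Basic

theorem neg_one_pow_eq_smul {k R : Type*} [Field k] [Ring R] [Algebra k R] (n : ℕ) :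
    ((-1) ^ n : R) = ((-1) ^ n : k) • (1 : R) := by
  rcases neg_one_pow_eq_or k n with h | h <;> rcases Nat.even_or_odd n with h' | h' <;>
    simp [h'.neg_one_pow]

theorem neg_one_pow_mul_self {R : Type*} [Ring R] (n : ℕ) : ((-1) ^ n * (-1) ^ n : R) = 1 := by
  rw [← pow_add, ← two_mul, pow_mul]; simp

variable {k : Type u} [Field k] {V : Type u} [AddCommGroup V] [Module k V]
  {𝒱 : ℕ → Submodule k V}

/-- The universal property of `ΛV`: a linear map whose values satisfy the defining relations
extends to an algebra morphism. -/
def lift {R : Type*} [Ring R] [Algebra k R] (f : V →ₗ[k] R)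
    (hf : ∀ p q, ∀ v ∈ 𝒱 p, ∀ w ∈ 𝒱 q, f v * f w = (-1) ^ (p * q) * (f w * f v)) :
    FreeCGA 𝒱 →ₐ[k] R :=
  RingQuot.liftAlgHom k ⟨TensorAlgebra.lift k f, by
    rintro _ _ ⟨hv, hw⟩
    simpa using hf _ _ _ hv _ hw⟩

@[simp]
theorem lift_ι {R : Type*} [Ring R] [Algebra k R] (f : V →ₗ[k] R)
    (hf : ∀ p q, ∀ v ∈ 𝒱 p, ∀ w ∈ 𝒱 q, f v * f w = (-1) ^ (p * q) * (f w * f v)) (v : V) :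
    lift f hf (ι 𝒱 v) = f v := by
  have h := RingQuot.liftAlgHom_mkAlgHom_apply k (s := FreeCGA.Rel 𝒱) (TensorAlgebra.lift k f) (by
    rintro _ _ ⟨hv, hw⟩
    simpa using hf _ _ _ hv _ hw) (TensorAlgebra.ι k v)
  rw [TensorAlgebra.lift_ι_apply] at h
  exact h

@[simp]
theorem map_ι {V' : Type u} [AddCommGroup V'] [Module k V'] {𝒱' : ℕ → Submodule k V'}
    (f : V →ₗ[k] V') (hf : ∀ n, ∀ v ∈ 𝒱 n, f v ∈ 𝒱' n) (v : V) :
    map 𝒱 𝒱' f hf (ι 𝒱 v) = ι 𝒱' (f v) :=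
  lift_ι (ι 𝒱' ∘ₗ f) (fun _ _ _ hv _ hw => ι_comm 𝒱' (hf _ _ hv) (hf _ _ hw)) v

end Basic

/-- A homogeneous basis of the graded vector space `V`; its elements are the letters of the
monomials in `ΛV`. -/
structure GradedBasis {k : Type u} [Field k] {V : Type u} [AddCommGroup V] [Module k V]
    (𝒱 : ℕ → Submodule k V) (I : Type u) where
  /-- the basis -/
  b : Module.Basis I k V
  /-- the degrees of the basis elements -/
  deg : I → ℕ
  mem : ∀ i, b i ∈ 𝒱 (deg i)
  deg_of_mem : ∀ n, ∀ v ∈ 𝒱 n, ∀ i, b.repr v i ≠ 0 → deg i = n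

namespace GradedBasis

variable {k : Type u} [Field k] {V : Type u} [AddCommGroup V] [Module k V]
  {𝒱 : ℕ → Submodule k V} {I : Type u} (B : GradedBasis 𝒱 I)

/-- The letter `x i ∈ ΛV`. -/
def x (i : I) : FreeCGA 𝒱 := ι 𝒱 (B.b i)

/-- The product of a word in the letters. -/
def listProd (l : List I) : FreeCGA 𝒱 := (l.map B.x).prod

@[simp] theorem listProd_nil : B.listProd [] = 1 := rfl

@[simp] theorem listProd_cons (i : I) (l : List I) :
    B.listProd (i :: l) = B.x i * B.listProd l := by simp [listProd]

theorem listProd_append (l l' : List I) :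
    B.listProd (l ++ l') = B.listProd l * B.listProd l' := by simp [listProd]

theorem mem_span {n : ℕ} {v : V} (hv : v ∈ 𝒱 n) :
    v ∈ Submodule.span k (B.b '' {i | B.deg i = n}) := by
  rw [Module.Basis.mem_span_image]
  intro i hi
  exact B.deg_of_mem n v hv i (by simpa using hi)

theorem x_comm (i j : I) : B.x i * B.x j = (-1) ^ (B.deg i * B.deg j) * (B.x j * B.x i) :=
  ι_comm 𝒱 (B.mem i) (B.mem j)

theorem lift_rel {R : Type*} [Ring R] [Algebra k R] (g : I → R)
    (hg : ∀ i j, g i * g j = (-1) ^ (B.deg i * B.deg j) * (g j * g i)) :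
    ∀ p q, ∀ v ∈ 𝒱 p, ∀ w ∈ 𝒱 q, B.b.constr k g v * B.b.constr k g w =
      (-1) ^ (p * q) * (B.b.constr k g w * B.b.constr k g v) := by
  intro p q v hv w hw
  refine Submodule.span_induction₂ (p := fun v w _ _ => B.b.constr k g v * B.b.constr k g w =
      (-1) ^ (p * q) * (B.b.constr k g w * B.b.constr k g v)) ?_ ?_ ?_ ?_ ?_ ?_ ?_
      (B.mem_span hv) (B.mem_span hw)
  · rintro _ _ ⟨i, rfl, rfl⟩ ⟨j, rfl, rfl⟩
    simpa using hg i j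
  · intros; simp
  · intros; simp
  · intro x y z _ _ _ h1 h2; rw [map_add, add_mul, h1, h2, mul_add, mul_add]
  · intro x y z _ _ _ h1 h2; rw [map_add, mul_add, h1, h2, add_mul, mul_add]
  · intro r x y _ _ h; rw [map_smul, smul_mul_assoc, h, mul_smul_comm, mul_smul_comm]
  · intro r x y _ _ h; rw [map_smul, mul_smul_comm, h, smul_mul_assoc, mul_smul_comm]

/-- The algebra morphism with prescribed values on the letters. -/
def lift {R : Type*} [Ring R] [Algebra k R] (g : I → R)
    (hg : ∀ i j, g i * g j = (-1) ^ (B.deg i * B.deg j) * (g j * g i)) : FreeCGA 𝒱 →ₐ[k] R :=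
  FreeCGA.lift (B.b.constr k g) (B.lift_rel g hg)

@[simp]
theorem lift_x {R : Type*} [Ring R] [Algebra k R] (g : I → R)
    (hg : ∀ i j, g i * g j = (-1) ^ (B.deg i * B.deg j) * (g j * g i)) (i : I) :
    B.lift g hg (B.x i) = g i := by
  simp [lift, x]

theorem linearMap_ι_eq {R : Type*} [AddCommGroup R] [Module k R] {f g : FreeCGA 𝒱 →ₗ[k] R}
    (h : ∀ i, f (B.x i) = g (B.x i)) (v : V) : f (ι 𝒱 v) = g (ι 𝒱 v) := by
  have : f ∘ₗ ι 𝒱 = g ∘ₗ ι 𝒱 := B.b.ext h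
  exact LinearMap.congr_fun this v

theorem algHom_ext {R : Type*} [Ring R] [Algebra k R] {f g : FreeCGA 𝒱 →ₐ[k] R}
    (h : ∀ i, f (B.x i) = g (B.x i)) (a : FreeCGA 𝒱) : f a = g a := by
  induction a using FreeCGA.induction with
  | h1 c => simp
  | hι v => exact B.linearMap_ι_eq (f := f.toLinearMap) (g := g.toLinearMap) h v
  | ha a b h1 h2 => simp [h1, h2]
  | hm a b h1 h2 => simp [h1, h2]

/-- A multiset of letters is admissible if no letter of odd degree is repeated. -/
def Adm (S : Multiset I) : Prop := ∀ i S', S = i ::ₘ S' → Odd (B.deg i) → i ∉ S'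

variable {B} in
theorem Adm.of_cons {i : I} {S : Multiset I} (h : B.Adm (i ::ₘ S)) : B.Adm S := by
  intro j S' hS hj hm
  refine h j (i ::ₘ S') ?_ hj (Multiset.mem_cons_of_mem hm)
  rw [hS, Multiset.cons_swap]

theorem listProd_perm {l l' : List I} (h : l.Perm l') :
    ∃ ε : k, ε ≠ 0 ∧ B.listProd l = ε • B.listProd l' := by
  induction h with
  | nil => exact ⟨1, one_ne_zero, by simp⟩
  | cons i _ ih =>
    obtain ⟨ε, h, e⟩ := ih
    exact ⟨ε, h, by simp [e]⟩
  | swap i j l =>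
    refine ⟨(-1) ^ (B.deg j * B.deg i), pow_ne_zero _ (by simp), ?_⟩
    rw [listProd_cons, listProd_cons, ← mul_assoc, B.x_comm, listProd_cons, listProd_cons]
    rcases neg_one_pow_eq_or k (B.deg j * B.deg i) with h | h <;>
    rcases neg_one_pow_eq_or (FreeCGA 𝒱) (B.deg j * B.deg i) with h' | h' <;>
    rcases Nat.even_or_odd (B.deg j * B.deg i) with h'' | h'' <;>
    simp [h''.neg_one_pow, mul_assoc]
  | trans _ _ ih1 ih2 =>
    obtain ⟨ε, h, e⟩ := ih1
    obtain ⟨ε', h', e'⟩ := ih2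
    exact ⟨ε * ε', mul_ne_zero h h', by rw [e, e', smul_smul]⟩

section CharZero

variable [CharZero k]

theorem x_mul_self {i : I} (h : Odd (B.deg i)) : B.x i * B.x i = 0 := by
  have := B.x_comm i i
  rw [(h.mul h).neg_one_pow, neg_one_mul, eq_neg_iff_add_eq_zero, ← two_smul k] at this
  exact (smul_eq_zero.1 this).resolve_left two_ne_zero

theorem listProd_eq_zero {l : List I} (h : ¬ B.Adm (l : Multiset I)) : B.listProd l = 0 := by
  unfold Adm at h
  push Not at h
  obtain ⟨i, S', hl, hi, hm⟩ := h
  obtain ⟨S'', rfl⟩ := Multiset.exists_cons_of_mem hm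
  induction S'' using Quotient.inductionOn with
  | h l'' =>
    have hp : l.Perm (i :: i :: l'') := Quotient.exact hl
    obtain ⟨ε, -, e⟩ := B.listProd_perm hp
    rw [e, listProd_cons, listProd_cons, ← mul_assoc, B.x_mul_self hi, zero_mul, smul_zero]

end CharZero

section Coord

open Classical in
/-- Left multiplication by a letter, on the vector space spanned by the multisets of letters. The
sign counts the letters which have to be passed to insert the new one at its place. -/
def insertLetter [LinearOrder I] (i : I) : Module.End k (Multiset I →₀ k) :=
  Finsupp.linearCombination k fun S => if Odd (B.deg i) ∧ i ∈ S then 0 else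
    Finsupp.single (i ::ₘ S) ((-1) ^ (B.deg i * ((S.filter (· < i)).map B.deg).sum))

theorem insertLetter_comm [LinearOrder I] (i j : I) : B.insertLetter i * B.insertLetter j =
    ((-1) ^ (B.deg i * B.deg j) : k) • (B.insertLetter j * B.insertLetter i) := by
  have key : ∀ i j : I, i < j → B.insertLetter i * B.insertLetter j =
      ((-1) ^ (B.deg i * B.deg j) : k) • (B.insertLetter j * B.insertLetter i) := by
    intro i j hij
    refine Finsupp.lhom_ext' fun S => LinearMap.ext_ring ?_
    simp only [LinearMap.comp_apply, Module.End.mul_apply, LinearMap.smul_apply, insertLetter,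
      Finsupp.lsingle_apply, Finsupp.linearCombination_single, one_smul]
    by_cases hj : Odd (B.deg j) ∧ j ∈ S <;> by_cases hi : Odd (B.deg i) ∧ i ∈ S
    · simp [hi, hj]
    · simp [hi, hj, hij.ne']
    · simp [hi, hj, hij.ne]
    · have hi' : ¬ (Odd (B.deg i) ∧ i ∈ j ::ₘ S) := by simpa [hij.ne] using hi
      have hj' : ¬ (Odd (B.deg j) ∧ j ∈ i ::ₘ S) := by simpa [hij.ne'] using hj
      rw [if_neg hi, if_neg hj]
      simp only [Finsupp.linearCombination_single, if_neg hi', if_neg hj', Finsupp.smul_single,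
        smul_eq_mul, Multiset.cons_swap i j S]
      congr 1
      rw [Multiset.filter_cons_of_neg (p := (· < i)) S (not_lt.2 hij.le),
        Multiset.filter_cons_of_pos (p := (· < j)) S hij,
        Multiset.map_cons, Multiset.sum_cons, mul_add, pow_add, mul_comm (B.deg j) (B.deg i)]
      have := neg_one_pow_mul_self (R := k) (B.deg i * B.deg j)
      linear_combination (-(-1) ^ (B.deg j * (Multiset.map B.deg (S.filter (· < j))).sum) *
        (-1) ^ (B.deg i * (Multiset.map B.deg (S.filter (· < i))).sum)) * this
  rcases lt_trichotomy i j with h | rfl | h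
  · exact key i j h
  · rcases Nat.even_or_odd (B.deg i) with h | h
    · rw [(h.mul_right (B.deg i)).neg_one_pow, one_smul]
    · have : B.insertLetter i * B.insertLetter i = 0 := by
        refine Finsupp.lhom_ext' fun S => LinearMap.ext_ring ?_
        simp only [LinearMap.comp_apply, Module.End.mul_apply, insertLetter,
          Finsupp.lsingle_apply, Finsupp.linearCombination_single, one_smul]
        split_ifs <;> simp [h]
      rw [this, smul_zero]
  · rw [key j i h, smul_smul, mul_comm (B.deg j), FreeCGA.neg_one_pow_mul_self, one_smul]

/-- The coordinate functions which show that the monomials are linearly independent: `ΛV` acts on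
the space spanned by the multisets of letters, and the action on the empty multiset sends the
product of an admissible word to its multiset, up to a sign. -/
theorem exists_coord : ∃ c : FreeCGA 𝒱 →ₗ[k] (Multiset I →₀ k), ∀ l : List I,
    B.Adm (l : Multiset I) →
      ∃ ε : k, ε ≠ 0 ∧ c (B.listProd l) = Finsupp.single (l : Multiset I) ε := by
  classical
  -- any linear order on the letters serves to define the signs
  obtain ⟨_, _⟩ := exists_wellFoundedLT I
  let φ := B.lift B.insertLetter fun i j => by
    rw [insertLetter_comm, neg_one_pow_eq_smul (k := k) (R := Module.End k (Multiset I →₀ k)),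
      smul_mul_assoc, one_mul]
  refine ⟨LinearMap.applyₗ (Finsupp.single 0 1) ∘ₗ φ.toLinearMap, fun l => ?_⟩
  induction l with
  | nil => intro _; exact ⟨1, one_ne_zero, by simp⟩
  | cons i l ih =>
    intro h
    rw [← Multiset.cons_coe] at h
    obtain ⟨ε, hε, e⟩ := ih h.of_cons
    simp only [LinearMap.comp_apply, AlgHom.toLinearMap_apply, LinearMap.applyₗ_apply_apply] at e
    have hi : ¬ (Odd (B.deg i) ∧ i ∈ (l : Multiset I)) := fun hh => h i _ rfl hh.1 hh.2
    simp only [LinearMap.comp_apply, AlgHom.toLinearMap_apply, LinearMap.applyₗ_apply_apply,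
      listProd_cons, map_mul, Module.End.mul_apply, e]
    rw [show φ (B.x i) = B.insertLetter i from B.lift_x _ _ i, insertLetter,
      Finsupp.linearCombination_single, if_neg hi, Finsupp.smul_single]
    exact ⟨_, smul_ne_zero hε (pow_ne_zero _ (by simp)), rfl⟩

end Coord

/-- The span of the products of the words whose multiset of letters satisfies `p`. All the
subspaces of `ΛV` in use, such as those of a given degree or wordlength, have this form. -/
def supported (p : Multiset I → Prop) : Submodule k (FreeCGA 𝒱) :=
  Submodule.span k {a | ∃ l : List I, p l ∧ a = B.listProd l}

variable {B} in
theorem listProd_mem {p : Multiset I → Prop} {l : List I} (h : p l) :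
    B.listProd l ∈ B.supported p :=
  Submodule.subset_span ⟨l, h, rfl⟩

theorem supported_le {p : Multiset I → Prop} {N : Submodule k (FreeCGA 𝒱)}
    (h : ∀ l : List I, p l → B.listProd l ∈ N) : B.supported p ≤ N := by
  refine Submodule.span_le.2 ?_
  rintro _ ⟨l, hl, rfl⟩
  exact h l hl

variable {B} in
theorem supported_mono {p q : Multiset I → Prop} (h : ∀ S, p S → q S) :
    B.supported p ≤ B.supported q :=
  B.supported_le fun _ hl => listProd_mem (h _ hl)

variable {B} in
theorem mul_mem_supported {p q r : Multiset I → Prop} (h : ∀ S T, p S → q T → r (S + T))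
    {a b : FreeCGA 𝒱} (ha : a ∈ B.supported p) (hb : b ∈ B.supported q) :
    a * b ∈ B.supported r := by
  refine Submodule.span_induction₂ (p := fun a b _ _ => a * b ∈ B.supported r) ?_ ?_ ?_ ?_ ?_ ?_ ?_
    ha hb
  · rintro _ _ ⟨l, hl, rfl⟩ ⟨l', hl', rfl⟩
    rw [← listProd_append]
    exact listProd_mem (by simpa using h _ _ hl hl')
  · intros; simp
  · intros; simp
  · intro x y z _ _ _ h1 h2; rw [add_mul]; exact add_mem h1 h2
  · intro x y z _ _ _ h1 h2; rw [mul_add]; exact add_mem h1 h2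
  · intro r x y _ _ h; rw [smul_mul_assoc]; exact Submodule.smul_mem _ _ h
  · intro r x y _ _ h; rw [mul_smul_comm]; exact Submodule.smul_mem _ _ h

theorem one_mem_supported {p : Multiset I → Prop} (h : p 0) : (1 : FreeCGA 𝒱) ∈ B.supported p :=
  listProd_mem (l := []) h

theorem x_mem_supported {p : Multiset I → Prop} {i : I} (h : p {i}) : B.x i ∈ B.supported p := by
  have := listProd_mem (B := B) (p := p) (l := [i]) h
  simpa using this

theorem ι_mem_supported {p : Multiset I → Prop} {v : V} (h : ∀ i, B.b.repr v i ≠ 0 → p {i}) :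
    ι 𝒱 v ∈ B.supported p := by
  rw [← B.b.linearCombination_repr v, Finsupp.linearCombination_apply, Finsupp.sum, map_sum]
  refine Submodule.sum_mem _ fun i hi => ?_
  rw [map_smul]
  exact Submodule.smul_mem _ _ (B.x_mem_supported (h i (by simpa using hi)))

theorem mem_supported_true (a : FreeCGA 𝒱) : a ∈ B.supported fun _ => True := by
  induction a using FreeCGA.induction with
  | h1 c =>
    rw [Algebra.algebraMap_eq_smul_one]
    exact Submodule.smul_mem _ _ (B.one_mem_supported trivial)
  | hι v => exact B.ι_mem_supported fun _ _ => trivial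
  | ha a b h1 h2 => exact add_mem h1 h2
  | hm a b h1 h2 => exact mul_mem_supported (fun _ _ _ _ => trivial) h1 h2

section Basis

theorem exists_listProd_toList (l : List I) :
    ∃ ε : k, ε ≠ 0 ∧ B.listProd l = ε • B.listProd (l : Multiset I).toList := by
  have hp : l.Perm (l : Multiset I).toList := by
    rw [← Multiset.coe_eq_coe, Multiset.coe_toList]
  exact B.listProd_perm hp

theorem linearIndependent_listProd {J : Type*} (L : J → List I)
    (hinj : Function.Injective fun j => (L j : Multiset I)) (hadm : ∀ j, B.Adm (L j)) :
    LinearIndependent k fun j => B.listProd (L j) := by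
  obtain ⟨c, hc⟩ := B.exists_coord
  refine LinearIndependent.of_comp c ?_
  choose ε hε h using fun j => hc (L j) (hadm j)
  have : (c ∘ fun j => B.listProd (L j)) =
      (fun j => Units.mk0 (ε j) (hε j)) •
        ((fun S : Multiset I => Finsupp.single S (1 : k)) ∘ fun j => (L j : Multiset I)) := by
    ext1 j
    simp [h]
  rw [this]
  refine LinearIndependent.units_smul ?_ _
  exact (Finsupp.linearIndependent_single_one k (Multiset I)).comp _ hinj

theorem linearIndependent_toList :
    LinearIndependent k fun S : {S : Multiset I // B.Adm S} => B.listProd S.1.toList := by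
  refine B.linearIndependent_listProd (fun S : {S : Multiset I // B.Adm S} => S.1.toList) ?_ ?_
  · intro S T h
    simp only [Multiset.coe_toList] at h
    exact Subtype.ext h
  · intro S
    rw [Multiset.coe_toList]
    exact S.2

variable [CharZero k]

theorem span_listProd :
    ⊤ ≤ Submodule.span k (Set.range fun S : {S : Multiset I // B.Adm S} =>
      B.listProd S.1.toList) := by
  intro a _
  have h : B.supported (fun _ => True) ≤ Submodule.span k (Set.range
      fun S : {S : Multiset I // B.Adm S} => B.listProd S.1.toList) := by
    refine B.supported_le fun l _ => ?_
    by_cases hl : B.Adm (l : Multiset I)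
    · obtain ⟨ε, -, e⟩ := B.exists_listProd_toList l
      rw [e]
      exact Submodule.smul_mem _ _ (Submodule.subset_span ⟨⟨_, hl⟩, rfl⟩)
    · rw [B.listProd_eq_zero hl]; exact zero_mem _
  exact h (B.mem_supported_true a)

/-- The monomial basis of `ΛV`, indexed by the admissible multisets of letters. -/
def basis : Module.Basis {S : Multiset I // B.Adm S} k (FreeCGA 𝒱) :=
  Module.Basis.mk B.linearIndependent_toList B.span_listProd

theorem basis_apply (S : {S : Multiset I // B.Adm S}) : B.basis S = B.listProd S.1.toList :=
  Module.Basis.mk_apply _ _ S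

theorem exists_listProd_eq_smul {l : List I} (hl : B.Adm (l : Multiset I)) :
    ∃ ε : k, ε ≠ 0 ∧ B.listProd l = ε • B.basis ⟨l, hl⟩ := by
  rw [basis_apply]
  exact B.exists_listProd_toList l

theorem basis_mem {p : Multiset I → Prop} {S : {S : Multiset I // B.Adm S}} (h : p S) :
    B.basis S ∈ B.supported p := by
  rw [basis_apply]
  exact listProd_mem (by simpa using h)

/-- Membership in `supported p` can be read off the coordinates in the monomial basis: words with
the same multiset of letters have proportional products, which vanish if the multiset is not
admissible. -/
theorem mem_supported_iff {p : Multiset I → Prop} {a : FreeCGA 𝒱} :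
    a ∈ B.supported p ↔ ∀ S, B.basis.repr a S ≠ 0 → p S := by
  constructor
  · classical
    intro ha
    refine Submodule.span_induction (p := fun a _ => ∀ S, B.basis.repr a S ≠ 0 → p S)
      ?_ ?_ ?_ ?_ ha
    · rintro _ ⟨l, hl, rfl⟩ S hS
      by_cases h : B.Adm (l : Multiset I)
      · obtain ⟨ε, -, e⟩ := B.exists_listProd_eq_smul h
        rw [e, map_smul, Module.Basis.repr_self, Finsupp.smul_single, Finsupp.single_apply] at hS
        split_ifs at hS with h'
        · rw [← h']; exact hl
        · exact absurd rfl hS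
      · rw [B.listProd_eq_zero h] at hS; simp at hS
    · intro S h; simp at h
    · intro x y _ _ h1 h2 S h
      rw [map_add, Finsupp.add_apply] at h
      by_cases hx : B.basis.repr x S = 0
      · exact h2 S (by simpa [hx] using h)
      · exact h1 S hx
    · intro r x _ h1 S h
      rw [map_smul, Finsupp.smul_apply] at h
      exact h1 S (right_ne_zero_of_mul h)
  · intro h
    rw [← B.basis.linearCombination_repr a, Finsupp.linearCombination_apply]
    refine Submodule.sum_mem _ fun S hS => Submodule.smul_mem _ _ (B.basis_mem (h S ?_))
    simpa using hS

theorem mem_supported_and {p q : Multiset I → Prop} {a : FreeCGA 𝒱} (hp : a ∈ B.supported p)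
    (hq : a ∈ B.supported q) : a ∈ B.supported fun S => p S ∧ q S := by
  rw [mem_supported_iff] at *
  exact fun S h => ⟨hp S h, hq S h⟩

open Classical in
/-- The projection onto the monomials which satisfy `p`. -/
def proj (p : Multiset I → Prop) : FreeCGA 𝒱 →ₗ[k] FreeCGA 𝒱 :=
  B.basis.constr k fun S => if p S then B.basis S else 0

theorem repr_proj (p : Multiset I → Prop) [DecidablePred p] (a : FreeCGA 𝒱)
    (S : {S : Multiset I // B.Adm S}) :
    B.basis.repr (B.proj p a) S = if p S then B.basis.repr a S else 0 := by
  classical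
  have : (Finsupp.lapply S ∘ₗ B.basis.repr.toLinearMap) ∘ₗ B.proj p =
      (if p S then (1 : k) else 0) • (Finsupp.lapply S ∘ₗ B.basis.repr.toLinearMap) := by
    refine B.basis.ext fun T => ?_
    by_cases hTS : T = S
    · subst hTS
      by_cases h : p T <;> simp [proj, h]
    · by_cases h : p T <;> by_cases h' : p S <;> simp [proj, h, h', hTS]
  have := LinearMap.congr_fun this a
  simp only [LinearMap.comp_apply, Finsupp.lapply_apply, LinearEquiv.coe_coe,
    LinearMap.smul_apply] at this
  rw [this]
  split_ifs <;> simp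

theorem proj_mem {p q : Multiset I → Prop} {a : FreeCGA 𝒱} (h : a ∈ B.supported q) :
    B.proj p a ∈ B.supported fun S => q S ∧ p S := by
  classical
  rw [mem_supported_iff] at *
  intro S hS
  rw [repr_proj] at hS
  split_ifs at hS with h'
  · exact ⟨h S hS, h'⟩
  · exact absurd rfl hS

theorem sub_proj_mem {p q : Multiset I → Prop} {a : FreeCGA 𝒱} (h : a ∈ B.supported q) :
    a - B.proj p a ∈ B.supported fun S => q S ∧ ¬ p S := by
  classical
  rw [mem_supported_iff] at *
  intro S hS
  rw [map_sub, Finsupp.sub_apply, repr_proj] at hS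
  split_ifs at hS with h'
  · simp at hS
  · exact ⟨h S (by simpa using hS), h'⟩

theorem proj_eq_self {p : Multiset I → Prop} {a : FreeCGA 𝒱} (h : a ∈ B.supported p) :
    B.proj p a = a := by
  classical
  refine B.basis.repr.injective (Finsupp.ext fun S => ?_)
  rw [repr_proj]
  split_ifs with h'
  · rfl
  · by_contra h''
    exact h' (B.mem_supported_iff.1 h S (Ne.symm h''))

theorem proj_eq_zero {p q : Multiset I → Prop} (hpq : ∀ S, q S → ¬ p S) {a : FreeCGA 𝒱}
    (h : a ∈ B.supported q) : B.proj p a = 0 := by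
  classical
  refine B.basis.repr.injective (Finsupp.ext fun S => ?_)
  rw [repr_proj]
  split_ifs with h'
  · by_contra h''
    exact hpq S (B.mem_supported_iff.1 h S (by simpa using h'')) h'
  · simp

end Basis

end GradedBasis

end FreeCGA

namespace FreeCGA

/-! ### Rewriting of monomials -/

/-- `Step ρ S' S`: the multiset `S'` arises from `S` by replacing one letter `i` by a multiset of
letters `T` with `ρ i T`. A derivation `θ` whose value at the letter `i` is a combination of
monomials `T` with `ρ i T` maps each monomial `S` to a combination of monomials `S'` with
`Step ρ S' S`. -/
def Step {I : Type*} (ρ : I → Multiset I → Prop) (S' S : Multiset I) : Prop :=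
  ∃ i S₀ T, S = i ::ₘ S₀ ∧ S' = T + S₀ ∧ ρ i T

namespace Step

variable {I : Type*} {ρ : I → Multiset I → Prop}

theorem head {i : I} {T : Multiset I} (h : ρ i T) (S : Multiset I) : Step ρ (T + S) (i ::ₘ S) :=
  ⟨i, S, T, rfl, rfl, h⟩

theorem add_left {S' S : Multiset I} (h : Step ρ S' S) (T : Multiset I) :
    Step ρ (T + S') (T + S) := by
  obtain ⟨i, S₀, U, rfl, rfl, h⟩ := h
  exact ⟨i, T + S₀, U, by simp, by abel, h⟩

theorem transGen_add_left {S' S : Multiset I} (h : Relation.TransGen (Step ρ) S' S)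
    (T : Multiset I) : Relation.TransGen (Step ρ) (T + S') (T + S) :=
  h.lift (T + ·) fun _ _ h => h.add_left T

theorem wellFounded {r : I → I → Prop} (hr : WellFounded r) (h : ∀ i T, ρ i T → ∀ j ∈ T, r j i) :
    WellFounded (Relation.TransGen (Step ρ)) := by
  refine WellFounded.transGen (Subrelation.wf (r := Relation.CutExpand r) ?_ hr.cutExpand)
  rintro _ _ ⟨i, S₀, T, rfl, rfl, hT⟩
  refine ⟨T, i, h i T hT, ?_⟩
  rw [← Multiset.singleton_add]
  abel

theorem transGen_of_closed {p : Multiset I → Prop} (h : ∀ S' S, Step ρ S' S → p S → p S')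
    {S' S : Multiset I} (hS : Relation.TransGen (Step ρ) S' S) (hp : p S) : p S' := by
  induction hS using Relation.TransGen.head_induction_on with
  | single h' => exact h _ _ h' hp
  | head h' _ ih => exact h _ _ h' ih

end Step

namespace GradedBasis

variable {k : Type u} [Field k] {V : Type u} [AddCommGroup V] [Module k V]
  {𝒱 : ℕ → Submodule k V} {I : Type u} (B : GradedBasis 𝒱 I)

variable {B} in
/-- An endomorphism which changes the letters by terms in `ρ` changes a monomial by terms which
arise by rewriting one or several of its letters. -/
theorem algHom_sub_mem {ρ : I → Multiset I → Prop} (φ : FreeCGA 𝒱 →ₐ[k] FreeCGA 𝒱)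
    (h : ∀ i, φ (B.x i) - B.x i ∈ B.supported (ρ i)) (l : List I) :
    φ (B.listProd l) - B.listProd l ∈
      B.supported fun S => Relation.TransGen (Step ρ) S l := by
  induction l with
  | nil => simp
  | cons i l ih =>
    have e : φ (B.listProd (i :: l)) - B.listProd (i :: l) =
        (φ (B.x i) - B.x i) * B.listProd l + B.x i * (φ (B.listProd l) - B.listProd l) +
          (φ (B.x i) - B.x i) * (φ (B.listProd l) - B.listProd l) := by
      rw [listProd_cons, map_mul]; noncomm_ring
    rw [e, ← Multiset.cons_coe]
    refine add_mem (add_mem ?_ ?_) ?_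
    · refine mul_mem_supported (q := (· = (l : Multiset I))) ?_ (h i) (listProd_mem rfl)
      rintro T _ hT rfl
      exact .single (Step.head hT _)
    · refine mul_mem_supported (p := (· = {i})) ?_ (B.x_mem_supported rfl) ih
      rintro _ S rfl hS
      exact Step.transGen_add_left hS {i}
    · refine mul_mem_supported ?_ (h i) ih
      intro T S hT hS
      exact (Step.transGen_add_left hS T).tail (Step.head hT _)

variable {B} in
theorem linearMap_eqOn {M : Type*} [AddCommGroup M] [Module k M] {f g : FreeCGA 𝒱 →ₗ[k] M}
    {p : Multiset I → Prop} (h : ∀ l : List I, p l → f (B.listProd l) = g (B.listProd l))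
    {a : FreeCGA 𝒱} (ha : a ∈ B.supported p) : f a = g a := by
  have : B.supported p ≤ LinearMap.eqLocus f g := B.supported_le h
  exact this ha

theorem linearMap_ext {M : Type*} [AddCommGroup M] [Module k M] {f g : FreeCGA 𝒱 →ₗ[k] M}
    (h : ∀ l : List I, f (B.listProd l) = g (B.listProd l)) (a : FreeCGA 𝒱) : f a = g a :=
  linearMap_eqOn (fun l _ => h l) (B.mem_supported_true a)

variable {B} in
theorem map_mem_of_listProd {M : Type*} [AddCommGroup M] [Module k M] (f : FreeCGA 𝒱 →ₗ[k] M)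
    {p : Multiset I → Prop} {N : Submodule k M} (h : ∀ l : List I, p l → f (B.listProd l) ∈ N)
    {a : FreeCGA 𝒱} (ha : a ∈ B.supported p) : f a ∈ N := by
  have : B.supported p ≤ N.comap f := B.supported_le h
  exact this ha

theorem x_comm_smul (i j : I) :
    B.x i * B.x j = ((-1) ^ (B.deg i * B.deg j) : k) • (B.x j * B.x i) := by
  rw [x_comm, neg_one_pow_eq_smul (k := k) (R := FreeCGA 𝒱), smul_mul_assoc, one_mul]

/-! ### Identification of degree and wordlength -/

theorem degree_eq (n : ℕ) : degree 𝒱 n = B.supported fun S => (S.map B.deg).sum = n := by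
  apply le_antisymm
  · refine Submodule.span_le.2 ?_
    rintro _ ⟨l, hl, rfl, rfl⟩
    induction l with
    | nil => exact B.one_mem_supported rfl
    | cons a l ih =>
      simp only [List.map_cons, List.prod_cons, List.sum_cons]
      refine mul_mem_supported (p := fun S => (S.map B.deg).sum = a.1) ?_ ?_
        (ih fun p hp => hl p (List.mem_cons_of_mem _ hp))
      · intro S T hS hT; simp [hS, hT]
      · refine B.ι_mem_supported fun i hi => ?_
        simpa using B.deg_of_mem a.1 a.2 (hl a (by simp)) i hi
  · refine B.supported_le fun l hl => ?_
    refine Submodule.subset_span ⟨l.map fun i => (B.deg i, B.b i), ?_, ?_, ?_⟩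
    · simp only [List.mem_map, forall_exists_index, and_imp, forall_apply_eq_imp_iff₂]
      exact fun i _ => B.mem i
    · simpa [Function.comp_def] using hl
    · simp only [listProd, List.map_map, Function.comp_def]; rfl

theorem degreeInt_eq (i : ℤ) :
    degreeInt 𝒱 i = B.supported fun S => ((S.map B.deg).sum : ℤ) = i := by
  apply le_antisymm
  · refine iSup₂_le fun n hn => ?_
    rw [B.degree_eq]
    exact supported_mono fun S hS => by rw [hS, hn]
  · refine B.supported_le fun l hl => ?_
    refine (le_iSup₂ (f := fun (n : ℕ) (_ : (n : ℤ) = i) => degree 𝒱 n) _ hl) ?_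
    rw [B.degree_eq]
    exact listProd_mem rfl

theorem listProd_mem_degree (l : List I) : B.listProd l ∈ degree 𝒱 (l.map B.deg).sum := by
  rw [B.degree_eq]
  exact listProd_mem (by simp)

theorem word_eq (q : ℕ) : word 𝒱 q = B.supported fun S => S.card = q := by
  unfold word
  apply le_antisymm
  · induction q with
    | zero =>
      rw [pow_zero]
      exact Submodule.one_le.2 (B.one_mem_supported rfl)
    | succ q ih =>
      rw [pow_succ']
      refine Submodule.mul_le.2 ?_
      rintro _ ⟨v, rfl⟩ y hy
      refine mul_mem_supported (p := fun S => S.card = 1) ?_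
        (B.ι_mem_supported fun i _ => rfl) (ih hy)
      intro S T hS hT; simp [hS, hT, add_comm]
  · refine B.supported_le fun l hl => ?_
    subst hl
    induction l with
    | nil => exact Submodule.one_le.1 le_rfl
    | cons i l ih =>
      rw [listProd_cons, Multiset.coe_card, List.length_cons, pow_succ']
      exact Submodule.mul_mem_mul ⟨_, rfl⟩ ih

theorem mem_wordGE_iff {q : ℕ} {a : FreeCGA 𝒱} :
    a ∈ wordGE 𝒱 q ↔ a ∈ B.supported fun S => q ≤ S.card := by
  rw [FreeCGA.mem_wordGE]
  constructor
  · intro h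
    refine (iSup₂_le fun j hj => ?_ : (⨆ (j : ℕ) (_ : q ≤ j), word 𝒱 j) ≤ _) h
    rw [B.word_eq]
    exact supported_mono fun S hS => by rw [hS]; exact hj
  · intro h
    refine (B.supported_le fun l hl => ?_ : _ ≤ ⨆ (j : ℕ) (_ : q ≤ j), word 𝒱 j) h
    refine (le_iSup₂ (f := fun (j : ℕ) (_ : q ≤ j) => word 𝒱 j) _ hl) ?_
    rw [B.word_eq]
    exact listProd_mem rfl

theorem subLambda_le {U : Submodule k V} {p : I → Prop}
    (h : ∀ v ∈ U, ∀ i, B.b.repr v i ≠ 0 → p i) {a : FreeCGA 𝒱} (ha : a ∈ subLambda 𝒱 U) :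
    a ∈ B.supported fun S => ∀ i ∈ S, p i := by
  unfold subLambda at ha
  induction ha using Algebra.adjoin_induction with
  | mem y hy =>
    obtain ⟨v, hv, rfl⟩ := hy
    exact B.ι_mem_supported fun i hi => by simpa using h v hv i hi
  | algebraMap c =>
    rw [Algebra.algebraMap_eq_smul_one]
    exact Submodule.smul_mem _ _ (B.one_mem_supported (by simp))
  | add y z _ _ h1 h2 => exact add_mem h1 h2
  | mul y z _ _ h1 h2 =>
    refine mul_mem_supported ?_ h1 h2
    intro S T hS hT i hi
    exact (Multiset.mem_add.1 hi).elim (hS i) (hT i)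

/-! ### Odd derivations -/

/-- The sign involution `a ↦ (-1)^{|a|} a`. -/
def sgn : FreeCGA 𝒱 →ₐ[k] FreeCGA 𝒱 :=
  B.lift (fun i => ((-1) ^ B.deg i : k) • B.x i) fun i j => by
    rw [smul_mul_smul_comm, B.x_comm i j, smul_mul_smul_comm, mul_smul_comm,
      mul_comm ((-1 : k) ^ B.deg i)]

@[simp] theorem sgn_x (i : I) : B.sgn (B.x i) = ((-1) ^ B.deg i : k) • B.x i := B.lift_x _ _ i

theorem sgn_listProd (l : List I) :
    B.sgn (B.listProd l) = ((-1) ^ (l.map B.deg).sum : k) • B.listProd l := by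
  induction l with
  | nil => simp
  | cons i l ih =>
    rw [listProd_cons, map_mul, ih, sgn_x, smul_mul_smul_comm, List.map_cons, List.sum_cons,
      pow_add]

theorem sgn_of_mem {n : ℕ} {a : FreeCGA 𝒱}
    (ha : a ∈ B.supported fun S => (-1 : k) ^ (S.map B.deg).sum = (-1) ^ n) :
    B.sgn a = ((-1) ^ n : k) • a := by
  refine linearMap_eqOn (f := B.sgn.toLinearMap) (g := ((-1) ^ n : k) • LinearMap.id) ?_ ha
  intro l hl
  simp only [Multiset.map_coe, Multiset.sum_coe] at hl
  simp [sgn_listProd, hl]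

theorem sgn_of_mem_degree {n : ℕ} {a : FreeCGA 𝒱} (ha : a ∈ degree 𝒱 n) :
    B.sgn a = ((-1) ^ n : k) • a := by
  rw [B.degree_eq] at ha
  exact B.sgn_of_mem (supported_mono (fun S hS => by rw [hS]) ha)

theorem sgn_sgn (a : FreeCGA 𝒱) : B.sgn (B.sgn a) = a := by
  refine B.algHom_ext (f := B.sgn.comp B.sgn) (g := AlgHom.id k _) (fun i => ?_) a
  simp [smul_smul, FreeCGA.neg_one_pow_mul_self]

theorem mul_x_of_mem {n : ℕ} {a : FreeCGA 𝒱}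
    (ha : a ∈ B.supported fun S => (-1 : k) ^ (S.map B.deg).sum = (-1) ^ n) (j : I) :
    a * B.x j = ((-1) ^ (n * B.deg j) : k) • (B.x j * a) := by
  refine linearMap_eqOn (f := LinearMap.mulRight k (B.x j))
    (g := ((-1) ^ (n * B.deg j) : k) • LinearMap.mulLeft k (B.x j)) ?_ ha
  intro l hl
  simp only [Multiset.map_coe, Multiset.sum_coe] at hl
  have key : B.listProd l * B.x j =
      ((-1) ^ ((l.map B.deg).sum * B.deg j) : k) • (B.x j * B.listProd l) := by
    clear hl
    induction l with
    | nil => simp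
    | cons i l ih =>
      rw [listProd_cons, mul_assoc, ih, mul_smul_comm, ← mul_assoc, B.x_comm_smul i j,
        smul_mul_assoc, smul_smul, mul_assoc, ← pow_add]
      congr 2
      simp; ring
  simp [key, pow_mul, hl]

/-- An odd derivation of `ΛV`. -/
structure OddDerivation where
  /-- the underlying linear map -/
  toLin : FreeCGA 𝒱 →ₗ[k] FreeCGA 𝒱
  map_mul : ∀ a b, toLin (a * b) = toLin a * b + B.sgn a * toLin b
  sgn_map : ∀ a, B.sgn (toLin a) = - toLin (B.sgn a)

/-- A family of values on the letters with the parities required of an odd derivation. -/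
def IsOddFamily (g : I → FreeCGA 𝒱) : Prop :=
  ∀ i, g i ∈ B.supported fun S => (-1 : k) ^ (S.map B.deg).sum = (-1) ^ (B.deg i + 1)

/-- The morphism `a ↦ [[(-1)^{|a|} a, θ a], [0, a]]` of `ΛV` to the `2 × 2` matrices over `ΛV`; its
upper right entry is the odd derivation `θ` with prescribed values `g` on the letters. -/
def matrixHom (g : I → FreeCGA 𝒱) (hg : B.IsOddFamily g) :
    FreeCGA 𝒱 →ₐ[k] Matrix (Fin 2) (Fin 2) (FreeCGA 𝒱) :=
  B.lift (fun i => !![B.sgn (B.x i), g i; 0, B.x i]) fun i j => by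
    have h1 : B.sgn (B.x i) * g j + g i * B.x j =
        ((-1) ^ (B.deg i * B.deg j) : k) • (B.sgn (B.x j) * g i + g j * B.x i) := by
      rw [B.mul_x_of_mem (hg i), B.mul_x_of_mem (hg j), sgn_x, sgn_x, smul_mul_assoc,
        smul_mul_assoc, smul_add, smul_smul, smul_smul, add_comm, ← pow_add, ← pow_add]
      congr 2
      · congr 1; ring
      · have : B.deg i * B.deg j + (B.deg j + 1) * B.deg i =
            2 * (B.deg i * B.deg j) + B.deg i := by ring
        rw [this, pow_add, pow_mul]; simp
    have h2 : B.sgn (B.x i) * B.sgn (B.x j) =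
        ((-1) ^ (B.deg i * B.deg j) : k) • (B.sgn (B.x j) * B.sgn (B.x i)) := by
      rw [← map_mul, B.x_comm_smul i j, map_smul, map_mul]
    rw [neg_one_pow_eq_smul (k := k) (R := Matrix (Fin 2) (Fin 2) (FreeCGA 𝒱)), smul_mul_assoc,
      one_mul, Matrix.mul_fin_two, Matrix.mul_fin_two, Matrix.smul_of]
    simp only [Matrix.smul_cons, Matrix.smul_empty, mul_zero, zero_mul, add_zero, zero_add,
      smul_zero, h1, h2, B.x_comm_smul i j]

theorem matrixHom_entries (g : I → FreeCGA 𝒱) (hg : B.IsOddFamily g) (a : FreeCGA 𝒱) :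
    B.matrixHom g hg a 0 0 = B.sgn a ∧ B.matrixHom g hg a 1 0 = 0 ∧ B.matrixHom g hg a 1 1 = a := by
  induction a using FreeCGA.induction with
  | h1 c => simp [Matrix.algebraMap_matrix_apply]
  | hι v =>
    refine ⟨?_, ?_, ?_⟩
    · exact B.linearMap_ι_eq (f := Matrix.entryLinearMap k (FreeCGA 𝒱) 0 0 ∘ₗ
        (B.matrixHom g hg).toLinearMap) (g := B.sgn.toLinearMap) (by simp [matrixHom]) v
    · exact B.linearMap_ι_eq (f := Matrix.entryLinearMap k (FreeCGA 𝒱) 1 0 ∘ₗ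
        (B.matrixHom g hg).toLinearMap) (g := 0) (by simp [matrixHom]) v
    · exact B.linearMap_ι_eq (f := Matrix.entryLinearMap k (FreeCGA 𝒱) 1 1 ∘ₗ
        (B.matrixHom g hg).toLinearMap) (g := LinearMap.id) (by simp [matrixHom]) v
  | ha a b h1 h2 => simp [h1, h2]
  | hm a b h1 h2 => simp [Matrix.mul_apply, Fin.sum_univ_two, h1, h2]

/-- The odd derivation with prescribed values on the letters. -/
def oddDerivation (g : I → FreeCGA 𝒱) (hg : B.IsOddFamily g) : B.OddDerivation where
  toLin := Matrix.entryLinearMap k (FreeCGA 𝒱) 0 1 ∘ₗ (B.matrixHom g hg).toLinearMap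
  map_mul a b := by
    simp only [LinearMap.comp_apply, AlgHom.toLinearMap_apply, Matrix.entryLinearMap_apply,
      _root_.map_mul, Matrix.mul_apply, Fin.sum_univ_two, (B.matrixHom_entries g hg a).1,
      (B.matrixHom_entries g hg b).2.2]
    rw [add_comm]
  sgn_map a := by
    refine B.linearMap_ext (f := B.sgn.toLinearMap ∘ₗ Matrix.entryLinearMap k (FreeCGA 𝒱) 0 1 ∘ₗ
      (B.matrixHom g hg).toLinearMap) (g := -(Matrix.entryLinearMap k (FreeCGA 𝒱) 0 1 ∘ₗ
      (B.matrixHom g hg).toLinearMap ∘ₗ B.sgn.toLinearMap)) (fun l => ?_) a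
    simp only [LinearMap.comp_apply, AlgHom.toLinearMap_apply, Matrix.entryLinearMap_apply,
      LinearMap.neg_apply]
    induction l with
    | nil => simp
    | cons i l ih =>
      have h1 : B.sgn (B.matrixHom g hg (B.x i) 0 1) = - B.matrixHom g hg (B.sgn (B.x i)) 0 1 := by
        simp [matrixHom, B.sgn_of_mem (hg i), pow_succ]
      simp only [listProd_cons, _root_.map_mul, Matrix.mul_apply, Fin.sum_univ_two,
        B.matrixHom_entries, map_add, ih, h1, sgn_sgn]
      rw [neg_add, neg_mul, mul_neg]

@[simp]
theorem oddDerivation_x (g : I → FreeCGA 𝒱) (hg : B.IsOddFamily g) (i : I) :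
    (B.oddDerivation g hg).toLin (B.x i) = g i := by
  simp [oddDerivation, matrixHom]

/-- A differential is an odd derivation. -/
def ofDifferential (d : Differential 𝒱) : B.OddDerivation where
  toLin := d.toLin
  map_mul a b := by
    refine B.linearMap_ext (f := d.toLin ∘ₗ LinearMap.mulRight k b)
      (g := LinearMap.mulRight k b ∘ₗ d.toLin +
        LinearMap.mulRight k (d.toLin b) ∘ₗ B.sgn.toLinearMap) (fun l => ?_) a
    simp only [LinearMap.comp_apply, LinearMap.mulRight_apply, LinearMap.add_apply,
      AlgHom.toLinearMap_apply]
    rw [d.leibniz _ _ (B.listProd_mem_degree l), sgn_listProd,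
      neg_one_pow_eq_smul (k := k) (R := FreeCGA 𝒱), smul_mul_assoc, one_mul, smul_mul_assoc]
  sgn_map a := by
    refine B.linearMap_ext (f := B.sgn.toLinearMap ∘ₗ d.toLin)
      (g := -(d.toLin ∘ₗ B.sgn.toLinearMap)) (fun l => ?_) a
    simp only [LinearMap.comp_apply, LinearMap.neg_apply, AlgHom.toLinearMap_apply]
    rw [B.sgn_of_mem_degree (d.degree_succ _ _ (B.listProd_mem_degree l)), sgn_listProd, map_smul,
      pow_succ, mul_neg_one, neg_smul]

/-- A derivation relative to the sign rule `σ` (which is the sign involution for odd derivations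
and the identity for even ones). -/
def IsSkewDerivation (σ : FreeCGA 𝒱 →ₐ[k] FreeCGA 𝒱) (θ : FreeCGA 𝒱 →ₗ[k] FreeCGA 𝒱) : Prop :=
  (∀ i, ∃ c : k, σ (B.x i) = c • B.x i) ∧ ∀ a b, θ (a * b) = θ a * b + σ a * θ b

variable {B}

theorem OddDerivation.isSkewDerivation (θ : B.OddDerivation) :
    B.IsSkewDerivation B.sgn θ.toLin :=
  ⟨fun i => ⟨_, B.sgn_x i⟩, θ.map_mul⟩

/-- The graded commutator of two odd derivations is an even derivation. -/
theorem OddDerivation.isSkewDerivation_comm (θ η : B.OddDerivation) :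
    B.IsSkewDerivation (AlgHom.id k _) (θ.toLin ∘ₗ η.toLin + η.toLin ∘ₗ θ.toLin) := by
  refine ⟨fun i => ⟨1, by simp⟩, fun a b => ?_⟩
  simp only [LinearMap.add_apply, LinearMap.comp_apply, θ.map_mul, η.map_mul, map_add, sgn_sgn,
    θ.sgn_map, η.sgn_map, AlgHom.id_apply]
  noncomm_ring

/-- The square of an odd derivation is an even derivation. -/
theorem OddDerivation.isSkewDerivation_sq (θ : B.OddDerivation) :
    B.IsSkewDerivation (AlgHom.id k _) (θ.toLin ∘ₗ θ.toLin) := by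
  refine ⟨fun i => ⟨1, by simp⟩, fun a b => ?_⟩
  simp only [LinearMap.comp_apply, θ.map_mul, map_add, sgn_sgn, θ.sgn_map, AlgHom.id_apply]
  noncomm_ring

namespace IsSkewDerivation

variable {σ : FreeCGA 𝒱 →ₐ[k] FreeCGA 𝒱} {θ η : FreeCGA 𝒱 →ₗ[k] FreeCGA 𝒱}

theorem map_one (h : B.IsSkewDerivation σ θ) : θ 1 = 0 := by
  have := h.2 1 1
  simpa using this

/-- A derivation rewrites one letter of a monomial. -/
theorem listProd_mem {ρ : I → Multiset I → Prop} (h : B.IsSkewDerivation σ θ)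
    (hρ : ∀ i, θ (B.x i) ∈ B.supported (ρ i)) (l : List I) :
    θ (B.listProd l) ∈ B.supported fun S => Step ρ S l := by
  induction l with
  | nil => simp [h.map_one]
  | cons i l ih =>
    rw [listProd_cons, h.2, ← Multiset.cons_coe]
    refine add_mem ?_ ?_
    · refine mul_mem_supported (q := (· = (l : Multiset I))) ?_ (hρ i)
        (GradedBasis.listProd_mem rfl)
      rintro T _ hT rfl
      exact Step.head hT _
    · obtain ⟨c, hc⟩ := h.1 i
      rw [hc, smul_mul_assoc]
      refine Submodule.smul_mem _ _
        (mul_mem_supported (p := (· = {i})) ?_ (B.x_mem_supported rfl) ih)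
      rintro _ S rfl hS
      exact hS.add_left {i}

theorem map_mem {ρ : I → Multiset I → Prop} (h : B.IsSkewDerivation σ θ)
    (hρ : ∀ i, θ (B.x i) ∈ B.supported (ρ i)) {p q : Multiset I → Prop}
    (hpq : ∀ S' S, Step ρ S' S → p S → q S') {a : FreeCGA 𝒱} (ha : a ∈ B.supported p) :
    θ a ∈ B.supported q :=
  map_mem_of_listProd θ (fun l hl => supported_mono (fun S hS => hpq S _ hS hl)
    (h.listProd_mem hρ l)) ha

theorem ext (h : B.IsSkewDerivation σ θ) (h' : B.IsSkewDerivation σ η)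
    (e : ∀ i, θ (B.x i) = η (B.x i)) (a : FreeCGA 𝒱) : θ a = η a := by
  induction a using FreeCGA.induction with
  | h1 c => rw [Algebra.algebraMap_eq_smul_one, map_smul, map_smul, h.map_one, h'.map_one]
  | hι v => exact B.linearMap_ι_eq e v
  | ha a b h1 h2 => rw [map_add, map_add, h1, h2]
  | hm a b h1 h2 => rw [h.2, h'.2, h1, h2]

end IsSkewDerivation

/-- An even derivation which multiplies each letter `i` by the number `w i`, up to terms in
`ρ i`, multiplies each monomial by the total weight of its letters, up to terms which arise by
rewriting a letter. -/
theorem IsSkewDerivation.sub_weight_mem {θ : FreeCGA 𝒱 →ₗ[k] FreeCGA 𝒱}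
    (h : B.IsSkewDerivation (AlgHom.id k _) θ) (w : I → ℕ) {ρ : I → Multiset I → Prop}
    (hρ : ∀ i, θ (B.x i) - (w i : k) • B.x i ∈ B.supported (ρ i)) (l : List I) :
    θ (B.listProd l) - (((l : Multiset I).map w).sum : k) • B.listProd l ∈
      B.supported fun S => Step ρ S l := by
  induction l with
  | nil => simp [h.map_one]
  | cons i l ih =>
    have e : θ (B.listProd (i :: l)) - ((((i :: l : List I) : Multiset I).map w).sum : k) •
        B.listProd (i :: l) = (θ (B.x i) - (w i : k) • B.x i) * B.listProd l +
          B.x i * (θ (B.listProd l) - (((l : Multiset I).map w).sum : k) • B.listProd l) := by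
      rw [listProd_cons, h.2, AlgHom.id_apply, sub_mul, mul_sub, smul_mul_assoc, mul_smul_comm,
        ← Multiset.cons_coe, Multiset.map_cons, Multiset.sum_cons, Nat.cast_add, add_smul]
      abel
    rw [e, ← Multiset.cons_coe]
    refine add_mem ?_ ?_
    · refine mul_mem_supported (q := (· = (l : Multiset I))) ?_ (hρ i)
        (GradedBasis.listProd_mem rfl)
      rintro T _ hT rfl
      exact Step.head hT _
    · refine mul_mem_supported (p := (· = {i})) ?_ (B.x_mem_supported rfl) ih
      rintro _ S rfl hS
      exact hS.add_left {i}

/-! ### Triangular operators -/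

section Triangular

variable {lt : Multiset I → Multiset I → Prop} {T : FreeCGA 𝒱 →ₗ[k] FreeCGA 𝒱}
  {c : Multiset I → k} {p : Multiset I → Prop}

theorem triangular_mem (hp : ∀ S S', p S → lt S' S → p S')
    (hT : ∀ l : List I, p l → T (B.listProd l) - c l • B.listProd l ∈ B.supported fun S => lt S l)
    {a : FreeCGA 𝒱} (ha : a ∈ B.supported p) : T a ∈ B.supported p := by
  refine map_mem_of_listProd T (fun l hl => ?_) ha
  have := add_mem (supported_mono (fun S hS => hp _ S hl hS) (hT l hl))
    (Submodule.smul_mem _ (c l) (listProd_mem (B := B) hl))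
  simpa using this

/-- An operator which multiplies each monomial by a non-zero scalar, up to smaller monomials, is
surjective on each subspace spanned by a downward closed set of monomials. -/
theorem triangular_surjective (wf : WellFounded lt) (hp : ∀ S S', p S → lt S' S → p S')
    (hc : ∀ S, p S → c S ≠ 0)
    (hT : ∀ l : List I, p l → T (B.listProd l) - c l • B.listProd l ∈ B.supported fun S => lt S l)
    {a : FreeCGA 𝒱} (ha : a ∈ B.supported p) : ∃ b ∈ B.supported p, T b = a := by
  have key : ∀ S : Multiset I, ∀ l : List I, (l : Multiset I) = S → p S →
      B.listProd l ∈ (B.supported p).map T := by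
    intro S
    induction S using wf.induction with
    | _ S ih =>
      rintro l rfl hl
      have h1 : T (B.listProd l) - c l • B.listProd l ∈ (B.supported p).map T :=
        (B.supported_le fun l' hl' => ih _ hl' l' rfl (hp _ _ hl hl')) (hT l hl)
      have h2 := sub_mem (Submodule.mem_map_of_mem (f := T) (listProd_mem (B := B) hl)) h1
      rw [sub_sub_cancel] at h2
      have h3 := Submodule.smul_mem _ (c l)⁻¹ h2
      rwa [smul_smul, inv_mul_cancel₀ (hc _ hl), one_smul] at h3
  exact (B.supported_le fun l hl => key _ l rfl hl : B.supported p ≤ _) ha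

/-- An operator which multiplies each monomial by a non-zero scalar, up to smaller monomials, is
injective: it does not kill the maximal monomials of an element. -/
theorem triangular_injective [CharZero k] (wf : WellFounded lt)
    (htr : ∀ S S' S'', lt S S' → lt S' S'' → lt S S'')
    (hc : ∀ S, p S → c S ≠ 0)
    (hT : ∀ l : List I, p l → T (B.listProd l) - c l • B.listProd l ∈ B.supported fun S => lt S l)
    {a : FreeCGA 𝒱} (ha : a ∈ B.supported p) (h0 : T a = 0) : a = 0 := by
  classical
  by_contra hne
  let s : Finset {S : Multiset I // B.Adm S} := (B.basis.repr a).support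
  have hs : s.Nonempty := Finsupp.support_nonempty_iff.2 (by simpa using hne)
  -- a monomial of `a` which is maximal with respect to the well-founded order
  let r : {S : Multiset I // B.Adm S} → {S : Multiset I // B.Adm S} → Prop := fun S S' => lt S' S
  have : IsStrictOrder _ r :=
    { irrefl := fun S h => (wf.irrefl (r := lt)).irrefl _ h
      trans := fun S S' S'' h h' => htr _ _ _ h' h }
  have hwf : (s : Set _).WellFoundedOn r := s.finite_toSet.wellFoundedOn
  obtain ⟨S₀, hS₀⟩ := hs
  obtain ⟨⟨S, hS⟩, -, hmax⟩ := WellFounded.has_min hwf Set.univ ⟨⟨S₀, hS₀⟩, trivial⟩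
  have hb : ∀ S' : {S : Multiset I // B.Adm S}, p S' → S' ∈ s →
      B.basis.repr (T (B.basis S')) S = if S' = S then c S else 0 := by
    intro S' hpS' hS'
    have h1 := hT S'.1.toList (by simpa using hpS')
    rw [← basis_apply, Multiset.coe_toList, mem_supported_iff] at h1
    have h2 : B.basis.repr (T (B.basis S') - c S' • B.basis S') S = 0 := by
      by_contra h
      exact hmax ⟨S', hS'⟩ trivial (h1 S h)
    rw [map_sub, map_smul, Module.Basis.repr_self, Finsupp.sub_apply, Finsupp.smul_apply,
      Finsupp.single_apply, sub_eq_zero] at h2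
    rw [h2]
    split_ifs with h
    · simp [h]
    · simp
  have hpS : ∀ S' ∈ s, p S'.1 := fun S' hS' =>
    B.mem_supported_iff.1 ha S' (by simpa [s] using hS')
  have h1 : B.basis.repr (T a) S = B.basis.repr a S * c S := by
    conv_lhs => rw [← B.basis.linearCombination_repr a]
    rw [Finsupp.linearCombination_apply, Finsupp.sum, map_sum, map_sum, Finsupp.finsetSum_apply]
    rw [Finset.sum_eq_single S]
    · rw [map_smul, map_smul, Finsupp.smul_apply, hb S (hpS S hS) hS, if_pos rfl, smul_eq_mul]
    · intro S' hS' hne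
      rw [map_smul, map_smul, Finsupp.smul_apply, hb S' (hpS S' hS') hS', if_neg hne, smul_zero]
    · intro h; exact absurd hS h
  rw [h0, map_zero, Finsupp.zero_apply] at h1
  exact mul_ne_zero (Finsupp.mem_support_iff.1 hS) (hc _ (hpS S hS)) h1.symm

end Triangular

end GradedBasis

end FreeCGA

/-! ### Monomials in `ΛZ ⊗ ΛY` -/

section SumParts

variable {I J : Type*}

/-- The letters of a multiset which come from the base. -/
def basePart (S : Multiset (I ⊕ J)) : Multiset I := S.bind (Sum.elim (fun i => {i}) fun _ => 0)

/-- The letters of a multiset which come from the fiber. -/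
def fiberPart (S : Multiset (I ⊕ J)) : Multiset J := S.bind (Sum.elim (fun _ => 0) fun j => {j})

@[simp] theorem basePart_add (S T : Multiset (I ⊕ J)) :
    basePart (S + T) = basePart S + basePart T := Multiset.add_bind _ _ _

@[simp] theorem fiberPart_add (S T : Multiset (I ⊕ J)) :
    fiberPart (S + T) = fiberPart S + fiberPart T := Multiset.add_bind _ _ _

@[simp] theorem basePart_cons_inl (i : I) (S : Multiset (I ⊕ J)) :
    basePart (Sum.inl i ::ₘ S) = i ::ₘ basePart S := by simp [basePart]

@[simp] theorem basePart_cons_inr (j : J) (S : Multiset (I ⊕ J)) :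
    basePart (Sum.inr j ::ₘ S) = basePart S := by simp [basePart]

@[simp] theorem fiberPart_cons_inl (i : I) (S : Multiset (I ⊕ J)) :
    fiberPart (Sum.inl i ::ₘ S) = fiberPart S := by simp [fiberPart]

@[simp] theorem fiberPart_cons_inr (j : J) (S : Multiset (I ⊕ J)) :
    fiberPart (Sum.inr j ::ₘ S) = j ::ₘ fiberPart S := by simp [fiberPart]

@[simp] theorem basePart_map_inl (S : Multiset I) :
    basePart (S.map (Sum.inl : I → I ⊕ J)) = S := by
  induction S using Multiset.induction with
  | empty => rfl
  | cons i S ih => rw [Multiset.map_cons, basePart_cons_inl, ih]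

@[simp] theorem basePart_map_inr (T : Multiset J) :
    basePart (T.map (Sum.inr : J → I ⊕ J)) = 0 := by simp [basePart, Multiset.bind_map]

@[simp] theorem fiberPart_map_inl (S : Multiset I) :
    fiberPart (S.map (Sum.inl : I → I ⊕ J)) = 0 := by simp [fiberPart, Multiset.bind_map]

@[simp] theorem fiberPart_map_inr (T : Multiset J) :
    fiberPart (T.map (Sum.inr : J → I ⊕ J)) = T := by
  induction T using Multiset.induction with
  | empty => rfl
  | cons j T ih => rw [Multiset.map_cons, fiberPart_cons_inr, ih]

theorem map_basePart_add (S : Multiset (I ⊕ J)) :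
    (basePart S).map Sum.inl + (fiberPart S).map Sum.inr = S := by
  induction S using Multiset.induction with
  | empty => rfl
  | cons a S ih => rcases a with i | j <;> simp [ih]

theorem card_parts (S : Multiset (I ⊕ J)) :
    (basePart S).card + (fiberPart S).card = S.card := by
  conv_rhs => rw [← map_basePart_add S]
  simp

theorem mem_basePart {i : I} {S : Multiset (I ⊕ J)} : i ∈ basePart S ↔ Sum.inl i ∈ S := by
  conv_rhs => rw [← map_basePart_add S]
  simp

theorem mem_fiberPart {j : J} {S : Multiset (I ⊕ J)} : j ∈ fiberPart S ↔ Sum.inr j ∈ S := by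
  conv_rhs => rw [← map_basePart_add S]
  simp

end SumParts

namespace FreeCGA

namespace GradedBasis

variable {k : Type u} [Field k] {Z Y : Type u} [AddCommGroup Z] [Module k Z]
  [AddCommGroup Y] [Module k Y] {𝒵 : ℕ → Submodule k Z} {𝒴 : ℕ → Submodule k Y} {I J : Type u}

/-- The homogeneous basis of `Z ⊕ Y` given by homogeneous bases of `Z` and of `Y`. -/
def sum (BZ : GradedBasis 𝒵 I) (BY : GradedBasis 𝒴 J) : GradedBasis (sumGrading 𝒵 𝒴) (I ⊕ J) where
  b := BZ.b.prod BY.b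
  deg := Sum.elim BZ.deg BY.deg
  mem := by
    rintro (i | j)
    · simpa using ⟨BZ.mem i, zero_mem _⟩
    · simpa using ⟨zero_mem _, BY.mem j⟩
  deg_of_mem := by
    rintro n ⟨z, y⟩ ⟨hz, hy⟩ (i | j) h
    · exact BZ.deg_of_mem n z hz i (by simpa using h)
    · exact BY.deg_of_mem n y hy j (by simpa using h)

@[simp] theorem sum_deg_inl (BZ : GradedBasis 𝒵 I) (BY : GradedBasis 𝒴 J) (i : I) :
    (BZ.sum BY).deg (Sum.inl i) = BZ.deg i := rfl

@[simp] theorem sum_deg_inr (BZ : GradedBasis 𝒵 I) (BY : GradedBasis 𝒴 J) (j : J) :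
    (BZ.sum BY).deg (Sum.inr j) = BY.deg j := rfl

variable (BZ : GradedBasis 𝒵 I) (BY : GradedBasis 𝒴 J)

@[simp] theorem inclBase_x (i : I) :
    inclBase 𝒵 𝒴 (BZ.x i) = (BZ.sum BY).x (Sum.inl i) := by
  refine (FreeCGA.map_ι ..).trans ?_
  simp [x, sum]

@[simp] theorem inclFiber_x (j : J) :
    inclFiber 𝒵 𝒴 (BY.x j) = (BZ.sum BY).x (Sum.inr j) := by
  refine (FreeCGA.map_ι ..).trans ?_
  simp [x, sum]

@[simp] theorem projFiber_x_inl (i : I) : projFiber 𝒵 𝒴 ((BZ.sum BY).x (Sum.inl i)) = 0 := by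
  refine (FreeCGA.map_ι ..).trans ?_
  simp [sum]

@[simp] theorem projFiber_x_inr (j : J) :
    projFiber 𝒵 𝒴 ((BZ.sum BY).x (Sum.inr j)) = BY.x j := by
  refine (FreeCGA.map_ι ..).trans ?_
  simp [x, sum]

theorem inclBase_listProd (l : List I) :
    inclBase 𝒵 𝒴 (BZ.listProd l) = (BZ.sum BY).listProd (l.map Sum.inl) := by
  induction l with
  | nil => simp
  | cons i l ih => rw [listProd_cons, map_mul, ih, inclBase_x BZ BY, List.map_cons, listProd_cons]

theorem inclFiber_listProd (l : List J) :
    inclFiber 𝒵 𝒴 (BY.listProd l) = (BZ.sum BY).listProd (l.map Sum.inr) := by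
  induction l with
  | nil => simp
  | cons i l ih => rw [listProd_cons, map_mul, ih, inclFiber_x BZ BY, List.map_cons, listProd_cons]

variable {BZ} in
theorem inclBase_mem {p : Multiset I → Prop} {a : FreeCGA 𝒵} (ha : a ∈ BZ.supported p) :
    inclBase 𝒵 𝒴 a ∈ (BZ.sum BY).supported fun S => fiberPart S = 0 ∧ p (basePart S) := by
  refine map_mem_of_listProd (inclBase 𝒵 𝒴).toLinearMap (fun l hl => ?_) ha
  change inclBase 𝒵 𝒴 (BZ.listProd l) ∈ _
  rw [inclBase_listProd BZ BY]
  refine listProd_mem ?_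
  rw [← Multiset.map_coe, fiberPart_map_inl, basePart_map_inl]
  exact ⟨rfl, hl⟩

variable {BY} in
theorem inclFiber_mem {p : Multiset J → Prop} {a : FreeCGA 𝒴} (ha : a ∈ BY.supported p) :
    inclFiber 𝒵 𝒴 a ∈ (BZ.sum BY).supported fun S => basePart S = 0 ∧ p (fiberPart S) := by
  refine map_mem_of_listProd (inclFiber 𝒵 𝒴).toLinearMap (fun l hl => ?_) ha
  change inclFiber 𝒵 𝒴 (BY.listProd l) ∈ _
  rw [inclFiber_listProd BZ BY]
  refine listProd_mem ?_
  rw [← Multiset.map_coe, fiberPart_map_inr, basePart_map_inr]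
  exact ⟨rfl, hl⟩

variable {BZ BY} in
theorem projFiber_mem {p : Multiset (I ⊕ J) → Prop} {a : FreeCGA (sumGrading 𝒵 𝒴)}
    (ha : a ∈ (BZ.sum BY).supported p) :
    projFiber 𝒵 𝒴 a ∈ BY.supported fun T => p (T.map Sum.inr) := by
  refine map_mem_of_listProd (projFiber 𝒵 𝒴).toLinearMap (fun l hl => ?_) ha
  change projFiber 𝒵 𝒴 ((BZ.sum BY).listProd l) ∈ _
  have key : (∃ l' : List J, l = l'.map Sum.inr ∧
      projFiber 𝒵 𝒴 ((BZ.sum BY).listProd l) = BY.listProd l') ∨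
      projFiber 𝒵 𝒴 ((BZ.sum BY).listProd l) = 0 := by
    clear hl
    induction l with
    | nil => exact Or.inl ⟨[], by simp⟩
    | cons a l ih =>
      rw [listProd_cons, map_mul]
      rcases ih with ⟨l', rfl, h⟩ | h
      · rcases a with i | j
        · right; simp
        · left
          exact ⟨j :: l', by simp, by rw [h]; simp⟩
      · right; rw [h, mul_zero]
  rcases key with ⟨l', rfl, h⟩ | h
  · rw [h]
    exact listProd_mem (by rw [Multiset.map_coe]; exact hl)
  · rw [h]; exact zero_mem _

@[simp] theorem projFiber_inclFiber (BY : GradedBasis 𝒴 J) (a : FreeCGA 𝒴) :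
    projFiber 𝒵 𝒴 (inclFiber 𝒵 𝒴 a) = a := by
  refine BY.algHom_ext (f := (projFiber 𝒵 𝒴).comp (inclFiber 𝒵 𝒴)) (g := AlgHom.id k _)
    (fun j => ?_) a
  change projFiber 𝒵 𝒴 (inclFiber 𝒵 𝒴 (ι 𝒴 (BY.b j))) = ι 𝒴 (BY.b j)
  refine (congrArg _ (FreeCGA.map_ι ..)).trans ((FreeCGA.map_ι ..).trans ?_)
  rfl

/-- The kernel of the projection to the fiber consists of the combinations of monomials which
contain a letter of the base. -/
theorem sub_inclFiber_projFiber_mem (a : FreeCGA (sumGrading 𝒵 𝒴)) :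
    a - inclFiber 𝒵 𝒴 (projFiber 𝒵 𝒴 a) ∈ (BZ.sum BY).supported fun S => 1 ≤ (basePart S).card := by
  refine map_mem_of_listProd (LinearMap.id - (inclFiber 𝒵 𝒴).toLinearMap ∘ₗ
    (projFiber 𝒵 𝒴).toLinearMap) (fun l _ => ?_) ((BZ.sum BY).mem_supported_true a)
  change (BZ.sum BY).listProd l - inclFiber 𝒵 𝒴 (projFiber 𝒵 𝒴 ((BZ.sum BY).listProd l)) ∈ _
  induction l with
  | nil => simp
  | cons c l ih =>
    rw [listProd_cons]
    rcases c with i | j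
    · rw [map_mul, projFiber_x_inl, zero_mul, map_zero, sub_zero, ← listProd_cons]
      refine listProd_mem ?_
      rw [← Multiset.cons_coe, basePart_cons_inl, Multiset.card_cons]
      omega
    · rw [map_mul, map_mul, projFiber_x_inr, inclFiber_x BZ BY, ← mul_sub]
      exact mul_mem_supported (p := fun _ => True) (fun S T _ h => by simp; omega)
        ((BZ.sum BY).mem_supported_true _) ih

theorem exists_listProd_sum (l : List (I ⊕ J)) : ∃ ε : k, ∃ (l₁ : List I) (l₂ : List J),
    (l₁ : Multiset I) = basePart (l : Multiset (I ⊕ J)) ∧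
    (l₂ : Multiset J) = fiberPart (l : Multiset (I ⊕ J)) ∧
    (BZ.sum BY).listProd l =
      ε • (inclBase 𝒵 𝒴 (BZ.listProd l₁) * inclFiber 𝒵 𝒴 (BY.listProd l₂)) := by
  let l₁ := (basePart (l : Multiset (I ⊕ J))).toList
  let l₂ := (fiberPart (l : Multiset (I ⊕ J))).toList
  have h : l.Perm (l₁.map Sum.inl ++ l₂.map Sum.inr) := by
    rw [← Multiset.coe_eq_coe, ← Multiset.coe_add, ← Multiset.map_coe, ← Multiset.map_coe]
    simp only [l₁, l₂, Multiset.coe_toList, map_basePart_add]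
  obtain ⟨ε, -, e⟩ := (BZ.sum BY).listProd_perm h
  refine ⟨ε, l₁, l₂, by simp [l₁], by simp [l₂], ?_⟩
  rw [e, listProd_append, inclBase_listProd BZ BY, inclFiber_listProd BZ BY]

theorem adm_sum {S : Multiset I} {T : Multiset J} (hS : BZ.Adm S) (hT : BY.Adm T) :
    (BZ.sum BY).Adm (S.map Sum.inl + T.map Sum.inr) := by
  rintro (i | j) R h hodd hm
  · have h1 := congrArg basePart h
    simp only [basePart_add, basePart_map_inl, basePart_map_inr, add_zero, basePart_cons_inl] at h1
    exact hS i _ h1 hodd (mem_basePart.2 hm)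
  · have h1 := congrArg fiberPart h
    simp only [fiberPart_add, fiberPart_map_inl, fiberPart_map_inr, zero_add,
      fiberPart_cons_inr] at h1
    exact hT j _ h1 hodd (mem_fiberPart.2 hm)

end GradedBasis

end FreeCGA

/-! ### `ΛZ ⊗ ΛY` as a module over `ΛZ` -/

section BaseModule

variable {k : Type u} [Field k] {Z Y : Type u} [AddCommGroup Z] [Module k Z]
  [AddCommGroup Y] [Module k Y] {𝒵 : ℕ → Submodule k Z} {𝒴 : ℕ → Submodule k Y} {I J : Type u}

open FreeCGA GradedBasis

/-- `ΛZ ⊗ ΛY` is a module over `ΛZ` through the inclusion. -/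
@[reducible] def baseModule (𝒵 : ℕ → Submodule k Z) (𝒴 : ℕ → Submodule k Y) :
    Module (FreeCGA 𝒵) (FreeCGA (sumGrading 𝒵 𝒴)) :=
  Module.compHom _ (inclBase 𝒵 𝒴).toRingHom

attribute [local instance] baseModule

theorem base_smul_def (a : FreeCGA 𝒵) (x : FreeCGA (sumGrading 𝒵 𝒴)) :
    a • x = inclBase 𝒵 𝒴 a * x := rfl

instance baseModule_isScalarTower :
    IsScalarTower k (FreeCGA 𝒵) (FreeCGA (sumGrading 𝒵 𝒴)) :=
  ⟨fun c a x => by rw [base_smul_def, base_smul_def, map_smul, smul_mul_assoc]⟩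

variable [CharZero k]

/-- The monomials of the fiber are linearly independent over `ΛZ`. -/
theorem linearIndependent_fiberBasis (BZ : GradedBasis 𝒵 I) (BY : GradedBasis 𝒴 J) :
    LinearIndependent (FreeCGA 𝒵) fun T => inclFiber 𝒵 𝒴 (BY.basis T) := by
  let f := Finsupp.linearCombination (FreeCGA 𝒵) fun T => inclFiber 𝒵 𝒴 (BY.basis T)
  let β := Finsupp.basis fun _ : {T : Multiset J // BY.Adm T} => BZ.basis
  have h : LinearIndependent k (f.restrictScalars k ∘ β) := by
    have := (BZ.sum BY).linearIndependent_listProd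
      (fun t : (_ : {T : Multiset J // BY.Adm T}) × {S : Multiset I // BZ.Adm S} =>
        t.2.1.toList.map Sum.inl ++ t.1.1.toList.map Sum.inr) ?_ ?_
    · convert this using 1
      ext1 t
      simp only [Function.comp_apply, LinearMap.coe_restrictScalars, β, f, Finsupp.coe_basis,
        Finsupp.linearCombination_single, base_smul_def]
      rw [basis_apply, basis_apply, inclBase_listProd BZ BY, inclFiber_listProd BZ BY,
        listProd_append]
    · rintro ⟨T, S⟩ ⟨T', S'⟩ h
      simp only [← Multiset.coe_add, ← Multiset.map_coe, Multiset.coe_toList] at h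
      have h1 := congrArg basePart h
      have h2 := congrArg fiberPart h
      simp only [basePart_add, basePart_map_inl, basePart_map_inr, fiberPart_add,
        fiberPart_map_inl, fiberPart_map_inr, add_zero, zero_add] at h1 h2
      rw [Subtype.ext h1, Subtype.ext h2]
    · rintro ⟨T, S⟩
      simp only [← Multiset.coe_add, ← Multiset.map_coe, Multiset.coe_toList]
      exact adm_sum BZ BY S.2 T.2
  have hinj : Function.Injective (f.restrictScalars k) := by
    have e : f.restrictScalars k = Finsupp.linearCombination k (f.restrictScalars k ∘ β) ∘ₗ
        β.repr.toLinearMap := β.ext fun t => by simp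
    rw [e]
    have h' : Function.Injective (Finsupp.linearCombination k (f.restrictScalars k ∘ β)) := h
    rw [LinearMap.coe_comp]
    exact h'.comp β.repr.injective
  exact hinj

variable (𝒵) in
/-- The `ΛZ`-submodule of `ΛZ ⊗ ΛY` spanned by the monomials of the fiber which satisfy `p`. -/
def fiberSpan (BY : GradedBasis 𝒴 J) (p : Multiset J → Prop) :
    Submodule (FreeCGA 𝒵) (FreeCGA (sumGrading 𝒵 𝒴)) :=
  Submodule.span (FreeCGA 𝒵) (Set.range fun T : {T : {T : Multiset J // BY.Adm T} // p T} =>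
    inclFiber 𝒵 𝒴 (BY.basis T.1))

/-- The span over `ΛZ` of monomials of the fiber, described by the monomials of `ΛZ ⊗ ΛY`. -/
theorem mem_fiberSpan_iff (BZ : GradedBasis 𝒵 I) (BY : GradedBasis 𝒴 J)
    {p : Multiset J → Prop} {a : FreeCGA (sumGrading 𝒵 𝒴)} :
    a ∈ fiberSpan 𝒵 BY p ↔ a ∈ (BZ.sum BY).supported fun S => p (fiberPart S) := by
  constructor
  · intro ha
    refine Submodule.span_induction
      (p := fun a _ => a ∈ (BZ.sum BY).supported fun S => p (fiberPart S)) ?_ (zero_mem _)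
      (fun _ _ _ _ h1 h2 => add_mem h1 h2) ?_ ha
    · rintro _ ⟨T, rfl⟩
      exact supported_mono (fun S hS => hS.2) (inclFiber_mem BZ (BY.basis_mem T.2))
    · intro c x _ hx
      refine mul_mem_supported (p := fun S => fiberPart S = 0) ?_
        (supported_mono (fun S hS => hS.1) (inclBase_mem BY (BZ.mem_supported_true c))) hx
      intro S T hS hT
      rw [fiberPart_add, hS, zero_add]
      exact hT
  · intro ha
    refine ((BZ.sum BY).supported_le (N := (fiberSpan 𝒵 BY p).restrictScalars k) ?_) ha
    intro l hl
    obtain ⟨ε, l₁, l₂, h1, h2, e⟩ := exists_listProd_sum BZ BY l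
    rw [e]
    refine Submodule.smul_mem _ _ ?_
    rw [← base_smul_def]
    refine Submodule.smul_mem (fiberSpan 𝒵 BY p) _ ?_
    by_cases h : BY.Adm (l₂ : Multiset J)
    · obtain ⟨ε, -, e⟩ := BY.exists_listProd_eq_smul h
      rw [e, map_smul, ← algebraMap_smul (FreeCGA 𝒵)]
      exact Submodule.smul_mem _ _ (Submodule.subset_span ⟨⟨⟨_, h⟩, by simpa [h2] using hl⟩, rfl⟩)
    · rw [BY.listProd_eq_zero h, map_zero]; exact zero_mem _

end BaseModule

/-! ### Semifree modules -/

section Semifree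

/-- Projections which are compatible with a family of subspaces show that the family is a
grading. -/
theorem isInternal_of_projections {k M ι : Type*} [Field k] [AddCommGroup M] [Module k M]
    [DecidableEq ι] (ℳ : ι → Submodule k M) (P : ι → M →ₗ[k] M) (h1 : ∀ i, ∀ x ∈ ℳ i, P i x = x)
    (h0 : ∀ i j, i ≠ j → ∀ x ∈ ℳ j, P i x = 0) (htop : ∀ x, x ∈ ⨆ i, ℳ i) :
    DirectSum.IsInternal ℳ := by
  rw [DirectSum.isInternal_submodule_iff_iSupIndep_and_iSup_eq_top]
  refine ⟨fun i => ?_, eq_top_iff.2 fun x _ => htop x⟩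
  rw [Submodule.disjoint_def]
  intro x hx hx'
  have : (⨆ j, ⨆ (_ : j ≠ i), ℳ j) ≤ LinearMap.ker (P i) :=
    iSup₂_le fun j hj x hx => h0 i j hj.symm x hx
  rw [← h1 i x hx]
  exact this hx'

/-- If the differentials of the basis elements are combinations of basis elements which are smaller
in a well-founded order, the basis elements have finite rank, as only finitely many basis elements
occur in each differential. -/
theorem exists_rank {R M ι : Type*} [Ring R] [AddCommGroup M] [Module R M]
    (b : Module.Basis ι R M) (d : M → M) {lt : ι → ι → Prop} (wf : WellFounded lt)
    (h : ∀ i j, b.repr (d (b i)) j ≠ 0 → lt j i) :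
    ∃ rank : ι → ℕ, ∀ i, d (b i) ∈ Submodule.span R {x | ∃ j, rank j < rank i ∧ x = b j} := by
  classical
  let rank : ι → ℕ := wf.fix fun i rec =>
    ((b.repr (d (b i))).support.attach.sup fun j =>
      rec j.1 (h i j.1 (Finsupp.mem_support_iff.1 j.2)) + 1)
  refine ⟨rank, fun i => ?_⟩
  suffices hs : Finsupp.linearCombination R b (b.repr (d (b i))) ∈
      Submodule.span R {x | ∃ j, rank j < rank i ∧ x = b j} by
    rwa [b.linearCombination_repr] at hs
  rw [Finsupp.linearCombination_apply, Finsupp.sum]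
  refine Submodule.sum_mem _ fun j hj => Submodule.smul_mem _ _ (Submodule.subset_span ⟨j, ?_, rfl⟩)
  have e : rank i = ((b.repr (d (b i))).support.attach.sup fun j => rank j.1 + 1) :=
    wf.fix_eq _ i
  rw [e, ← Nat.succ_le_iff]
  exact Finset.le_sup (f := fun j : {j // j ∈ (b.repr (d (b i))).support} => rank j.1 + 1)
    (Finset.mem_attach _ ⟨j, hj⟩)

variable {k : Type u} [Field k] {Z Y : Type u} [AddCommGroup Z] [Module k Z]
  [AddCommGroup Y] [Module k Y] {𝒵 : ℕ → Submodule k Z} {𝒴 : ℕ → Submodule k Y} {I J : Type u}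

open FreeCGA GradedBasis

attribute [local instance] baseModule

variable (𝒵) in
/-- The grading of the module spanned by some monomials of the fiber. -/
def fiberSpanGrading [CharZero k] (BY : GradedBasis 𝒴 J) (p : Multiset J → Prop) (i : ℤ) :
    Submodule k (fiberSpan 𝒵 BY p) :=
  (degreeInt (sumGrading 𝒵 𝒴) i).comap ((fiberSpan 𝒵 BY p).subtype.restrictScalars k)

theorem mem_fiberSpanGrading [CharZero k] {BY : GradedBasis 𝒴 J} {p : Multiset J → Prop} {i : ℤ}
    {a : fiberSpan 𝒵 BY p} :
    a ∈ fiberSpanGrading 𝒵 BY p i ↔ a.1 ∈ degreeInt (sumGrading 𝒵 𝒴) i := Iff.rfl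

/-- The differential of the module spanned by some monomials of the fiber. -/
def fiberSpanDiff [CharZero k] (BY : GradedBasis 𝒴 J) (p : Multiset J → Prop)
    (d : Differential (sumGrading 𝒵 𝒴))
    (hp : ∀ a ∈ fiberSpan 𝒵 BY p, d.toLin a ∈ fiberSpan 𝒵 BY p) :
    fiberSpan 𝒵 BY p →ₗ[k] fiberSpan 𝒵 BY p :=
  d.toLin.restrict (p := (fiberSpan 𝒵 BY p).restrictScalars k)
    (q := (fiberSpan 𝒵 BY p).restrictScalars k) hp

variable [CharZero k]

theorem isInternal_fiberSpanGrading (BZ : GradedBasis 𝒵 I) (BY : GradedBasis 𝒴 J)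
    (p : Multiset J → Prop) : DirectSum.IsInternal (fiberSpanGrading 𝒵 BY p) := by
  have hP : ∀ i : ℤ, ∀ x ∈ (fiberSpan 𝒵 BY p).restrictScalars k,
      (BZ.sum BY).proj (fun S => ((S.map (BZ.sum BY).deg).sum : ℤ) = i) x ∈
        (fiberSpan 𝒵 BY p).restrictScalars k := by
    intro i x hx
    rw [Submodule.restrictScalars_mem, mem_fiberSpan_iff BZ] at hx ⊢
    exact supported_mono (fun S hS => hS.1) ((BZ.sum BY).proj_mem hx)
  let P : ℤ → fiberSpan 𝒵 BY p →ₗ[k] fiberSpan 𝒵 BY p := fun i => LinearMap.restrict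
    (p := (fiberSpan 𝒵 BY p).restrictScalars k) (q := (fiberSpan 𝒵 BY p).restrictScalars k) _ (hP i)
  refine isInternal_of_projections _ P (fun i x h => ?_) (fun i j hij x h => ?_) (fun x => ?_)
  · rw [mem_fiberSpanGrading, (BZ.sum BY).degreeInt_eq] at h
    have e := (BZ.sum BY).proj_eq_self h
    exact Subtype.ext e
  · rw [mem_fiberSpanGrading, (BZ.sum BY).degreeInt_eq] at h
    have e := (BZ.sum BY).proj_eq_zero (p := fun S => ((S.map (BZ.sum BY).deg).sum : ℤ) = i)
      (fun S hS hS' => hij (hS'.symm.trans hS)) h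
    exact Subtype.ext e
  · have key : (BZ.sum BY).supported (fun S => p (fiberPart S)) ≤
        (⨆ i, fiberSpanGrading 𝒵 BY p i).map
        ((fiberSpan 𝒵 BY p).subtype.restrictScalars k) := by
      refine (BZ.sum BY).supported_le fun l hl => ?_
      refine ⟨⟨(BZ.sum BY).listProd l, (mem_fiberSpan_iff BZ BY).2 (listProd_mem hl)⟩, ?_, rfl⟩
      refine Submodule.mem_iSup_of_mem (((l : Multiset (I ⊕ J)).map (BZ.sum BY).deg).sum : ℤ) ?_
      rw [mem_fiberSpanGrading, (BZ.sum BY).degreeInt_eq]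
      exact listProd_mem rfl
    obtain ⟨y, hy, e⟩ := key ((mem_fiberSpan_iff BZ BY).1 x.2)
    have : y = x := Subtype.ext e
    rwa [← this]

theorem isDGModule_fiberSpan (BZ : GradedBasis 𝒵 I) (BY : GradedBasis 𝒴 J)
    (p : Multiset J → Prop) (dZ : Differential 𝒵)
    (d : Differential (sumGrading 𝒵 𝒴))
    (hbase : ∀ a, d.toLin (inclBase 𝒵 𝒴 a) = inclBase 𝒵 𝒴 (dZ.toLin a))
    (hp : ∀ a ∈ fiberSpan 𝒵 BY p, d.toLin a ∈ fiberSpan 𝒵 BY p) :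
    IsDGModule dZ (fiberSpanGrading 𝒵 BY p) (fiberSpanDiff BY p d hp) where
  scalarTower := inferInstance
  isInternal := isInternal_fiberSpanGrading BZ BY p
  smul_mem := by
    rintro n i a ha ⟨x, hx⟩ (h : x ∈ degreeInt _ i)
    change inclBase 𝒵 𝒴 a * x ∈ degreeInt _ _
    rw [BZ.degree_eq] at ha
    rw [(BZ.sum BY).degreeInt_eq] at h ⊢
    refine mul_mem_supported ?_ (inclBase_mem BY ha) h
    rintro S T ⟨hS, hS'⟩ hT
    rw [← map_basePart_add S, hS, Multiset.map_add, Multiset.sum_add, Nat.cast_add, hT]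
    simp [Function.comp_def, hS']
  degree_succ := by
    rintro i ⟨x, hx⟩ (h : x ∈ degreeInt _ i)
    change d.toLin x ∈ degreeInt _ _
    refine (iSup₂_le fun n hn y hy => ?_ : degreeInt (sumGrading 𝒵 𝒴) i ≤
      (degreeInt (sumGrading 𝒵 𝒴) (i + 1)).comap d.toLin) h
    exact (le_iSup₂ (f := fun (n : ℕ) (_ : (n : ℤ) = i + 1) => degree (sumGrading 𝒵 𝒴) n) (n + 1)
      (by push_cast; omega)) (d.degree_succ n y hy)
  sq_zero := fun x => Subtype.ext (d.sq_zero x)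
  leibniz := by
    intro n a ha x
    refine Subtype.ext ?_
    change d.toLin (inclBase 𝒵 𝒴 a * x) = inclBase 𝒵 𝒴 (dZ.toLin a) * x +
      inclBase 𝒵 𝒴 ((-1) ^ n) * (inclBase 𝒵 𝒴 a * d.toLin x)
    rw [d.leibniz n, hbase, map_pow, map_neg, map_one]
    rw [BZ.degree_eq] at ha
    rw [(BZ.sum BY).degree_eq]
    refine supported_mono ?_ (inclBase_mem BY ha)
    rintro S ⟨hS, hS'⟩
    rw [← map_basePart_add S, hS]
    simp [Function.comp_def, hS']

/-- The submodule of `ΛZ ⊗ ΛY` spanned by some monomials of the fiber is semifree, if the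
differential of a letter of the fiber involves only letters of the fiber of lower level. -/
theorem isSemifree_fiberSpan (BZ : GradedBasis 𝒵 I) (BY : GradedBasis 𝒴 J)
    (p : Multiset J → Prop) (dZ : Differential 𝒵)
    (d : Differential (sumGrading 𝒵 𝒴))
    (hbase : ∀ a, d.toLin (inclBase 𝒵 𝒴 a) = inclBase 𝒵 𝒴 (dZ.toLin a))
    (hp : ∀ a ∈ fiberSpan 𝒵 BY p, d.toLin a ∈ fiberSpan 𝒵 BY p) (lev : J → ℕ)
    (hlev : ∀ j, d.toLin ((BZ.sum BY).x (Sum.inr j)) ∈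
      (BZ.sum BY).supported fun S => ∀ i ∈ fiberPart S, lev i < lev j) :
    IsSemifree dZ (fiberSpanGrading 𝒵 BY p) (fiberSpanDiff BY p d hp) := by
  refine ⟨isDGModule_fiberSpan BZ BY p dZ d hbase hp, ?_⟩
  have hli := (linearIndependent_fiberBasis BZ BY).comp
    (fun T : {T : {T : Multiset J // BY.Adm T} // p T} => T.1) Subtype.val_injective
  let b : Module.Basis {T : {T : Multiset J // BY.Adm T} // p T} (FreeCGA 𝒵) (fiberSpan 𝒵 BY p) :=
    Module.Basis.span hli
  have hb : ∀ T, (b T : FreeCGA (sumGrading 𝒵 𝒴)) = inclFiber 𝒵 𝒴 (BY.basis T.1) := fun T =>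
    congrArg Subtype.val (Module.Basis.span_apply hli T)
  let ρ : J → Multiset J → Prop := fun j T => ∀ i ∈ T, lev i < lev j
  have wf : WellFounded (Relation.TransGen (Step ρ)) :=
    Step.wellFounded (r := fun i j => lev i < lev j) (InvImage.wf lev wellFounded_lt) fun _ _ h => h
  -- The differential of a monomial of the fiber is a combination of smaller ones.
  have hd : ∀ T : {T : Multiset J // BY.Adm T}, d.toLin (inclFiber 𝒵 𝒴 (BY.basis T)) ∈
      (BZ.sum BY).supported fun S => Relation.TransGen (Step ρ) (fiberPart S) T.1 := by
    intro T
    rw [basis_apply, inclFiber_listProd BZ BY]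
    have h := ((BZ.sum BY).ofDifferential d).isSkewDerivation.listProd_mem
      (ρ := fun a S => match a with
        | Sum.inl _ => True
        | Sum.inr j => ρ j (fiberPart S)) (by
        rintro (i | j)
        · exact (BZ.sum BY).mem_supported_true _
        · exact hlev j) (T.1.toList.map Sum.inr)
    refine supported_mono ?_ h
    rintro _ ⟨a, S₀, U, h1, rfl, hU⟩
    rw [← Multiset.map_coe, Multiset.coe_toList] at h1
    rcases a with i | j
    · have : Sum.inl i ∈ T.1.map (Sum.inr : J → I ⊕ J) := by rw [h1]; simp
      simp at this
    · have h2 := congrArg fiberPart h1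
      rw [fiberPart_map_inr, fiberPart_cons_inr] at h2
      rw [h2, fiberPart_add]
      exact .single (Step.head hU _)
  obtain ⟨rank, hrank⟩ := exists_rank b (fiberSpanDiff BY p d hp)
    (lt := fun T T' => Relation.TransGen (Step ρ) T.1.1 T'.1.1)
    (InvImage.wf (fun T : {T : {T : Multiset J // BY.Adm T} // p T} => T.1.1) wf) (by
    intro T T' h
    have h1 : (fiberSpanDiff BY p d hp (b T) : FreeCGA (sumGrading 𝒵 𝒴)) ∈
        fiberSpan 𝒵 BY fun S => p S ∧ Relation.TransGen (Step ρ) S T.1.1 := by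
      rw [mem_fiberSpan_iff BZ]
      refine (BZ.sum BY).mem_supported_and ((mem_fiberSpan_iff BZ BY).1 (Subtype.mem _)) ?_
      change d.toLin (b T) ∈ _
      rw [hb]
      exact hd _
    have h2 : fiberSpanDiff BY p d hp (b T) ∈ Submodule.span (FreeCGA 𝒵)
        (b '' {T' | Relation.TransGen (Step ρ) T'.1.1 T.1.1}) := by
      have h3 : (fiberSpan 𝒵 BY fun S => p S ∧ Relation.TransGen (Step ρ) S T.1.1) ≤
          (Submodule.span (FreeCGA 𝒵)
            (b '' {T' | Relation.TransGen (Step ρ) T'.1.1 T.1.1})).map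
              (fiberSpan 𝒵 BY p).subtype := by
        refine Submodule.span_le.2 ?_
        rintro _ ⟨U, rfl⟩
        exact ⟨b ⟨U.1, U.2.1⟩, Submodule.subset_span ⟨_, U.2.2, rfl⟩, hb _⟩
      obtain ⟨y, hy, e⟩ := h3 h1
      rwa [← Subtype.ext e]
    rw [Module.Basis.mem_span_image] at h2
    exact h2 (Finsupp.mem_support_iff.2 h))
  refine ⟨_, b, fun T => ((T.1.1.map BY.deg).sum : ℤ), rank, fun T => ?_, hrank⟩
  change (b T : FreeCGA (sumGrading 𝒵 𝒴)) ∈ degreeInt _ _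
  rw [hb, (BZ.sum BY).degreeInt_eq]
  refine supported_mono ?_ (inclFiber_mem BZ (BY.basis_mem (p := (· = T.1.1)) rfl))
  rintro S ⟨hS, hS'⟩
  rw [← map_basePart_add S, hS, hS']
  simp [Function.comp_def]

end Semifree

/-! ### Adapted homogeneous bases -/

section AdaptedBasis

variable {k : Type u} [Field k] {V : Type u} [AddCommGroup V] [Module k V] {𝒱 : ℕ → Submodule k V}

open FreeCGA

/-- A filtered graded vector space has a homogeneous basis which is adapted to the filtration. -/
theorem exists_gradedBasis (h𝒱 : DirectSum.IsInternal 𝒱) {F : ℕ → Submodule k V}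
    (hF : IsGradedFiltration 𝒱 F) : ∃ (I : Type u) (B : GradedBasis 𝒱 I) (lev : I → ℕ),
      (∀ i, B.b i ∈ F (lev i + 1)) ∧ ∀ r, ∀ v ∈ F r, ∀ i, B.b.repr v i ≠ 0 → lev i < r := by
  classical
  -- Increasing linearly independent sets of homogeneous vectors spanning the steps of `F`.
  let P : ℕ → Set V → Prop := fun r s => LinearIndepOn k id s ∧
    (∀ v ∈ s, ∃ n, v ∈ F r ⊓ 𝒱 n) ∧ F r ≤ Submodule.span k s
  have hstep : ∀ r (s : {s // P r s}), ∃ t : {t // P (r + 1) t}, s.1 ⊆ t.1 := by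
    rintro r ⟨s, hs, hs', hs''⟩
    have hst : s ⊆ {v | ∃ n, v ∈ F (r + 1) ⊓ 𝒱 n} := fun v hv =>
      (hs' v hv).imp fun n h => ⟨hF.mono (Nat.le_succ r) h.1, h.2⟩
    obtain ⟨t, ht, hst, htt, hli⟩ := exists_linearIndepOn_id_extension hs hst
    refine ⟨⟨t, hli, fun v hv => ht hv, ?_⟩, hst⟩
    refine (hF.graded (r + 1)).trans (iSup_le fun n v hv => htt ⟨n, hv⟩)
  choose next hnext using hstep
  let s : ∀ r, {s // P r s} := fun r => Nat.rec (motive := fun r => {s // P r s})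
    ⟨∅, linearIndepOn_empty k id, by simp, by rw [hF.zero]; exact bot_le⟩ (fun r s => next r s) r
  have hmono : Monotone fun r => (s r).1 := monotone_nat_of_le_succ fun r => hnext r (s r)
  let S : Set V := ⋃ r, (s r).1
  have hli : LinearIndepOn k id S :=
    linearIndepOn_iUnion_of_directed hmono.directed_le fun r => (s r).2.1
  have hspan : ∀ r, F r ≤ Submodule.span k (s r).1 := fun r => (s r).2.2.2
  let b : Module.Basis S k V := Module.Basis.mk hli (by
    intro v _
    obtain ⟨r, hr⟩ := hF.exhaustive v
    have := Submodule.span_mono (Set.subset_iUnion (fun r => (s r).1) r) (hspan r hr)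
    simpa using this)
  have hb : ∀ i, b i = i.1 := fun i => Module.Basis.mk_apply _ _ i
  have hmem : ∀ i : S, ∃ r, i.1 ∈ (s r).1 := fun i => Set.mem_iUnion.1 i.2
  have hpos : ∀ i : S, Nat.find (hmem i) ≠ 0 := by
    intro i h
    have := Nat.find_spec (hmem i)
    rw [h] at this
    exact this
  choose deg hdeg using fun i : S => (s _).2.2.1 i.1 (Nat.find_spec (hmem i))
  have hmem' : ∀ i, b i ∈ 𝒱 (deg i) := fun i => by rw [hb]; exact (hdeg i).2
  refine ⟨S, ⟨b, deg, hmem', ?_⟩, fun i => Nat.find (hmem i) - 1, ?_, ?_⟩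
  · intro n v hv
    -- The part of `v` outside of degree `n` lies in `𝒱 n` and in the sum of the other `𝒱 m`.
    have h1 : Finsupp.linearCombination k b ((b.repr v).filter fun i => deg i ≠ n) ∈
        ⨆ (m) (_ : m ≠ n), 𝒱 m := by
      rw [Finsupp.linearCombination_apply]
      refine Submodule.sum_mem _ fun i hi => Submodule.smul_mem _ _ ?_
      have hi' : deg i ≠ n := by simp at hi; exact hi.2
      exact (le_iSup₂ (f := fun m (_ : m ≠ n) => 𝒱 m) _ hi') (hmem' i)
    have h2 : Finsupp.linearCombination k b ((b.repr v).filter fun i => deg i ≠ n) ∈ 𝒱 n := by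
      have h3 : Finsupp.linearCombination k b ((b.repr v).filter fun i => deg i = n) ∈ 𝒱 n := by
        rw [Finsupp.linearCombination_apply]
        refine Submodule.sum_mem _ fun i hi => Submodule.smul_mem _ _ ?_
        have hi' : deg i = n := by simp at hi; exact hi.2
        rw [← hi']
        exact hmem' i
      have h4 := congrArg (Finsupp.linearCombination k b)
        (Finsupp.filter_add_filter_not (b.repr v) fun i => deg i = n)
      rw [map_add, b.linearCombination_repr] at h4
      rw [← sub_eq_iff_eq_add'.2 h4.symm]
      exact sub_mem hv h3
    have h3 := Submodule.disjoint_def.1 (h𝒱.submodule_iSupIndep n) _ h2 h1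
    have h4 : (b.repr v).filter (fun i => deg i ≠ n) = 0 := by
      have := congrArg b.repr h3
      rwa [b.repr_linearCombination, map_zero] at this
    intro i hi
    by_contra hne
    have h5 := DFunLike.congr_fun h4 i
    rw [Finsupp.filter_apply_pos (fun i => deg i ≠ n) _ hne] at h5
    exact hi h5
  · intro i
    change b i ∈ F (Nat.find (hmem i) - 1 + 1)
    rw [Nat.sub_add_cancel (Nat.one_le_iff_ne_zero.2 (hpos i)), hb]
    exact (hdeg i).1
  · intro r v hv i hi
    have h1 : v ∈ Submodule.span k (b '' {i | i.1 ∈ (s r).1}) := by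
      refine Submodule.span_mono ?_ (hspan r hv)
      intro w hw
      exact ⟨⟨w, Set.mem_iUnion.2 ⟨r, hw⟩⟩, hw, hb _⟩
    rw [Module.Basis.mem_span_image] at h1
    have h2 : i.1 ∈ (s r).1 := h1 (Finsupp.mem_support_iff.2 hi)
    have h3 := Nat.find_min' (hmem i) h2
    have h4 := hpos i
    change Nat.find (hmem i) - 1 < r
    omega

end AdaptedBasis

/-! ### Linear homotopies over a field -/

section Homotopy

variable {k A : Type*} [Field k] [AddCommGroup A] [Module k A]

theorem exists_linear_section (d : A →ₗ[k] A) {Q B : Submodule k A}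
    (h : ∀ z ∈ Q, ∃ b ∈ B, d b = z) : ∃ τ : A →ₗ[k] A, ∀ z ∈ Q, τ z ∈ B ∧ d (τ z) = z := by
  let f : ↥(B ⊓ Q.comap d) →ₗ[k] Q := d.restrict fun x hx => hx.2
  have hf : LinearMap.range f = ⊤ := by
    rw [LinearMap.range_eq_top]
    rintro ⟨z, hz⟩
    obtain ⟨b, hb, rfl⟩ := h z hz
    exact ⟨⟨b, hb, hz⟩, rfl⟩
  obtain ⟨g, hg⟩ := f.exists_rightInverse_of_surjective hf
  obtain ⟨τ, hτ⟩ := LinearMap.exists_extend ((B ⊓ Q.comap d).subtype ∘ₗ g)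
  refine ⟨τ, fun z hz => ?_⟩
  have h1 : τ z = (g ⟨z, hz⟩).1 := LinearMap.congr_fun hτ ⟨z, hz⟩
  have h2 := congrArg Subtype.val (LinearMap.congr_fun hg ⟨z, hz⟩)
  rw [h1]
  exact ⟨(g ⟨z, hz⟩).2.1, h2⟩

/-- If each cocycle of the subcomplex `B'` is the coboundary of an element of `B ⊇ B'`, the
inclusion `B' → B` is null-homotopic, by a linear homotopy which need not respect any grading. -/
theorem exists_homotopy (d : A →ₗ[k] A) (hd : ∀ a, d (d a) = 0) {B' B : Submodule k A}
    (hB : B' ≤ B) (hB' : ∀ b ∈ B', d b ∈ B') (hex : ∀ b ∈ B', d b = 0 → ∃ c ∈ B, d c = b) :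
    ∃ h : A →ₗ[k] A, ∀ b ∈ B', h b ∈ B ∧ d (h b) + h (d b) = b := by
  obtain ⟨ρ, hρ⟩ := exists_linear_section d (Q := B' ⊓ LinearMap.ker d) (B := B)
    fun z hz => hex z hz.1 hz.2
  obtain ⟨τ, hτ⟩ := exists_linear_section d (Q := B'.map d) (B := B') fun z hz => by
    obtain ⟨b, hb, rfl⟩ := hz
    exact ⟨b, hb, rfl⟩
  obtain ⟨q, hq⟩ := LinearMap.exists_extend (LinearMap.id : B'.map d →ₗ[k] B'.map d)
  have hq' : ∀ z ∈ B'.map d, (q z : A) = z := fun z hz =>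
    congrArg Subtype.val (LinearMap.congr_fun hq ⟨z, hz⟩)
  -- a section of `d` on the cocycles of `B'` which extends the section `τ` on the coboundaries
  let σ : A →ₗ[k] A := τ ∘ₗ (B'.map d).subtype ∘ₗ q + ρ ∘ₗ (LinearMap.id - (B'.map d).subtype ∘ₗ q)
  have hle : B'.map d ≤ B' ⊓ LinearMap.ker d := by
    rintro _ ⟨b, hb, rfl⟩
    exact ⟨hB' b hb, hd b⟩
  have hσ : ∀ z ∈ B' ⊓ LinearMap.ker d, σ z ∈ B ∧ d (σ z) = z := by
    intro z hz
    have h1 := hτ _ (q z).2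
    have h2 := hρ (z - q z) (sub_mem hz (hle (q z).2))
    refine ⟨add_mem (hB h1.1) h2.1, ?_⟩
    change d (τ (q z) + ρ (z - q z)) = z
    rw [map_add, h1.2, h2.2, add_sub_cancel]
  have hσ' : ∀ z ∈ B'.map d, σ z = τ z := by
    intro z hz
    change τ (q z) + ρ (z - q z) = τ z
    rw [hq' z hz, sub_self, map_zero, add_zero]
  refine ⟨σ ∘ₗ (LinearMap.id - τ ∘ₗ d), fun b hb => ?_⟩
  have h1 := hτ _ (Submodule.mem_map_of_mem hb)
  have h2 := hσ (b - τ (d b)) ⟨sub_mem hb h1.1, by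
    rw [SetLike.mem_coe, LinearMap.mem_ker, map_sub, h1.2, sub_self]⟩
  refine ⟨h2.1, ?_⟩
  change d (σ (b - τ (d b))) + σ (d b - τ (d (d b))) = b
  rw [h2.2, hd, map_zero, sub_zero, hσ' _ (Submodule.mem_map_of_mem hb), sub_add_cancel]

end Homotopy

/-! ### The exponential of a locally nilpotent derivation -/

section Exponential

variable {k E : Type*} [Field k] [CharZero k] [Ring E] [Algebra k E]

open Finset in
theorem derivation_pow_mul (θ : E →ₗ[k] E) (hθ : ∀ a b, θ (a * b) = θ a * b + a * θ b) (n : ℕ)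
    (a b : E) : ((n.factorial : k)⁻¹) • (θ ^ n) (a * b) = ∑ m ∈ antidiagonal n,
      (((m.1.factorial : k)⁻¹) • (θ ^ m.1) a) * (((m.2.factorial : k)⁻¹) • (θ ^ m.2) b) := by
  have h1 : θ ∘ₗ LinearMap.mul' k E = LinearMap.mul' k E ∘ₗ (θ.rTensor E + θ.lTensor E) :=
    TensorProduct.ext' fun a b => by simp [hθ]
  have h2 : (θ ^ n) ∘ₗ LinearMap.mul' k E =
      LinearMap.mul' k E ∘ₗ ((θ.rTensor E + θ.lTensor E) ^ n) := by
    induction n with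
    | zero => rfl
    | succ n ih =>
      rw [pow_succ, Module.End.mul_eq_comp, LinearMap.comp_assoc, h1, ← LinearMap.comp_assoc, ih,
        pow_succ, Module.End.mul_eq_comp, LinearMap.comp_assoc]
  have h3 : Commute (θ.rTensor E) (θ.lTensor E) := by
    refine TensorProduct.ext' fun a b => ?_
    simp [Module.End.mul_apply]
  have h4 := LinearMap.congr_fun h2 (a ⊗ₜ[k] b)
  rw [h3.add_pow'] at h4
  simp only [LinearMap.comp_apply, LinearMap.mul'_apply, LinearMap.sum_apply, map_sum,
    LinearMap.smul_apply, LinearMap.rTensor_pow, LinearMap.lTensor_pow, Module.End.mul_apply,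
    LinearMap.rTensor_tmul, LinearMap.lTensor_tmul, map_nsmul] at h4
  rw [h4, smul_sum]
  refine sum_congr rfl fun m hm => ?_
  rw [smul_mul_smul_comm, ← Nat.cast_smul_eq_nsmul k, smul_smul]
  congr 1
  have hm' := mem_antidiagonal.1 hm
  have := Nat.choose_mul_factorial_mul_factorial (n := n) (k := m.1) (by omega)
  rw [show n - m.1 = m.2 by omega] at this
  have h5 : (n.factorial : k) ≠ 0 := Nat.cast_ne_zero.2 n.factorial_ne_zero
  have h6 : (m.1.factorial : k) ≠ 0 := Nat.cast_ne_zero.2 m.1.factorial_ne_zero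
  have h7 : (m.2.factorial : k) ≠ 0 := Nat.cast_ne_zero.2 m.2.factorial_ne_zero
  field_simp
  rw [← this]
  push_cast
  ring

open Finset Polynomial in
/-- The exponential of a locally nilpotent derivation is an algebra morphism. -/
theorem exists_exp (θ : E →ₗ[k] E) (hθ : ∀ a b, θ (a * b) = θ a * b + a * θ b)
    (hnil : ∀ a, ∃ N, (θ ^ N) a = 0) : ∃ φ : E →ₐ[k] E, ∀ a, ∃ N, ∀ M, N ≤ M →
      φ a = ∑ n ∈ range M, ((n.factorial : k)⁻¹) • (θ ^ n) a := by
  choose N hN using hnil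
  have hN' : ∀ a n, N a ≤ n → (θ ^ n) a = 0 := by
    intro a n h
    obtain ⟨j, rfl⟩ := Nat.exists_eq_add_of_le' h
    rw [pow_add, Module.End.mul_apply, hN, map_zero]
  -- the polynomial `exp (X θ) a`, which is multiplicative in `a` and which is evaluated at `1`
  let p : E → E[X] := fun a => ∑ n ∈ range (N a), monomial n (((n.factorial : k)⁻¹) • (θ ^ n) a)
  have hp : ∀ a n, (p a).coeff n = ((n.factorial : k)⁻¹) • (θ ^ n) a := by
    intro a n
    simp only [p, finsetSum_coeff, coeff_monomial, sum_ite_eq', mem_range]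
    split_ifs with h
    · rfl
    · rw [hN' a n (not_lt.1 h), smul_zero]
  let ev : E[X] →+* E := eval₂RingHom' (RingHom.id E) 1 fun a => Commute.one_right a
  have hev : ∀ a M, N a ≤ M → ev (p a) = ∑ n ∈ range M, ((n.factorial : k)⁻¹) • (θ ^ n) a := by
    intro a M h
    have h1 : ev (p a) = ∑ n ∈ range (N a), ((n.factorial : k)⁻¹) • (θ ^ n) a := by
      simp only [p, map_sum]
      refine sum_congr rfl fun n _ => ?_
      change eval₂ (RingHom.id E) 1 _ = _
      rw [eval₂_monomial, one_pow, mul_one, RingHom.id_apply]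
    rw [h1]
    refine sum_subset (range_mono h) fun n _ hn => ?_
    rw [hN' a n (by simpa using hn), smul_zero]
  have h1 : θ 1 = 0 := by simpa using hθ 1 1
  have hp1 : ∀ c : k, p (algebraMap k E c) = C (algebraMap k E c) := by
    intro c
    ext n
    rw [hp, coeff_C]
    rcases n with _ | n
    · simp
    · rw [if_neg (by simp), pow_succ, Module.End.mul_apply, Algebra.algebraMap_eq_smul_one,
        map_smul, h1]
      simp
  refine ⟨AlgHom.ofLinearMap
    { toFun := fun a => ev (p a)
      map_add' := fun a b => by
        rw [← map_add]; congr 1; ext n; simp [hp]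
      map_smul' := fun c a => by
        have : p (c • a) = C (algebraMap k E c) * p a := by
          ext n
          rw [coeff_C_mul, hp, hp, map_smul, smul_comm, Algebra.smul_def]
        rw [this, map_mul, RingHom.id_apply, Algebra.smul_def]
        congr 1
        exact (eval₂_C (RingHom.id E) 1) } ?_ ?_, fun a => ⟨N a, hev a⟩⟩
  · change ev (p 1) = 1
    have := hp1 1
    rw [map_one, map_one] at this
    rw [this, map_one]
  · intro a b
    change ev (p (a * b)) = ev (p a) * ev (p b)
    rw [← map_mul]
    congr 1
    ext n
    rw [coeff_mul, hp, derivation_pow_mul θ hθ]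
    simp only [hp]

end Exponential

open FreeCGA GradedBasis

/-! ### Morphisms and derivations determined on the letters -/

section Derivations

variable {k : Type u} [Field k] {V : Type u} [AddCommGroup V] [Module k V]
  {𝒱 : ℕ → Submodule k V} {I : Type u} (B : GradedBasis 𝒱 I)

theorem FreeCGA.Step.le {I : Type*} {ρ : I → Multiset I → Prop} {ν : Multiset I → ℕ}
    (hν : ∀ S T, ν (S + T) = ν S + ν T) (hρ : ∀ i T, ρ i T → ν {i} ≤ ν T) (S' S : Multiset I)
    (h : Step ρ S' S) : ν S ≤ ν S' := by
  obtain ⟨i, S₀, T, rfl, rfl, h⟩ := h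
  rw [← Multiset.singleton_add, hν, hν]
  exact Nat.add_le_add_right (hρ i T h) _

namespace FreeCGA.GradedBasis

theorem mul_comm_of_mem_degree (B : GradedBasis 𝒱 I) {p q : ℕ} {a b : FreeCGA 𝒱}
    (ha : a ∈ degree 𝒱 p)
    (hb : b ∈ degree 𝒱 q) : a * b = ((-1) ^ (p * q) : k) • (b * a) := by
  have ha' : a ∈ B.supported fun S => (-1 : k) ^ (S.map B.deg).sum = (-1) ^ p := by
    rw [B.degree_eq] at ha
    exact supported_mono (fun S hS => by rw [hS]) ha
  rw [B.degree_eq] at hb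
  refine linearMap_eqOn (f := LinearMap.mulLeft k a)
    (g := ((-1) ^ (p * q) : k) • LinearMap.mulRight k a) ?_ hb
  rintro l rfl
  clear hb
  change a * B.listProd l = ((-1) ^ (p * _) : k) • (B.listProd l * a)
  induction l with
  | nil => simp
  | cons i l ih =>
    rw [listProd_cons, ← mul_assoc, B.mul_x_of_mem ha', smul_mul_assoc, mul_assoc, ih,
      mul_smul_comm, smul_smul, ← mul_assoc, ← pow_add, ← Multiset.cons_coe, Multiset.map_cons,
      Multiset.sum_cons, mul_add]

/-- The algebra morphism which sends the letters to given elements of the same degrees. -/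
def liftDegree {V' : Type u} [AddCommGroup V'] [Module k V'] {𝒱' : ℕ → Submodule k V'}
    {I' : Type u} (B' : GradedBasis 𝒱' I') (g : I → FreeCGA 𝒱')
    (hg : ∀ i, g i ∈ degree 𝒱' (B.deg i)) : FreeCGA 𝒱 →ₐ[k] FreeCGA 𝒱' :=
  B.lift g fun i j => by
    rw [B'.mul_comm_of_mem_degree (hg i) (hg j), neg_one_pow_eq_smul (k := k) (R := FreeCGA 𝒱'),
      smul_mul_assoc, one_mul]

theorem mem_degree_of_letters {V' : Type u} [AddCommGroup V'] [Module k V']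
    {𝒱' : ℕ → Submodule k V'} {I' : Type u} (B' : GradedBasis 𝒱' I')
    (φ : FreeCGA 𝒱 →ₐ[k] FreeCGA 𝒱') (hφ : ∀ i, φ (B.x i) ∈ degree 𝒱' (B.deg i)) {n : ℕ}
    {a : FreeCGA 𝒱} (ha : a ∈ degree 𝒱 n) : φ a ∈ degree 𝒱' n := by
  rw [B.degree_eq] at ha
  refine map_mem_of_listProd φ.toLinearMap ?_ ha
  rintro l rfl
  change φ (B.listProd l) ∈ _
  clear ha
  induction l with
  | nil => rw [listProd_nil, map_one, B'.degree_eq]; exact B'.one_mem_supported rfl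
  | cons i l ih =>
    have h := hφ i
    rw [B'.degree_eq] at h ih ⊢
    rw [listProd_cons, map_mul, ← Multiset.cons_coe, Multiset.map_cons, Multiset.sum_cons]
    refine mul_mem_supported ?_ h ih
    intro S T hS hT
    rw [Multiset.map_add, Multiset.sum_add, hS, hT]

theorem map_sgn {V' : Type u} [AddCommGroup V'] [Module k V']
    {𝒱' : ℕ → Submodule k V'} {I' : Type u} (B' : GradedBasis 𝒱' I')
    (φ : FreeCGA 𝒱 →ₐ[k] FreeCGA 𝒱') (hφ : ∀ i, φ (B.x i) ∈ degree 𝒱' (B.deg i))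
    (a : FreeCGA 𝒱) : B'.sgn (φ a) = φ (B.sgn a) := by
  refine B.algHom_ext (f := B'.sgn.comp φ) (g := φ.comp B.sgn) (fun i => ?_) a
  simp only [AlgHom.comp_apply, sgn_x, map_smul]
  exact B'.sgn_of_mem_degree (hφ i)

variable {B} in
/-- An odd derivation of square zero on the letters which raises their degrees by one is a
differential. -/
def OddDerivation.toDifferential (θ : B.OddDerivation)
    (hdeg : ∀ i, θ.toLin (B.x i) ∈ degree 𝒱 (B.deg i + 1))
    (hsq : ∀ i, θ.toLin (θ.toLin (B.x i)) = 0) : Differential 𝒱 where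
  toLin := θ.toLin
  degree_succ := by
    intro n a ha
    simp only [B.degree_eq] at ha hdeg ⊢
    refine θ.isSkewDerivation.map_mem hdeg ?_ ha
    rintro _ _ ⟨i, S₀, T, rfl, rfl, hT⟩ h
    rw [Multiset.map_cons, Multiset.sum_cons] at h
    rw [Multiset.map_add, Multiset.sum_add, hT]
    omega
  sq_zero := by
    have h0 : B.IsSkewDerivation (AlgHom.id k _) 0 := ⟨fun i => ⟨1, by simp⟩, fun a b => by simp⟩
    exact θ.isSkewDerivation_sq.ext h0 hsq
  leibniz := by
    intro n a ha b
    rw [θ.map_mul, B.sgn_of_mem_degree ha, neg_one_pow_eq_smul (k := k) (R := FreeCGA 𝒱),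
      smul_mul_assoc, smul_mul_assoc, one_mul]

variable {B} in
/-- An algebra morphism which commutes with odd derivations on the letters commutes with them. -/
theorem OddDerivation.comm_of_letters {V' : Type u} [AddCommGroup V'] [Module k V']
    {𝒱' : ℕ → Submodule k V'} {I' : Type u} {B' : GradedBasis 𝒱' I'} (θ : B.OddDerivation)
    (θ' : B'.OddDerivation) (φ : FreeCGA 𝒱 →ₐ[k] FreeCGA 𝒱')
    (hφ : ∀ i, φ (B.x i) ∈ degree 𝒱' (B.deg i))
    (h : ∀ i, θ'.toLin (φ (B.x i)) = φ (θ.toLin (B.x i))) (a : FreeCGA 𝒱) :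
    θ'.toLin (φ a) = φ (θ.toLin a) := by
  refine B.linearMap_ext (f := θ'.toLin ∘ₗ φ.toLinearMap) (g := φ.toLinearMap ∘ₗ θ.toLin)
    (fun l => ?_) a
  change θ'.toLin (φ (B.listProd l)) = φ (θ.toLin (B.listProd l))
  induction l with
  | nil => simp [θ.isSkewDerivation.map_one, θ'.isSkewDerivation.map_one]
  | cons i l ih =>
    rw [listProd_cons, _root_.map_mul, θ'.map_mul, θ.map_mul, map_add, _root_.map_mul,
      _root_.map_mul, h, ih, B.map_sgn B' φ hφ]

end FreeCGA.GradedBasis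

end Derivations

/-! ### Filtration of `ΛZ ⊗ ΛY` by the wordlength in `Z` -/

section BaseFiltration

attribute [local instance] baseModule

variable {k : Type u} [Field k] {Z Y : Type u} [AddCommGroup Z] [Module k Z]
  [AddCommGroup Y] [Module k Y] {𝒵 : ℕ → Submodule k Z} {𝒴 : ℕ → Submodule k Y} {I J : Type u}

namespace FreeCGA.GradedBasis

variable {BZ : GradedBasis 𝒵 I} {BY : GradedBasis 𝒴 J}

theorem inclBase_x_mem_degree (BZ : GradedBasis 𝒵 I) (BY : GradedBasis 𝒴 J) (i : I) :
    inclBase 𝒵 𝒴 (BZ.x i) ∈ degree (sumGrading 𝒵 𝒴) (BZ.deg i) := by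
  rw [inclBase_x BZ BY, (BZ.sum BY).degree_eq]
  exact (BZ.sum BY).x_mem_supported (by simp)

theorem inclFiber_x_mem_degree (BZ : GradedBasis 𝒵 I) (BY : GradedBasis 𝒴 J) (j : J) :
    inclFiber 𝒵 𝒴 (BY.x j) ∈ degree (sumGrading 𝒵 𝒴) (BY.deg j) := by
  rw [inclFiber_x BZ BY, (BZ.sum BY).degree_eq]
  exact (BZ.sum BY).x_mem_supported (by simp)

theorem projFiber_x_mem_degree (BZ : GradedBasis 𝒵 I) (BY : GradedBasis 𝒴 J) (c : I ⊕ J) :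
    projFiber 𝒵 𝒴 ((BZ.sum BY).x c) ∈ degree 𝒴 ((BZ.sum BY).deg c) := by
  rcases c with i | j
  · rw [projFiber_x_inl]; exact zero_mem _
  · rw [projFiber_x_inr, BY.degree_eq]; exact BY.x_mem_supported (by simp)

theorem inclBase_sgn (BZ : GradedBasis 𝒵 I) (BY : GradedBasis 𝒴 J) (a : FreeCGA 𝒵) :
    (BZ.sum BY).sgn (inclBase 𝒵 𝒴 a) = inclBase 𝒵 𝒴 (BZ.sgn a) :=
  BZ.map_sgn (BZ.sum BY) _ (inclBase_x_mem_degree BZ BY) a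

theorem inclFiber_sgn (BZ : GradedBasis 𝒵 I) (BY : GradedBasis 𝒴 J) (a : FreeCGA 𝒴) :
    (BZ.sum BY).sgn (inclFiber 𝒵 𝒴 a) = inclFiber 𝒵 𝒴 (BY.sgn a) :=
  BY.map_sgn (BZ.sum BY) _ (inclFiber_x_mem_degree BZ BY) a

theorem projFiber_sgn (BZ : GradedBasis 𝒵 I) (BY : GradedBasis 𝒴 J) (a : FreeCGA (sumGrading 𝒵 𝒴)) :
    BY.sgn (projFiber 𝒵 𝒴 a) = projFiber 𝒵 𝒴 ((BZ.sum BY).sgn a) :=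
  (BZ.sum BY).map_sgn BY _ (projFiber_x_mem_degree BZ BY) a

/-- The derivation induced on the fiber. -/
def OddDerivation.fiber (θ : (BZ.sum BY).OddDerivation) : BY.OddDerivation where
  toLin := (projFiber 𝒵 𝒴).toLinearMap ∘ₗ θ.toLin ∘ₗ (inclFiber 𝒵 𝒴).toLinearMap
  map_mul a b := by
    simp only [LinearMap.comp_apply, AlgHom.toLinearMap_apply, _root_.map_mul, θ.map_mul, map_add,
      projFiber_inclFiber BY, inclFiber_sgn]
  sgn_map a := by
    simp only [LinearMap.comp_apply, AlgHom.toLinearMap_apply]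
    rw [projFiber_sgn BZ BY, θ.sgn_map, map_neg, inclFiber_sgn]

/-- The differential does not lower the wordlength in the letters of the base. -/
theorem differential_mem_base (dZ : Differential 𝒵) (d : Differential (sumGrading 𝒵 𝒴))
    (hbase : ∀ a, d.toLin (inclBase 𝒵 𝒴 a) = inclBase 𝒵 𝒴 (dZ.toLin a)) {a : ℕ}
    {x : FreeCGA (sumGrading 𝒵 𝒴)} (hx : x ∈ (BZ.sum BY).supported fun S => a ≤ (basePart S).card) :
    d.toLin x ∈ (BZ.sum BY).supported fun S => a ≤ (basePart S).card := by
  refine ((BZ.sum BY).ofDifferential d).isSkewDerivation.map_mem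
    (ρ := fun c T => (basePart {c}).card ≤ (basePart T).card) ?_ ?_ hx
  · rintro (i | j)
    · rw [← inclBase_x BZ BY]
      change d.toLin _ ∈ _
      rw [hbase]
      have h := dZ.degree_succ _ _ (BZ.listProd_mem_degree [i])
      rw [BZ.degree_eq, listProd_cons, listProd_nil, mul_one] at h
      refine supported_mono ?_ (inclBase_mem BY h)
      rintro S ⟨-, hS⟩
      have : basePart S ≠ 0 := by
        intro h0
        rw [h0] at hS
        simp at hS
      have h1 : basePart ({Sum.inl i} : Multiset (I ⊕ J)) = {i} := by
        rw [← Multiset.cons_zero, basePart_cons_inl]; rfl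
      rw [h1, Multiset.card_singleton]
      exact Multiset.card_pos.2 this
    · refine supported_mono (fun S _ => ?_) ((BZ.sum BY).mem_supported_true _)
      have h1 : basePart ({Sum.inr j} : Multiset (I ⊕ J)) = 0 := by
        rw [← Multiset.cons_zero, basePart_cons_inr]; rfl
      simp [h1]
  · intro S' S h h'
    exact h'.trans (Step.le (ν := fun S => (basePart S).card) (by simp) (fun _ _ h => h) _ _ h)

theorem homotopy_identity {R : Type*} [Ring R] [Module k R] (d H : R →ₗ[k] R)
    {a a' da da' b hb db dhb hdb : R} (h1 : d (a * b) = da * b + a' * d b)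
    (h2 : d (a' * hb) = da' * hb + a * d hb) (h3 : H (a * b) = a' * hb)
    (h4 : H (da * b) = - (da' * hb)) (h5 : H (a' * db) = a * hdb) (h6 : dhb + hdb = b) :
    d (H (a * b)) + H (d (a * b)) - a * b = a * (d hb - dhb) + H (a' * (d b - db)) := by
  rw [h3, h1, h2, map_add, h4, mul_sub a' , map_sub, h5, ← h6]
  noncomm_ring

theorem inclBase_listProd_mul_mem {p p' : Multiset (I ⊕ J) → Prop} {l : List I}
    (h : ∀ S T, basePart S = l → fiberPart S = 0 → p T → p' (S + T))
    {e : FreeCGA (sumGrading 𝒵 𝒴)} (he : e ∈ (BZ.sum BY).supported p) :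
    inclBase 𝒵 𝒴 (BZ.listProd l) * e ∈ (BZ.sum BY).supported p' :=
  mul_mem_supported (fun S T hS hT => h S T hS.2 hS.1 hT)
    (inclBase_mem BY (listProd_mem (p := (· = (l : Multiset I))) rfl)) he

theorem fiber_extension_mem {h : FreeCGA 𝒴 →ₗ[k] FreeCGA 𝒴}
    {H : FreeCGA (sumGrading 𝒵 𝒴) →ₗ[k] FreeCGA (sumGrading 𝒵 𝒴)}
    (hH : ∀ a b, H (inclBase 𝒵 𝒴 a * inclFiber 𝒵 𝒴 b) =
      inclBase 𝒵 𝒴 (BZ.sgn a) * inclFiber 𝒵 𝒴 (h b)) {p p' : Multiset J → Prop}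
    (hh : ∀ b ∈ BY.supported p', h b ∈ BY.supported p) (r : Multiset I → Prop)
    {x : FreeCGA (sumGrading 𝒵 𝒴)}
    (hx : x ∈ (BZ.sum BY).supported fun S => r (basePart S) ∧ p' (fiberPart S)) :
    H x ∈ (BZ.sum BY).supported fun S => r (basePart S) ∧ p (fiberPart S) := by
  refine map_mem_of_listProd H (fun l hl => ?_) hx
  obtain ⟨ε, l₁, l₂, h1, h2, e⟩ := exists_listProd_sum BZ BY l
  rw [e, map_smul, hH, sgn_listProd, map_smul, smul_mul_assoc]
  refine Submodule.smul_mem _ _ (Submodule.smul_mem _ _ ?_)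
  refine inclBase_listProd_mul_mem ?_
    (inclFiber_mem BZ (hh _ (listProd_mem (by rw [h2]; exact hl.2))))
  rintro S T hS hS' ⟨hT, hT'⟩
  rw [basePart_add, fiberPart_add, hS, hS', hT, add_zero, zero_add, h1]
  exact ⟨hl.1, hT'⟩

/-- The extension of a homotopy on the fiber is a homotopy modulo longer words in the letters of
the base. -/
theorem fiber_extension_homotopy (dZ : Differential 𝒵) (d : Differential (sumGrading 𝒵 𝒴))
    (hbase : ∀ a, d.toLin (inclBase 𝒵 𝒴 a) = inclBase 𝒵 𝒴 (dZ.toLin a))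
    (dY : FreeCGA 𝒴 →ₗ[k] FreeCGA 𝒴)
    (hfib : ∀ a, dY a = projFiber 𝒵 𝒴 (d.toLin (inclFiber 𝒵 𝒴 a)))
    {p' : Multiset J → Prop} {h : FreeCGA 𝒴 →ₗ[k] FreeCGA 𝒴}
    (hh : ∀ b ∈ BY.supported p', dY (h b) + h (dY b) = b)
    {H : FreeCGA (sumGrading 𝒵 𝒴) →ₗ[k] FreeCGA (sumGrading 𝒵 𝒴)}
    (hH : ∀ a b, H (inclBase 𝒵 𝒴 a * inclFiber 𝒵 𝒴 b) =
      inclBase 𝒵 𝒴 (BZ.sgn a) * inclFiber 𝒵 𝒴 (h b)) {a : ℕ} {x : FreeCGA (sumGrading 𝒵 𝒴)}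
    (hx : x ∈ (BZ.sum BY).supported fun S => (basePart S).card = a ∧ p' (fiberPart S)) :
    d.toLin (H x) + H (d.toLin x) - x ∈
      (BZ.sum BY).supported fun S => a + 1 ≤ (basePart S).card := by
  refine map_mem_of_listProd (d.toLin ∘ₗ H + H ∘ₗ d.toLin - LinearMap.id) (fun l hl => ?_) hx
  obtain ⟨ε, l₁, l₂, h1, h2, e⟩ := exists_listProd_sum BZ BY l
  rw [e, map_smul]
  refine Submodule.smul_mem _ _ ?_
  have hβ := hh _ (listProd_mem (B := BY) (l := l₂) (by rw [h2]; exact hl.2))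
  have hmul : ∀ e ∈ (BZ.sum BY).supported (fun S => 1 ≤ (basePart S).card),
      inclBase 𝒵 𝒴 (BZ.listProd l₁) * e ∈
        (BZ.sum BY).supported fun S => a + 1 ≤ (basePart S).card := by
    intro e he
    refine inclBase_listProd_mul_mem (fun S T hS _ hT => ?_) he
    rw [basePart_add, Multiset.card_add, hS, h1, hl.1]
    exact Nat.add_le_add_left hT a
  have hd : ∀ a b, d.toLin (inclBase 𝒵 𝒴 a * b) =
      inclBase 𝒵 𝒴 (dZ.toLin a) * b + inclBase 𝒵 𝒴 (BZ.sgn a) * d.toLin b := by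
    intro a b
    rw [← hbase, ← inclBase_sgn BZ BY]
    exact ((BZ.sum BY).ofDifferential d).map_mul (inclBase 𝒵 𝒴 a) b
  have hs : BZ.sgn (dZ.toLin (BZ.listProd l₁)) = - dZ.toLin (BZ.sgn (BZ.listProd l₁)) :=
    (BZ.ofDifferential dZ).sgn_map _
  have e3 := homotopy_identity d.toLin H (db := inclFiber 𝒵 𝒴 (dY (BY.listProd l₂)))
    (dhb := inclFiber 𝒵 𝒴 (dY (h (BY.listProd l₂)))) (hd (BZ.listProd l₁) _)
    (by rw [hd, sgn_sgn]) (hH (BZ.listProd l₁) (BY.listProd l₂))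
    (by rw [hH, hs, map_neg, neg_mul]) (by rw [hH, sgn_sgn]) (by rw [← map_add, hβ])
  simp only [LinearMap.sub_apply, LinearMap.add_apply, LinearMap.comp_apply, LinearMap.id_apply]
  rw [e3]
  refine add_mem (hmul _ ?_) ?_
  · rw [hfib]
    exact sub_inclFiber_projFiber_mem BZ BY _
  · rw [sgn_listProd, map_smul, smul_mul_assoc, map_smul]
    refine Submodule.smul_mem _ _ ?_
    refine supported_mono (fun S hS => hS.1) (fiber_extension_mem hH (p := fun _ => True)
      (p' := fun _ => True) (fun _ _ => BY.mem_supported_true _) (fun S => a + 1 ≤ S.card) ?_)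
    refine supported_mono (fun S hS => ⟨hS, trivial⟩) (hmul _ ?_)
    rw [hfib]
    exact sub_inclFiber_projFiber_mem BZ BY _

variable [CharZero k]

/-- A linear endomorphism of the fiber extends to `ΛZ ⊗ ΛY`, with the sign rule for odd maps. -/
theorem exists_fiber_extension (BZ : GradedBasis 𝒵 I) (BY : GradedBasis 𝒴 J)
    (h : FreeCGA 𝒴 →ₗ[k] FreeCGA 𝒴) :
    ∃ H : FreeCGA (sumGrading 𝒵 𝒴) →ₗ[k] FreeCGA (sumGrading 𝒵 𝒴), ∀ a b,
      H (inclBase 𝒵 𝒴 a * inclFiber 𝒵 𝒴 b) = inclBase 𝒵 𝒴 (BZ.sgn a) * inclFiber 𝒵 𝒴 (h b) := by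
  have hli : LinearIndependent k
      (fun t : {S : Multiset I // BZ.Adm S} × {T : Multiset J // BY.Adm T} =>
        inclBase 𝒵 𝒴 (BZ.basis t.1) * inclFiber 𝒵 𝒴 (BY.basis t.2)) := by
    have h1 := BZ.basis.linearIndependent
    have h2 := linearIndependent_fiberBasis BZ BY
    have h3 := linearIndependent_smul (R := k) h1 h2
    exact h3
  let b := Module.Basis.span hli
  obtain ⟨H, hH⟩ := LinearMap.exists_extend (b.constr k fun t =>
    inclBase 𝒵 𝒴 (BZ.sgn (BZ.basis t.1)) * inclFiber 𝒵 𝒴 (h (BY.basis t.2)))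
  refine ⟨H, ?_⟩
  let f : FreeCGA 𝒵 →ₗ[k] FreeCGA 𝒴 →ₗ[k] FreeCGA (sumGrading 𝒵 𝒴) :=
    (LinearMap.mul k _).compl₁₂ (inclBase 𝒵 𝒴).toLinearMap (inclFiber 𝒵 𝒴).toLinearMap
  let g : FreeCGA 𝒵 →ₗ[k] FreeCGA 𝒴 →ₗ[k] FreeCGA (sumGrading 𝒵 𝒴) :=
    (LinearMap.mul k _).compl₁₂ ((inclBase 𝒵 𝒴).toLinearMap ∘ₗ BZ.sgn.toLinearMap)
      ((inclFiber 𝒵 𝒴).toLinearMap ∘ₗ h)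
  have key : f.compr₂ H = g := by
    refine BZ.basis.ext fun S => BY.basis.ext fun T => ?_
    have h1 := LinearMap.congr_fun hH (b (S, T))
    rw [Module.Basis.constr_basis] at h1
    rw [← show _ = g (BZ.basis S) (BY.basis T) from h1]
    change H (inclBase 𝒵 𝒴 (BZ.basis S) * inclFiber 𝒵 𝒴 (BY.basis T)) = H (b (S, T)).1
    rw [Module.Basis.span_apply hli]
  exact fun a b => LinearMap.congr_fun₂ key a b

/-- One step of the comparison between `ΛZ ⊗ ΛY` and its fiber: a homotopy on the fiber is used to
remove, from a cocycle, the terms of lowest wordlength in the letters of the base. -/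
theorem exists_sub_differential_mem (dZ : Differential 𝒵) (d : Differential (sumGrading 𝒵 𝒴))
    (hbase : ∀ a, d.toLin (inclBase 𝒵 𝒴 a) = inclBase 𝒵 𝒴 (dZ.toLin a))
    (dY : FreeCGA 𝒴 →ₗ[k] FreeCGA 𝒴)
    (hfib : ∀ a, dY a = projFiber 𝒵 𝒴 (d.toLin (inclFiber 𝒵 𝒴 a)))
    {p p' : Multiset J → Prop} (h : FreeCGA 𝒴 →ₗ[k] FreeCGA 𝒴)
    (hh : ∀ b ∈ BY.supported p', h b ∈ BY.supported p ∧ dY (h b) + h (dY b) = b) {a : ℕ}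
    {y : FreeCGA (sumGrading 𝒵 𝒴)}
    (hy : y ∈ (BZ.sum BY).supported fun S => a ≤ (basePart S).card)
    (hy' : y ∈ (BZ.sum BY).supported fun S => (basePart S).card = a → p' (fiberPart S))
    (hdy : d.toLin y = 0) :
    ∃ t ∈ (BZ.sum BY).supported fun S => (basePart S).card = a ∧ p (fiberPart S),
      y - d.toLin t ∈ (BZ.sum BY).supported fun S => a + 1 ≤ (basePart S).card := by
  obtain ⟨H, hH⟩ := exists_fiber_extension BZ BY h
  have hy₀ := (BZ.sum BY).proj_mem (p := fun S => (basePart S).card = a) hy'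
  have hy₁ := (BZ.sum BY).sub_proj_mem (p := fun S => (basePart S).card = a) hy
  generalize (BZ.sum BY).proj (fun S => (basePart S).card = a) y = y₀ at hy₀ hy₁
  replace hy₀ : y₀ ∈ (BZ.sum BY).supported fun S => (basePart S).card = a ∧ p' (fiberPart S) :=
    supported_mono (fun S hS => ⟨hS.2, hS.1 hS.2⟩) hy₀
  replace hy₁ : y - y₀ ∈ (BZ.sum BY).supported fun S => a + 1 ≤ (basePart S).card := by
    refine supported_mono ?_ hy₁
    rintro S ⟨h1, h2⟩
    exact Nat.lt_of_le_of_ne h1 fun h => h2 h.symm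
  refine ⟨H y₀, fiber_extension_mem hH (fun b hb => (hh b hb).1) (fun S => S.card = a) hy₀, ?_⟩
  have h1 : H (d.toLin y₀) ∈ (BZ.sum BY).supported fun S => a + 1 ≤ (basePart S).card := by
    have h2 : d.toLin y₀ = - d.toLin (y - y₀) := by rw [map_sub, hdy, zero_sub, neg_neg]
    have h3 := neg_mem (differential_mem_base dZ d hbase hy₁)
    rw [← h2] at h3
    exact supported_mono (fun S hS => hS.1) (fiber_extension_mem hH (p := fun _ => True)
      (p' := fun _ => True) (fun _ _ => BY.mem_supported_true _) (fun S => a + 1 ≤ S.card)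
      (supported_mono (fun S hS => ⟨hS, trivial⟩) h3))
  have h4 := fiber_extension_homotopy dZ d hbase dY hfib (fun b hb => (hh b hb).2) hH hy₀
  have e : y - d.toLin (H y₀) = -(d.toLin (H y₀) + H (d.toLin y₀) - y₀) + H (d.toLin y₀) +
      (y - y₀) := by abel
  rw [e]
  exact add_mem (add_mem (neg_mem h4) h1) hy₁

end FreeCGA.GradedBasis

end BaseFiltration

/-! ### The linear part of a differential -/

section LinearPart

variable {k : Type u} [Field k] {V : Type u} [AddCommGroup V] [Module k V]
  {𝒱 : ℕ → Submodule k V} {I : Type u} {B : GradedBasis 𝒱 I}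

namespace FreeCGA

theorem ι_mem_degree {n : ℕ} {v : V} (hv : v ∈ 𝒱 n) : ι 𝒱 v ∈ degree 𝒱 n :=
  Submodule.subset_span ⟨[(n, v)], by simpa using hv, by simp, by simp⟩

namespace GradedBasis

theorem isOddFamily_of_degree {g : I → FreeCGA 𝒱} (n : I → ℕ) (hg : ∀ i, g i ∈ degree 𝒱 (n i))
    (hn : ∀ i, Even (n i + (B.deg i + 1))) : B.IsOddFamily g := by
  intro i
  have h := hg i
  rw [B.degree_eq] at h
  refine supported_mono (fun S hS => ?_) h
  rw [hS]
  have h1 := (hn i).neg_one_pow (α := k)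
  rw [pow_add] at h1
  have h2 := FreeCGA.neg_one_pow_mul_self (R := k) (B.deg i + 1)
  exact mul_right_cancel₀ (pow_ne_zero (B.deg i + 1) (neg_ne_zero.2 one_ne_zero)) (h1.trans h2.symm)

/-- A derivation which is nilpotent on the letters in the sense that it replaces each letter by
smaller ones is locally nilpotent. -/
theorem IsSkewDerivation.exists_pow_eq_zero {σ : FreeCGA 𝒱 →ₐ[k] FreeCGA 𝒱}
    {θ : FreeCGA 𝒱 →ₗ[k] FreeCGA 𝒱} (h : B.IsSkewDerivation σ θ) {ρ : I → Multiset I → Prop}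
    (hρ : ∀ i, θ (B.x i) ∈ B.supported (ρ i)) (wf : WellFounded (Relation.TransGen (Step ρ)))
    (a : FreeCGA 𝒱) : ∃ N, (θ ^ N) a = 0 := by
  have key : ∀ S : Multiset I, ∀ l : List I, (l : Multiset I) = S →
      B.listProd l ∈ Module.End.maxGenEigenspace θ 0 := by
    intro S
    induction S using wf.induction with
    | _ S ih =>
      rintro l rfl
      have h1 : B.supported (fun S => Step ρ S l) ≤ Module.End.maxGenEigenspace θ 0 :=
        B.supported_le fun l' hl' => ih _ (.single hl') l' rfl
      have h2 := h1 (h.listProd_mem hρ l)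
      rw [Module.End.mem_maxGenEigenspace] at h2 ⊢
      obtain ⟨N, hN⟩ := h2
      refine ⟨N + 1, ?_⟩
      rw [zero_smul, sub_zero] at hN ⊢
      rw [pow_succ, Module.End.mul_apply, hN]
  have h1 : B.supported (fun _ => True) ≤ Module.End.maxGenEigenspace θ 0 :=
    B.supported_le fun l _ => key _ l rfl
  obtain ⟨N, hN⟩ := (Module.End.mem_maxGenEigenspace _ _ _).1 (h1 (B.mem_supported_true a))
  rw [zero_smul, sub_zero] at hN
  exact ⟨N, hN⟩

theorem differential_x_mem (d : Differential 𝒱) (i : I) :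
    d.toLin (B.x i) ∈ B.supported fun S => (S.map B.deg).sum = B.deg i + 1 ∧ 1 ≤ S.card := by
  have h := d.degree_succ _ _ (B.listProd_mem_degree [i])
  rw [B.degree_eq, listProd_cons, listProd_nil, mul_one] at h
  refine supported_mono ?_ h
  intro S hS
  refine ⟨by simpa using hS, Multiset.card_pos.2 ?_⟩
  rintro rfl
  simp at hS

variable [CharZero k]

/-- An endomorphism of `ΛV` which is the identity up to replacing letters by smaller ones is an
automorphism. -/
theorem exists_algEquiv (φ : FreeCGA 𝒱 →ₐ[k] FreeCGA 𝒱) {ρ : I → Multiset I → Prop}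
    (h : ∀ i, φ (B.x i) - B.x i ∈ B.supported (ρ i))
    (wf : WellFounded (Relation.TransGen (Step ρ))) :
    ∃ Φ : FreeCGA 𝒱 ≃ₐ[k] FreeCGA 𝒱, (∀ a, Φ a = φ a) ∧
      ∀ p : Multiset I → Prop, (∀ S' S, Step ρ S' S → p S → p S') →
        ∀ a ∈ B.supported p, Φ a ∈ B.supported p ∧ Φ.symm a ∈ B.supported p := by
  have hT : ∀ l : List I, φ.toLinearMap (B.listProd l) - (1 : k) • B.listProd l ∈
      B.supported fun S => Relation.TransGen (Step ρ) S l := fun l => by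
    rw [one_smul]; exact algHom_sub_mem φ h l
  have hinj : Function.Injective φ := by
    rw [injective_iff_map_eq_zero]
    intro a ha
    exact triangular_injective (p := fun _ => True) (c := fun _ => 1) wf
      (fun _ _ _ h h' => h.trans h') (fun _ _ => one_ne_zero) (fun l _ => hT l)
      (B.mem_supported_true a) ha
  have hsurj : ∀ p : Multiset I → Prop, (∀ S' S, Step ρ S' S → p S → p S') →
      ∀ a ∈ B.supported p, ∃ b ∈ B.supported p, φ b = a := fun p hp a ha =>
    triangular_surjective (T := φ.toLinearMap) (c := fun _ => 1) wf
      (fun _ _ h h' => Step.transGen_of_closed hp h' h) (fun _ _ => one_ne_zero)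
      (fun l _ => hT l) ha
  let Φ := AlgEquiv.ofBijective φ ⟨hinj, fun a => by
    obtain ⟨b, -, hb⟩ := hsurj _ (fun _ _ _ h => h) a (B.mem_supported_true a)
    exact ⟨b, hb⟩⟩
  refine ⟨Φ, fun a => rfl, fun p hp a ha => ⟨?_, ?_⟩⟩
  · exact triangular_mem (T := φ.toLinearMap) (c := fun _ => 1)
      (fun _ _ h h' => Step.transGen_of_closed hp h' h) (fun l _ => hT l) ha
  · obtain ⟨b, hb, e⟩ := hsurj p hp a ha
    rw [← e, ← show Φ b = φ b from rfl, AlgEquiv.symm_apply_apply]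
    exact hb

variable (B) in
/-- The component of wordlength one of an element of `ΛV`. -/
def linearPart : FreeCGA 𝒱 →ₗ[k] V :=
  B.basis.constr k fun S => if S.1.card = 1 then (S.1.map B.b).sum else 0

theorem linearPart_listProd_of_ne {l : List I} (hl : l.length ≠ 1) :
    B.linearPart (B.listProd l) = 0 := by
  by_cases h : B.Adm (l : Multiset I)
  · obtain ⟨ε, -, e⟩ := B.exists_listProd_eq_smul h
    rw [e, map_smul, linearPart, Module.Basis.constr_basis, if_neg (by simpa using hl), smul_zero]
  · rw [B.listProd_eq_zero h, map_zero]

theorem linearPart_x (i : I) : B.linearPart (B.x i) = B.b i := by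
  have h : B.Adm {i} := by
    intro j S' h _ hm
    have := congrArg Multiset.card h
    rw [Multiset.card_singleton, Multiset.card_cons] at this
    have h0 : S' = 0 := Multiset.card_eq_zero.1 (by omega)
    rw [h0] at hm
    exact Multiset.notMem_zero _ hm
  have e : B.x i = B.basis ⟨{i}, h⟩ := by rw [basis_apply]; simp
  rw [e, linearPart, Module.Basis.constr_basis, if_pos (Multiset.card_singleton i)]
  simp

theorem linearPart_of_mem {a : FreeCGA 𝒱} (ha : a ∈ B.supported fun S => S.card ≠ 1) :
    B.linearPart a = 0 :=
  linearMap_eqOn (g := 0) (fun l hl => linearPart_listProd_of_ne (by simpa using hl)) ha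

theorem linearPart_mem {p : Multiset I → Prop} {a : FreeCGA 𝒱} (ha : a ∈ B.supported p) :
    B.linearPart a ∈ Submodule.span k (B.b '' {i | p {i}}) := by
  refine map_mem_of_listProd B.linearPart (fun l hl => ?_) ha
  by_cases h : l.length = 1
  · obtain ⟨i, rfl⟩ := List.length_eq_one_iff.1 h
    rw [listProd_cons, listProd_nil, mul_one, linearPart_x]
    exact Submodule.subset_span ⟨i, hl, rfl⟩
  · rw [linearPart_listProd_of_ne h]; exact zero_mem _

theorem sub_linearPart_mem {p : Multiset I → Prop} {a : FreeCGA 𝒱} (ha : a ∈ B.supported p) :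
    a - ι 𝒱 (B.linearPart a) ∈ B.supported fun S => p S ∧ S.card ≠ 1 := by
  refine map_mem_of_listProd (LinearMap.id - ι 𝒱 ∘ₗ B.linearPart) (fun l hl => ?_) ha
  change B.listProd l - ι 𝒱 (B.linearPart (B.listProd l)) ∈ _
  by_cases h : l.length = 1
  · obtain ⟨i, rfl⟩ := List.length_eq_one_iff.1 h
    rw [listProd_cons, listProd_nil, mul_one, linearPart_x]
    change B.x i - B.x i ∈ _
    rw [sub_self]; exact zero_mem _
  · rw [linearPart_listProd_of_ne h, map_zero, sub_zero]
    exact listProd_mem ⟨hl, by simpa using h⟩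

variable (B) in
/-- The linear part of a differential. -/
def linearDiff (d : Differential 𝒱) : V →ₗ[k] V := B.linearPart ∘ₗ d.toLin ∘ₗ ι 𝒱

theorem linearDiff_mem (d : Differential 𝒱) (i : I) : B.linearDiff d (B.b i) ∈ 𝒱 (B.deg i + 1) := by
  have h := linearPart_mem (differential_x_mem (B := B) d i)
  refine (Submodule.span_le.2 ?_ : _ ≤ 𝒱 (B.deg i + 1)) h
  rintro _ ⟨j, ⟨hj, -⟩, rfl⟩
  rw [← hj]
  simpa using B.mem j

/-- The linear part of a differential is a differential, as a differential does not lower the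
wordlength: the letters have non-negative degree. -/
theorem linearDiff_linearDiff (h𝒱 : DirectSum.IsInternal 𝒱) (d : Differential 𝒱) (v : V) :
    B.linearDiff d (B.linearDiff d v) = 0 := by
  have h0 : B.linearDiff d ∘ₗ B.linearDiff d = 0 := B.b.ext fun i => by
    have h1 := sub_linearPart_mem (differential_x_mem (B := B) d i)
    have h2 : d.toLin (B.x i) - ι 𝒱 (B.linearPart (d.toLin (B.x i))) ∈ wordGE 𝒱 2 := by
      rw [B.mem_wordGE_iff]
      refine supported_mono ?_ h1
      rintro S ⟨⟨-, hS⟩, hS'⟩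
      omega
    have h3 := d.mem_wordGE h𝒱 2 _ h2
    rw [B.mem_wordGE_iff] at h3
    have h4 := linearPart_of_mem (supported_mono (fun S hS => by omega) h3)
    rw [map_sub, d.sq_zero, zero_sub, map_neg, neg_eq_zero] at h4
    exact h4
  exact LinearMap.congr_fun h0 v

end GradedBasis

end FreeCGA

end LinearPart

/-! ### A cylinder of a Sullivan algebra -/

namespace Cylinder

variable {k : Type u} [Field k] {W : Type u} [AddCommGroup W] [Module k W]
  {𝒲 : ℕ → Submodule k W} {I : Type u}

/-- The suspension of a graded vector space. -/
def susp (𝒲 : ℕ → Submodule k W) (n : ℕ) : Submodule k W := 𝒲 (n + 1)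

/-- The graded vector space `W ⊕ (sW ⊕ W)` which generates the cylinder. Its three summands are
spanned by the letters `r i`, `s i` and `v i`. -/
abbrev cyl (𝒲 : ℕ → Submodule k W) : ℕ → Submodule k (W × W × W) :=
  sumGrading 𝒲 (sumGrading (susp 𝒲) 𝒲)

variable (𝒲) in
/-- The inclusion of `ΛW` on the letters `v i`. -/
def inclV : FreeCGA 𝒲 →ₐ[k] FreeCGA (cyl 𝒲) :=
  (inclFiber 𝒲 (sumGrading (susp 𝒲) 𝒲)).comp (inclFiber (susp 𝒲) 𝒲)

variable (𝒲) in
/-- The projection to `ΛW` which kills the letters `r i` and `s i`. -/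
def projV : FreeCGA (cyl 𝒲) →ₐ[k] FreeCGA 𝒲 :=
  (projFiber (susp 𝒲) 𝒲).comp (projFiber 𝒲 (sumGrading (susp 𝒲) 𝒲))

variable (𝒲) in
/-- The projection to `ΛW` which identifies `r i` and `v i` and kills `s i`. -/
def fold : FreeCGA (cyl 𝒲) →ₐ[k] FreeCGA 𝒲 :=
  FreeCGA.map (cyl 𝒲) 𝒲
    (LinearMap.fst k W (W × W) + LinearMap.snd k W W ∘ₗ LinearMap.snd k W (W × W))
    fun _ _ h => add_mem h.1 h.2.2

/-- The homogeneous basis of the suspension. -/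
def suspBasis (B : GradedBasis 𝒲 I) (hpos : ∀ i, 0 < B.deg i) : GradedBasis (susp 𝒲) I where
  b := B.b
  deg i := B.deg i - 1
  mem i := by
    have := B.mem i
    rwa [← Nat.sub_add_cancel (hpos i)] at this
  deg_of_mem n v hv i hi := by
    have := B.deg_of_mem (n + 1) v hv i hi
    omega

variable (B : GradedBasis 𝒲 I) (hpos : ∀ i, 0 < B.deg i)

/-- The letters `s i` and `v i`. -/
abbrev svBasis : GradedBasis (sumGrading (susp 𝒲) 𝒲) (I ⊕ I) := (suspBasis B hpos).sum B

/-- The letters `r i`, `s i` and `v i`. -/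
abbrev cylBasis : GradedBasis (cyl 𝒲) (I ⊕ (I ⊕ I)) := B.sum (svBasis B hpos)

theorem x_r (i : I) : (cylBasis B hpos).x (Sum.inl i) = ι (cyl 𝒲) (B.b i, 0, 0) := by
  simp [x, GradedBasis.sum]; rfl

theorem x_s (i : I) : (cylBasis B hpos).x (Sum.inr (Sum.inl i)) = ι (cyl 𝒲) (0, B.b i, 0) := by
  simp [x, GradedBasis.sum, suspBasis]

theorem x_v (i : I) : (cylBasis B hpos).x (Sum.inr (Sum.inr i)) = ι (cyl 𝒲) (0, 0, B.b i) := by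
  simp [x, GradedBasis.sum]

theorem inclV_ι (w : W) : inclV 𝒲 (ι 𝒲 w) = ι (cyl 𝒲) (0, 0, w) :=
  (congrArg _ (FreeCGA.map_ι ..)).trans (FreeCGA.map_ι ..)

theorem projV_ι (w : W × W × W) : projV 𝒲 (ι (cyl 𝒲) w) = ι 𝒲 w.2.2 :=
  (congrArg _ (FreeCGA.map_ι ..)).trans (FreeCGA.map_ι ..)

theorem fold_ι (w : W × W × W) : fold 𝒲 (ι (cyl 𝒲) w) = ι 𝒲 (w.1 + w.2.2) :=
  FreeCGA.map_ι ..

theorem inclV_x (i : I) : inclV 𝒲 (B.x i) = (cylBasis B hpos).x (Sum.inr (Sum.inr i)) := by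
  rw [x_v]; exact inclV_ι _

theorem inclBase_x_r (i : I) :
    inclBase 𝒲 (sumGrading (susp 𝒲) 𝒲) (B.x i) = (cylBasis B hpos).x (Sum.inl i) :=
  inclBase_x B (svBasis B hpos) i

theorem inclV_x_mem_degree (B : GradedBasis 𝒲 I) (hpos : ∀ i, 0 < B.deg i) (i : I) :
    inclV 𝒲 (B.x i) ∈ degree (cyl 𝒲) (B.deg i) := by
  rw [inclV_x B hpos, (cylBasis B hpos).degree_eq]
  exact (cylBasis B hpos).x_mem_supported (by simp)

variable {B} in
theorem inclV_mem {p : Multiset I → Prop} {a : FreeCGA 𝒲} (ha : a ∈ B.supported p) :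
    inclV 𝒲 a ∈ (cylBasis B hpos).supported fun S => basePart S = 0 ∧
      basePart (fiberPart S) = 0 ∧ p (fiberPart (fiberPart S)) := by
  have h1 := inclFiber_mem (suspBasis B hpos) ha
  have h2 := inclFiber_mem B h1
  exact h2

variable {B hpos} in
theorem projV_mem {p : Multiset I → Prop} {a : FreeCGA (cyl 𝒲)}
    (ha : a ∈ (cylBasis B hpos).supported fun S => p (fiberPart (fiberPart S))) :
    projV 𝒲 a ∈ B.supported p := by
  refine supported_mono ?_ (projFiber_mem (projFiber_mem ha))
  intro S hS
  rwa [fiberPart_map_inr, fiberPart_map_inr] at hS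

theorem projV_inclV (B : GradedBasis 𝒲 I) (a : FreeCGA 𝒲) : projV 𝒲 (inclV 𝒲 a) = a := by
  refine B.algHom_ext (f := (projV 𝒲).comp (inclV 𝒲)) (g := AlgHom.id k _) (fun i => ?_) a
  exact (congrArg _ (inclV_ι _)).trans (projV_ι _)

theorem fold_inclV (B : GradedBasis 𝒲 I) (a : FreeCGA 𝒲) : fold 𝒲 (inclV 𝒲 a) = a := by
  refine B.algHom_ext (f := (fold 𝒲).comp (inclV 𝒲)) (g := AlgHom.id k _) (fun i => ?_) a
  exact (congrArg _ (inclV_ι _)).trans ((fold_ι _).trans (by simp [x]))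

theorem fold_inclBase (B : GradedBasis 𝒲 I) (a : FreeCGA 𝒲) : fold 𝒲 (inclBase 𝒲 _ a) = a := by
  refine B.algHom_ext (f := (fold 𝒲).comp (inclBase 𝒲 _)) (g := AlgHom.id k _) (fun i => ?_) a
  exact (congrArg _ (FreeCGA.map_ι ..)).trans ((fold_ι _).trans (by simp [x]))

theorem sub_inclV_projV_mem (a : FreeCGA (cyl 𝒲)) : a - inclV 𝒲 (projV 𝒲 a) ∈
    (cylBasis B hpos).supported fun S => (∃ i, Sum.inl i ∈ S) ∨ ∃ i, Sum.inr (Sum.inl i) ∈ S := by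
  have h1 := sub_inclFiber_projFiber_mem B (svBasis B hpos) a
  have h2 := inclFiber_mem B (sub_inclFiber_projFiber_mem (suspBasis B hpos) B
    (projFiber 𝒲 (sumGrading (susp 𝒲) 𝒲) a))
  have h3 := add_mem (supported_mono (q := fun S => (∃ i, Sum.inl i ∈ S) ∨
      ∃ i, Sum.inr (Sum.inl i) ∈ S) ?_ h1) (supported_mono ?_ h2)
  · rw [map_sub] at h3
    have e : ∀ {R : Type u} [AddCommGroup R] (x y z : R), x - y + (y - z) = x - z := by
      intros; abel
    rw [e] at h3
    exact h3
  · intro S hS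
    obtain ⟨i, hi⟩ := Multiset.card_pos_iff_exists_mem.1 hS
    exact Or.inl ⟨i, mem_basePart.1 hi⟩
  · rintro S ⟨-, hS⟩
    obtain ⟨i, hi⟩ := Multiset.card_pos_iff_exists_mem.1 hS
    exact Or.inr ⟨i, mem_fiberPart.1 (mem_basePart.1 hi)⟩

variable {B}

theorem linearMap_eq {M : Type*} [AddCommGroup M] [Module k M] {f g : W × W × W →ₗ[k] M}
    (h1 : ∀ i, f (B.b i, 0, 0) = g (B.b i, 0, 0)) (h2 : ∀ i, f (0, B.b i, 0) = g (0, B.b i, 0))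
    (h3 : ∀ i, f (0, 0, B.b i) = g (0, 0, B.b i)) (w : W × W × W) : f w = g w := by
  have : f = g := LinearMap.prod_ext (B.b.ext h1) (LinearMap.prod_ext (B.b.ext h2) (B.b.ext h3))
  rw [this]

section Derivations

variable (d : Differential 𝒲)

variable [CharZero k]

/-- The differential of the cylinder: `r ↦ r d₀`, `s ↦ r - s d₀`, and `v ↦ d` on `ΛW`, where `d₀` is
the linear part of `d`. -/
def diff : (cylBasis B hpos).OddDerivation :=
  (cylBasis B hpos).oddDerivation
    (Sum.elim (fun i => ι (cyl 𝒲) (B.linearDiff d (B.b i), 0, 0))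
      (Sum.elim (fun i => ι (cyl 𝒲) (B.b i, -B.linearDiff d (B.b i), 0))
        fun i => inclV 𝒲 (d.toLin (B.x i)))) <| by
    refine isOddFamily_of_degree (fun a => (cylBasis B hpos).deg a + 1) ?_ (by simp)
    rintro (i | i | i)
    · exact ι_mem_degree ⟨linearDiff_mem d i, zero_mem _, zero_mem _⟩
    · refine ι_mem_degree ⟨?_, neg_mem ?_, zero_mem _⟩
      · change B.b i ∈ 𝒲 (B.deg i - 1 + 1)
        rw [Nat.sub_add_cancel (hpos i)]
        exact B.mem i
      · change B.linearDiff d (B.b i) ∈ 𝒲 (B.deg i - 1 + 1 + 1)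
        rw [Nat.sub_add_cancel (hpos i)]
        exact linearDiff_mem d i
    · refine B.mem_degree_of_letters (cylBasis B hpos) (inclV 𝒲) (inclV_x_mem_degree B hpos) ?_
      have := d.degree_succ _ _ (B.listProd_mem_degree [i])
      simpa using this

theorem diff_x (a : I ⊕ (I ⊕ I)) : (diff hpos d).toLin ((cylBasis B hpos).x a) =
    Sum.elim (fun i => ι (cyl 𝒲) (B.linearDiff d (B.b i), 0, 0))
      (Sum.elim (fun i => ι (cyl 𝒲) (B.b i, -B.linearDiff d (B.b i), 0))
        fun i => inclV 𝒲 (d.toLin (B.x i))) a :=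
  (cylBasis B hpos).oddDerivation_x _ _ a

theorem diff_ι (w : W × W × W) : (diff hpos d).toLin (ι (cyl 𝒲) w) =
    ι (cyl 𝒲) (B.linearDiff d w.1 + w.2.1, -B.linearDiff d w.2.1, 0) +
      inclV 𝒲 (d.toLin (ι 𝒲 w.2.2)) := by
  let L := B.linearDiff d
  refine linearMap_eq (B := B) (f := (diff hpos d).toLin ∘ₗ ι (cyl 𝒲))
    (g := ι (cyl 𝒲) ∘ₗ (((L ∘ₗ LinearMap.fst k W (W × W)) +
      LinearMap.fst k W W ∘ₗ LinearMap.snd k W (W × W)).prod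
      ((-L ∘ₗ LinearMap.fst k W W ∘ₗ LinearMap.snd k W (W × W)).prod 0)) +
      (inclV 𝒲).toLinearMap ∘ₗ d.toLin ∘ₗ ι 𝒲 ∘ₗ LinearMap.snd k W W ∘ₗ LinearMap.snd k W (W × W))
    (fun i => ?_) (fun i => ?_) (fun i => ?_) w
  · refine Eq.trans ?_ ((diff_x hpos d (Sum.inl i)).trans ?_)
    · rw [x_r]; rfl
    · simp [L]
  · refine Eq.trans ?_ ((diff_x hpos d (Sum.inr (Sum.inl i))).trans ?_)
    · rw [x_s]; rfl
    · simp [L]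
  · refine Eq.trans ?_ ((diff_x hpos d (Sum.inr (Sum.inr i))).trans ?_)
    · rw [x_v]; rfl
    · simp [L]
      exact ((congrArg (· + _) (map_zero _)).trans (zero_add _)).symm

theorem diff_inclV (a : FreeCGA 𝒲) :
    (diff hpos d).toLin (inclV 𝒲 a) = inclV 𝒲 (d.toLin a) := by
  refine (B.ofDifferential d).comm_of_letters (diff hpos d) (inclV 𝒲) (inclV_x_mem_degree B hpos)
    (fun i => ?_) a
  change (diff hpos d).toLin (inclV 𝒲 (ι 𝒲 (B.b i))) = _
  rw [inclV_ι, diff_ι, map_zero, add_zero, neg_zero]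
  exact (congrArg (· + _) (map_zero _)).trans (zero_add _)

theorem diff_diff (h𝒲 : DirectSum.IsInternal 𝒲) (a : FreeCGA (cyl 𝒲)) :
    (diff hpos d).toLin ((diff hpos d).toLin a) = 0 := by
  have h0 : (cylBasis B hpos).IsSkewDerivation (AlgHom.id k _) 0 :=
    ⟨fun i => ⟨1, by simp⟩, fun a b => by simp⟩
  refine (diff hpos d).isSkewDerivation_sq.ext h0 ?_ a
  intro c
  change (diff hpos d).toLin ((diff hpos d).toLin (ι (cyl 𝒲) _)) = 0
  rw [diff_ι, map_add, diff_ι, diff_inclV, d.sq_zero]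
  simp only [map_add, map_neg, linearDiff_linearDiff h𝒲, zero_add, neg_zero, map_zero, add_zero,
    add_neg_cancel]
  exact map_zero _

end Derivations

end Cylinder

/-! #### The degree-lowering derivations and the field `theta` -/

namespace Cylinder

variable {k : Type u} [Field k] {W : Type u} [AddCommGroup W] [Module k W]
  {𝒲 : ℕ → Submodule k W} {I : Type u} {B : GradedBasis 𝒲 I} (hpos : ∀ i, 0 < B.deg i)

/-- The parities of a letter and of its suspension differ, so `v i ↦ s i` and `r i ↦ s i` are values
of odd derivations. -/
theorem even_pred_add {n : ℕ} (h : 0 < n) : Even (n - 1 + (n + 1)) := by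
  rw [show n - 1 + (n + 1) = n + n by omega]
  exact Even.add_self n

theorem x_s_mem_degree (i : I) :
    (cylBasis B hpos).x (Sum.inr (Sum.inl i)) ∈ degree (cyl 𝒲) (B.deg i - 1) := by
  rw [(cylBasis B hpos).degree_eq]
  exact (cylBasis B hpos).x_mem_supported (by simp [suspBasis])

theorem projV_x_mem_degree (a : I ⊕ (I ⊕ I)) :
    projV 𝒲 ((cylBasis B hpos).x a) ∈ degree 𝒲 ((cylBasis B hpos).deg a) := by
  rcases a with i | i | i
  · rw [x_r, projV_ι, map_zero]; exact zero_mem _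
  · rw [x_s, projV_ι, map_zero]; exact zero_mem _
  · rw [x_v, projV_ι]; exact ι_mem_degree (B.mem i)

/-- The derivation `v i ↦ s i`. -/
def suspV : (cylBasis B hpos).OddDerivation :=
  (cylBasis B hpos).oddDerivation
    (Sum.elim (fun _ => 0) (Sum.elim (fun _ => 0) fun i =>
      (cylBasis B hpos).x (Sum.inr (Sum.inl i)))) <| by
    refine isOddFamily_of_degree (Sum.elim (fun i => B.deg i + 1)
      (Sum.elim (fun i => B.deg i - 1 + 1) fun i => B.deg i - 1)) ?_ ?_
    · rintro (i | i | i)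
      · exact zero_mem _
      · exact zero_mem _
      · exact x_s_mem_degree hpos i
    · rintro (i | i | i)
      · exact Even.add_self _
      · exact Even.add_self _
      · exact even_pred_add (hpos i)

/-- The derivation `r i ↦ s i`. -/
def suspR : (cylBasis B hpos).OddDerivation :=
  (cylBasis B hpos).oddDerivation
    (Sum.elim (fun i => (cylBasis B hpos).x (Sum.inr (Sum.inl i))) fun _ => 0) <| by
    refine isOddFamily_of_degree (Sum.elim (fun i => B.deg i - 1)
      fun a => (svBasis B hpos).deg a + 1) ?_ ?_
    · rintro (i | i)
      · exact x_s_mem_degree hpos i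
      · exact zero_mem _
    · rintro (i | i)
      · exact even_pred_add (hpos i)
      · exact Even.add_self _

theorem suspV_x (a : I ⊕ (I ⊕ I)) : (suspV hpos).toLin ((cylBasis B hpos).x a) =
    Sum.elim (fun _ => 0) (Sum.elim (fun _ => 0) fun i =>
      (cylBasis B hpos).x (Sum.inr (Sum.inl i))) a :=
  (cylBasis B hpos).oddDerivation_x _ _ a

theorem suspR_x (a : I ⊕ (I ⊕ I)) : (suspR hpos).toLin ((cylBasis B hpos).x a) =
    Sum.elim (fun i => (cylBasis B hpos).x (Sum.inr (Sum.inl i))) (fun _ => 0) a :=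
  (cylBasis B hpos).oddDerivation_x _ _ a

theorem suspV_ι (w : W × W × W) :
    (suspV hpos).toLin (ι (cyl 𝒲) w) = ι (cyl 𝒲) (0, w.2.2, 0) := by
  refine linearMap_eq (B := B) (f := (suspV hpos).toLin ∘ₗ ι (cyl 𝒲))
    (g := ι (cyl 𝒲) ∘ₗ LinearMap.inr k W (W × W) ∘ₗ LinearMap.inl k W W ∘ₗ
      LinearMap.snd k W W ∘ₗ LinearMap.snd k W (W × W))
    (fun i => ?_) (fun i => ?_) (fun i => ?_) w
  · refine Eq.trans ?_ ((suspV_x hpos (Sum.inl i)).trans ?_)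
    · rw [x_r]; rfl
    · exact (map_zero (ι (cyl 𝒲))).symm
  · refine Eq.trans ?_ ((suspV_x hpos (Sum.inr (Sum.inl i))).trans ?_)
    · rw [x_s]; rfl
    · exact (map_zero (ι (cyl 𝒲))).symm
  · refine Eq.trans ?_ ((suspV_x hpos (Sum.inr (Sum.inr i))).trans ?_)
    · rw [x_v]; rfl
    · exact x_s B hpos i

theorem suspR_ι (w : W × W × W) :
    (suspR hpos).toLin (ι (cyl 𝒲) w) = ι (cyl 𝒲) (0, w.1, 0) := by
  refine linearMap_eq (B := B) (f := (suspR hpos).toLin ∘ₗ ι (cyl 𝒲))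
    (g := ι (cyl 𝒲) ∘ₗ LinearMap.inr k W (W × W) ∘ₗ LinearMap.inl k W W ∘ₗ
      LinearMap.fst k W (W × W))
    (fun i => ?_) (fun i => ?_) (fun i => ?_) w
  · refine Eq.trans ?_ ((suspR_x hpos (Sum.inl i)).trans ?_)
    · rw [x_r]; rfl
    · exact x_s B hpos i
  · refine Eq.trans ?_ ((suspR_x hpos (Sum.inr (Sum.inl i))).trans ?_)
    · rw [x_s]; rfl
    · exact (map_zero (ι (cyl 𝒲))).symm
  · refine Eq.trans ?_ ((suspR_x hpos (Sum.inr (Sum.inr i))).trans ?_)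
    · rw [x_v]; rfl
    · exact (map_zero (ι (cyl 𝒲))).symm

theorem suspR_inclV (a : FreeCGA 𝒲) : (suspR hpos).toLin (inclV 𝒲 a) = 0 := by
  let z : B.OddDerivation := ⟨0, by simp, by simp⟩
  refine (z.comm_of_letters (suspR hpos) (inclV 𝒲) (inclV_x_mem_degree B hpos)
    (fun i => ?_) a).trans (map_zero _)
  rw [inclV_x B hpos, suspR_x]
  exact (map_zero _).symm

theorem projV_suspV (a : FreeCGA (cyl 𝒲)) : projV 𝒲 ((suspV hpos).toLin a) = 0 := by
  let z : B.OddDerivation := ⟨0, by simp, by simp⟩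
  refine ((suspV hpos).comm_of_letters z (projV 𝒲) (projV_x_mem_degree hpos)
    (fun i => ?_) a).symm
  change 0 = projV 𝒲 ((suspV hpos).toLin (ι (cyl 𝒲) _))
  rw [suspV_ι, projV_ι, map_zero]

variable [CharZero k] (d : Differential 𝒲)

theorem projV_diff (a : FreeCGA (cyl 𝒲)) :
    projV 𝒲 ((diff hpos d).toLin a) = d.toLin (projV 𝒲 a) := by
  refine ((diff hpos d).comm_of_letters (B.ofDifferential d) (projV 𝒲) (projV_x_mem_degree hpos)
    (fun i => ?_) a).symm
  change d.toLin (projV 𝒲 (ι (cyl 𝒲) _)) = projV 𝒲 ((diff hpos d).toLin (ι (cyl 𝒲) _))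
  rw [diff_ι, projV_ι, map_add, projV_ι, projV_inclV B, map_zero, zero_add]

/-- The commutator of the differential with the contraction `r i ↦ s i` counts the letters `r i`
and `s i`. -/
theorem euler_x (a : I ⊕ (I ⊕ I)) :
    (diff hpos d).toLin ((suspR hpos).toLin ((cylBasis B hpos).x a)) +
      (suspR hpos).toLin ((diff hpos d).toLin ((cylBasis B hpos).x a)) =
    ((Sum.elim (fun _ => 1) (Sum.elim (fun _ => 1) fun _ => 0) a : ℕ) : k) •
      (cylBasis B hpos).x a := by
  have key : ∀ w : W × W × W, (diff hpos d).toLin ((suspR hpos).toLin (ι (cyl 𝒲) w)) +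
      (suspR hpos).toLin ((diff hpos d).toLin (ι (cyl 𝒲) w)) = ι (cyl 𝒲) (w.1, w.2.1, 0) := by
    intro w
    rw [suspR_ι, diff_ι, diff_ι, map_add, suspR_inclV, suspR_ι]
    simp only [map_zero, add_zero, zero_add]
    rw [← map_add]
    congr 1
    simp
  rcases a with i | i | i
  · rw [x_r, key]; simp
  · rw [x_s, key]; simp
  · rw [x_v, key]; simp
    exact map_zero _

/-- The derivation `[d, sV]` of degree `0`, whose exponential deforms the inclusion of `ΛW`. -/
def theta : FreeCGA (cyl 𝒲) →ₗ[k] FreeCGA (cyl 𝒲) :=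
  (diff hpos d).toLin ∘ₗ (suspV hpos).toLin + (suspV hpos).toLin ∘ₗ (diff hpos d).toLin

theorem theta_apply (a : FreeCGA (cyl 𝒲)) : theta hpos d a =
    (diff hpos d).toLin ((suspV hpos).toLin a) + (suspV hpos).toLin ((diff hpos d).toLin a) := rfl

theorem isSkewDerivation_theta :
    (cylBasis B hpos).IsSkewDerivation (AlgHom.id k _) (theta hpos d) :=
  (diff hpos d).isSkewDerivation_comm (suspV hpos)

theorem projV_theta (a : FreeCGA (cyl 𝒲)) : projV 𝒲 (theta hpos d a) = 0 := by
  rw [theta_apply, map_add, projV_diff, projV_suspV, projV_suspV, map_zero, add_zero]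

theorem diff_theta (h𝒲 : DirectSum.IsInternal 𝒲) (a : FreeCGA (cyl 𝒲)) :
    (diff hpos d).toLin (theta hpos d a) = theta hpos d ((diff hpos d).toLin a) := by
  rw [theta_apply, theta_apply, map_add, diff_diff hpos d h𝒲, diff_diff hpos d h𝒲, map_zero,
    zero_add, add_zero]

theorem theta_ι (w : W × W × W) : theta hpos d (ι (cyl 𝒲) w) =
    ι (cyl 𝒲) (w.2.2, -B.linearDiff d w.2.2, 0) +
      (suspV hpos).toLin (inclV 𝒲 (d.toLin (ι 𝒲 w.2.2))) := by
  rw [theta_apply, suspV_ι, diff_ι, diff_ι, map_add, suspV_ι]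
  simp only [map_zero, zero_add, add_zero]
  congr 1
  exact (congrArg (· + _) (map_zero _)).trans (zero_add _)

theorem theta_r (i : I) : theta hpos d ((cylBasis B hpos).x (Sum.inl i)) = 0 := by
  rw [x_r, theta_ι]
  simp only [map_zero, neg_zero, add_zero]
  exact map_zero _

theorem theta_s (i : I) : theta hpos d ((cylBasis B hpos).x (Sum.inr (Sum.inl i))) = 0 := by
  rw [x_s, theta_ι]
  simp only [map_zero, neg_zero, add_zero]
  exact map_zero _

/-! #### Triangularity with respect to the levels of the letters -/

/-- The letters `r i` and `v i`. -/
def IsRV : I ⊕ (I ⊕ I) → Prop := Sum.elim (fun _ => True) (Sum.elim (fun _ => False) fun _ => True)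

/-- The level of a letter. -/
def level (lev : I → ℕ) : I ⊕ (I ⊕ I) → ℕ := Sum.elim lev (Sum.elim lev lev)

/-- A monomial of the degree of `x i` in letters of levels below that of `x i`, one of which is
an `r` or a `v`. -/
def Low (lev : I → ℕ) (i : I) (S : Multiset (I ⊕ (I ⊕ I))) : Prop :=
  (∀ a ∈ S, level lev a < lev i) ∧ (∃ a ∈ S, IsRV a) ∧
    (S.map (cylBasis B hpos).deg).sum = B.deg i

variable {lev : I → ℕ}

theorem eq_map_of_basePart_eq_zero {I J : Type*} {S : Multiset (I ⊕ J)} (h : basePart S = 0) :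
    S = (fiberPart S).map Sum.inr := by
  conv_lhs => rw [← map_basePart_add S, h, Multiset.map_zero, zero_add]

/-- The linear part of the differential of a letter, moved to the letters `s j`, lowers the
level. -/
theorem linearDiff_low {i : I}
    (hlev : d.toLin (B.x i) ∈ B.supported fun S => ∀ j ∈ S, lev j < lev i) :
    ι (cyl 𝒲) (0, B.linearDiff d (B.b i), 0) ∈ (cylBasis B hpos).supported fun S =>
      ∀ a ∈ S, ∃ j, a = Sum.inr (Sum.inl j) ∧ lev j < lev i := by
  have h := linearPart_mem hlev
  suffices h1 : Submodule.span k (B.b '' {j | ∀ j' ∈ ({j} : Multiset I), lev j' < lev i}) ≤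
      Submodule.comap (ι (cyl 𝒲) ∘ₗ LinearMap.inr k W (W × W) ∘ₗ LinearMap.inl k W W)
        ((cylBasis B hpos).supported fun S =>
          ∀ a ∈ S, ∃ j, a = Sum.inr (Sum.inl j) ∧ lev j < lev i) from h1 h
  refine Submodule.span_le.2 ?_
  rintro _ ⟨j, hj, rfl⟩
  have h2 : (cylBasis B hpos).x (Sum.inr (Sum.inl j)) ∈ (cylBasis B hpos).supported fun S =>
      ∀ a ∈ S, ∃ j, a = Sum.inr (Sum.inl j) ∧ lev j < lev i :=
    (cylBasis B hpos).x_mem_supported fun a ha => ⟨j, Multiset.mem_singleton.1 ha,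
      hj j (Multiset.mem_singleton_self j)⟩
  rw [x_s] at h2
  exact h2

/-- The value of `theta` at `v i` is `r i`, up to terms in letters of lower level. The linear part
of the differential of `v i` contributes terms in the letters `s j` only, which cancel. -/
theorem theta_v_sub_mem (i : I)
    (hlev : d.toLin (B.x i) ∈ B.supported fun S => ∀ j ∈ S, lev j < lev i) :
    theta hpos d ((cylBasis B hpos).x (Sum.inr (Sum.inr i))) - (cylBasis B hpos).x (Sum.inl i) ∈
      (cylBasis B hpos).supported (Low hpos lev i) := by
  have h1 := inclV_mem hpos (sub_linearPart_mem
    (B.mem_supported_and (differential_x_mem (B := B) d i) hlev))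
  have e : theta hpos d ((cylBasis B hpos).x (Sum.inr (Sum.inr i))) -
      (cylBasis B hpos).x (Sum.inl i) =
      (suspV hpos).toLin (inclV 𝒲 (d.toLin (B.x i) - ι 𝒲 (B.linearPart (d.toLin (B.x i))))) := by
    have e1 : ι (cyl 𝒲) (B.b i, -B.linearDiff d (B.b i), 0) = ι (cyl 𝒲) (B.b i, 0, 0) -
        ι (cyl 𝒲) (0, B.linearDiff d (B.b i), 0) := by
      rw [← map_sub]; congr 1; simp
    have e2 : ∀ {R : Type u} [AddCommGroup R] (x y z : R), x - y + z - x = z - y := by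
      intros; abel
    rw [x_v, x_r, theta_ι, map_sub, map_sub, inclV_ι, suspV_ι, e1, e2]
    rfl
  rw [e]
  refine (suspV hpos).isSkewDerivation.map_mem (ρ := fun a T => ∃ j, a = Sum.inr (Sum.inr j) ∧
    T = {Sum.inr (Sum.inl j)}) ?_ ?_ h1
  · rintro (j | j | j)
    · rw [suspV_x]; exact zero_mem _
    · rw [suspV_x]; exact zero_mem _
    · rw [suspV_x]
      exact (cylBasis B hpos).x_mem_supported ⟨j, rfl, rfl⟩
  · rintro _ _ ⟨_, S₀, _, rfl, rfl, j, rfl, rfl⟩ ⟨h1, h2, ⟨⟨hdeg, -⟩, hl⟩, hc⟩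
    simp only [basePart_cons_inr, fiberPart_cons_inr] at h1 h2 hdeg hl hc
    have e1 := eq_map_of_basePart_eq_zero h1
    have e2 := eq_map_of_basePart_eq_zero h2
    rw [e2] at e1
    generalize fiberPart (fiberPart S₀) = U at *
    subst e1
    simp only [Multiset.map_cons, Multiset.sum_cons, Multiset.mem_cons, Multiset.card_cons,
      forall_eq_or_imp] at hdeg hl hc
    refine ⟨?_, ?_, ?_⟩
    · intro a ha
      simp only [Multiset.singleton_add, Multiset.mem_cons, Multiset.mem_map,
        exists_exists_and_eq_and] at ha
      rcases ha with rfl | ⟨j', hj', rfl⟩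
      · exact hl.1
      · exact hl.2 j' hj'
    · obtain ⟨j', hj'⟩ := Multiset.card_pos_iff_exists_mem.1
        (Nat.pos_of_ne_zero fun h => hc (by rw [h]))
      refine ⟨Sum.inr (Sum.inr j'), ?_, trivial⟩
      simp [hj']
    · have := hpos j
      simp [suspBasis, Function.comp_def]
      omega

end Cylinder

/-! #### The deformed inclusion and the contraction -/

namespace Cylinder

variable {k : Type u} [Field k] {W : Type u} [AddCommGroup W] [Module k W]
  {𝒲 : ℕ → Submodule k W} {I : Type u} {B : GradedBasis 𝒲 I} (hpos : ∀ i, 0 < B.deg i)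
  {d : Differential 𝒲} {lev : I → ℕ}

/-- Rewriting a letter in a monomial of lower level yields a monomial of lower level, if the
rewriting raises no level, keeps the degree, and introduces a letter `r` or `v`. -/
theorem Low.of_step {ρ : I ⊕ (I ⊕ I) → Multiset (I ⊕ (I ⊕ I)) → Prop}
    (hρ : ∀ a T, ρ a T → (∀ c ∈ T, level lev c ≤ level lev a) ∧ (∃ c ∈ T, IsRV c) ∧
      (T.map (cylBasis B hpos).deg).sum = (cylBasis B hpos).deg a) {i : I}
    (S' S : Multiset (I ⊕ (I ⊕ I))) (h : Step ρ S' S) (hS : Low hpos lev i S) :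
    Low hpos lev i S' := by
  obtain ⟨a, S₀, T, rfl, rfl, hT⟩ := h
  obtain ⟨h1, ⟨c, hc, hc'⟩, h3⟩ := hρ a T hT
  obtain ⟨h4, -, h5⟩ := hS
  refine ⟨fun b hb => ?_, ⟨c, Multiset.mem_add.2 (Or.inl hc), hc'⟩, ?_⟩
  · rcases Multiset.mem_add.1 hb with hb | hb
    · exact (h1 b hb).trans_lt (h4 a (Multiset.mem_cons_self a S₀))
    · exact h4 b (Multiset.mem_cons_of_mem hb)
  · rw [Multiset.map_add, Multiset.sum_add, h3, ← h5, Multiset.map_cons, Multiset.sum_cons]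

theorem Low.of_letter {i : I} {T : Multiset (I ⊕ (I ⊕ I))} {a c : I ⊕ (I ⊕ I)}
    (ha : a = Sum.inl i ∨ a = Sum.inr (Sum.inr i)) (hc : c = Sum.inl i ∨ c = Sum.inr (Sum.inr i))
    (hT : T = {c} ∨ Low hpos lev i T) : (∀ c ∈ T, level lev c ≤ level lev a) ∧ (∃ c ∈ T, IsRV c) ∧
      (T.map (cylBasis B hpos).deg).sum = (cylBasis B hpos).deg a := by
  have h1 : level lev a = lev i := by rcases ha with rfl | rfl <;> rfl
  have h2 : (cylBasis B hpos).deg a = B.deg i := by rcases ha with rfl | rfl <;> rfl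
  rcases hT with rfl | hT
  · refine ⟨fun b hb => ?_, ⟨c, Multiset.mem_singleton_self c, ?_⟩, ?_⟩
    · rw [Multiset.mem_singleton.1 hb, h1]
      rcases hc with rfl | rfl <;> exact le_rfl
    · rcases hc with rfl | rfl <;> trivial
    · rw [h2]
      rcases hc with rfl | rfl <;> simp
  · exact ⟨fun b hb => h1 ▸ (hT.1 b hb).le, hT.2.1, hT.2.2.trans h2.symm⟩

theorem wellFounded_step {ρ : I ⊕ (I ⊕ I) → Multiset (I ⊕ (I ⊕ I)) → Prop}
    (κ : I ⊕ (I ⊕ I) → ℕ) (hρ : ∀ a T, ρ a T → ∀ c ∈ T, κ c < κ a) :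
    WellFounded (Relation.TransGen (Step ρ)) :=
  Step.wellFounded (r := fun a b => κ a < κ b) (InvImage.wf κ wellFounded_lt) hρ

theorem Low.lt {i : I} {T : Multiset (I ⊕ (I ⊕ I))} (h : Low hpos lev i T)
    {κ : I ⊕ (I ⊕ I) → ℕ} (hκ : ∀ a, κ a ≤ 2 * level lev a + 1) {c : I ⊕ (I ⊕ I)} (hc : c ∈ T) :
    κ c < 2 * lev i + 1 := by
  have h1 := h.1 c hc
  have h2 := hκ c
  omega

variable [CharZero k]

/-- The deformed inclusion `exp(theta) ∘ inclV` of `ΛW` in the cylinder. -/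
theorem exists_deformation (h𝒲 : DirectSum.IsInternal 𝒲)
    (hlev : ∀ i, d.toLin (B.x i) ∈ B.supported fun S => ∀ j ∈ S, lev j < lev i) :
    ∃ u : FreeCGA 𝒲 →ₐ[k] FreeCGA (cyl 𝒲),
      (∀ a, (diff hpos d).toLin (u a) = u (d.toLin a)) ∧ (∀ a, projV 𝒲 (u a) = a) ∧
      ∀ i, u (B.x i) - (cylBasis B hpos).x (Sum.inl i) - (cylBasis B hpos).x (Sum.inr (Sum.inr i)) ∈
        (cylBasis B hpos).supported (Low hpos lev i) := by
  let ρ : I ⊕ (I ⊕ I) → Multiset (I ⊕ (I ⊕ I)) → Prop := fun a T =>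
    ∃ i, a = Sum.inr (Sum.inr i) ∧ (T = {Sum.inl i} ∨ Low hpos lev i T)
  let κ : I ⊕ (I ⊕ I) → ℕ := Sum.elim (fun i => 2 * lev i)
    (Sum.elim (fun i => 2 * lev i) fun i => 2 * lev i + 1)
  have hκ : ∀ a, κ a ≤ 2 * level lev a + 1 := by
    rintro (i | i | i) <;> simp [κ, level]
  have hmem : ∀ a, theta hpos d ((cylBasis B hpos).x a) ∈ (cylBasis B hpos).supported (ρ a) := by
    rintro (i | i | i)
    · rw [theta_r]; exact zero_mem _
    · rw [theta_s]; exact zero_mem _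
    · have h1 := supported_mono (q := ρ (Sum.inr (Sum.inr i))) (fun S hS => ⟨i, rfl, Or.inr hS⟩)
        (theta_v_sub_mem hpos d i (hlev i))
      have h2 : (cylBasis B hpos).x (Sum.inl i) ∈
          (cylBasis B hpos).supported (ρ (Sum.inr (Sum.inr i))) :=
        (cylBasis B hpos).x_mem_supported ⟨i, rfl, Or.inl rfl⟩
      have h3 := add_mem h1 h2
      rwa [sub_add_cancel] at h3
  have wf : WellFounded (Relation.TransGen (Step ρ)) := by
    refine wellFounded_step κ ?_
    rintro _ T ⟨i, rfl, rfl | hT⟩ c hc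
    · rw [Multiset.mem_singleton.1 hc]
      exact Nat.lt_succ_self _
    · exact hT.lt hpos hκ hc
  have hθ := isSkewDerivation_theta hpos d
  obtain ⟨φ, hφ⟩ := exists_exp (theta hpos d) hθ.2 (hθ.exists_pow_eq_zero hmem wf)
  have hlow : ∀ i, ∀ a ∈ (cylBasis B hpos).supported (Low hpos lev i),
      theta hpos d a ∈ (cylBasis B hpos).supported (Low hpos lev i) := by
    intro i a ha
    refine hθ.map_mem hmem (Low.of_step hpos ?_) ha
    rintro _ T ⟨i, rfl, hT⟩
    exact Low.of_letter hpos (Or.inr rfl) (Or.inl rfl) hT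
  have hcomm : ∀ n a, (diff hpos d).toLin ((theta hpos d ^ n) a) =
      (theta hpos d ^ n) ((diff hpos d).toLin a) := by
    intro n
    induction n with
    | zero => intro a; rfl
    | succ n ih =>
      intro a
      rw [pow_succ, Module.End.mul_apply, Module.End.mul_apply, ih, diff_theta hpos d h𝒲]
  refine ⟨φ.comp (inclV 𝒲), fun a => ?_, fun a => ?_, fun i => ?_⟩
  · rw [AlgHom.comp_apply, AlgHom.comp_apply, ← diff_inclV hpos]
    obtain ⟨N₁, h1⟩ := hφ (inclV 𝒲 a)
    obtain ⟨N₂, h2⟩ := hφ ((diff hpos d).toLin (inclV 𝒲 a))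
    rw [h1 _ (le_max_left N₁ N₂), h2 _ (le_max_right N₁ N₂), map_sum]
    exact Finset.sum_congr rfl fun n _ => by rw [map_smul, hcomm]
  · rw [AlgHom.comp_apply]
    obtain ⟨N, h1⟩ := hφ (inclV 𝒲 a)
    rw [h1 (N + 1) (Nat.le_succ N), Finset.sum_range_succ', map_add, map_sum,
      Finset.sum_eq_zero, zero_add]
    · simp [projV_inclV B]
    · intro n _
      rw [map_smul, pow_succ', Module.End.mul_apply, projV_theta, smul_zero]
  · rw [AlgHom.comp_apply, inclV_x B hpos]
    obtain ⟨N, h1⟩ := hφ ((cylBasis B hpos).x (Sum.inr (Sum.inr i)))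
    have hq := theta_v_sub_mem hpos d i (hlev i)
    have h2 : ∀ n, (theta hpos d ^ n) (theta hpos d (theta hpos d
        ((cylBasis B hpos).x (Sum.inr (Sum.inr i))))) ∈
        (cylBasis B hpos).supported (Low hpos lev i) := by
      intro n
      induction n with
      | zero =>
        have h3 := hlow i _ hq
        rw [map_sub, theta_r, sub_zero] at h3
        exact h3
      | succ n ih =>
        rw [pow_succ', Module.End.mul_apply]
        exact hlow i _ ih
    rw [h1 (N + 2) (Nat.le_add_right N 2), Finset.sum_range_succ', Finset.sum_range_succ']
    have e : ∀ {R : Type u} [AddCommGroup R] (x y z t : R), x + y + z - t - z = x + (y - t) := by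
      intros; abel
    simp only [zero_add, Nat.factorial_zero, Nat.factorial_one, Nat.cast_one, inv_one, one_smul,
      pow_zero, pow_one, Module.End.one_apply]
    rw [e]
    refine add_mem (Submodule.sum_mem _ fun n _ => Submodule.smul_mem _ _ ?_) hq
    have := h2 n
    rwa [← Module.End.mul_apply, ← Module.End.mul_apply, ← pow_succ, ← pow_succ] at this

/-- The kernel of the projection to `ΛW` which kills the letters `r i` and `s i` is contractible,
together with its filtration by the number of letters `v i`. -/
theorem exists_eq_diff (h𝒲 : DirectSum.IsInternal 𝒲) {q : ℕ} {x : FreeCGA (cyl 𝒲)}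
    (hx : x ∈ (cylBasis B hpos).supported fun S => q ≤ (fiberPart (fiberPart S)).card)
    (hdx : (diff hpos d).toLin x = 0) {y : FreeCGA 𝒲} (hy : y ∈ wordGE 𝒲 q)
    (hxy : projV 𝒲 x = d.toLin y) :
    ∃ t ∈ (cylBasis B hpos).supported fun S => q ≤ (fiberPart (fiberPart S)).card,
      x = (diff hpos d).toLin t := by
  let w : I ⊕ (I ⊕ I) → ℕ := Sum.elim (fun _ => 1) (Sum.elim (fun _ => 1) fun _ => 0)
  let p : Multiset (I ⊕ (I ⊕ I)) → Prop := fun S =>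
    1 ≤ (S.map w).sum ∧ q ≤ (fiberPart (fiberPart S)).card
  let L : FreeCGA (cyl 𝒲) →ₗ[k] FreeCGA (cyl 𝒲) := (diff hpos d).toLin ∘ₗ (suspR hpos).toLin +
    (suspR hpos).toLin ∘ₗ (diff hpos d).toLin
  have hL : ∀ l : List (I ⊕ (I ⊕ I)), L ((cylBasis B hpos).listProd l) -
      ((((l : Multiset (I ⊕ (I ⊕ I))).map w).sum : ℕ) : k) • (cylBasis B hpos).listProd l ∈
      (cylBasis B hpos).supported fun _ => False := by
    intro l
    refine supported_mono ?_ (((diff hpos d).isSkewDerivation_comm (suspR hpos)).sub_weight_mem w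
      (ρ := fun _ _ => False) (fun a => ?_) l)
    · rintro S ⟨_, _, _, _, _, h⟩
      exact h
    · have h1 := euler_x hpos d a
      have h2 : ((diff hpos d).toLin ∘ₗ (suspR hpos).toLin + (suspR hpos).toLin ∘ₗ
        (diff hpos d).toLin) ((cylBasis B hpos).x a) = (w a : k) • (cylBasis B hpos).x a := h1
      rw [h2, sub_self]
      exact zero_mem _
  have hc : ∀ S, p S → ((((S : Multiset (I ⊕ (I ⊕ I))).map w).sum : ℕ) : k) ≠ 0 := fun S hS =>
    Nat.cast_ne_zero.2 (Nat.one_le_iff_ne_zero.1 hS.1)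
  have wf : WellFounded fun _ _ : Multiset (I ⊕ (I ⊕ I)) => False :=
    ⟨fun _ => ⟨_, fun _ h => h.elim⟩⟩
  have hinclV : ∀ a ∈ wordGE 𝒲 q, inclV 𝒲 a ∈
      (cylBasis B hpos).supported fun S => q ≤ (fiberPart (fiberPart S)).card := by
    intro a ha
    rw [B.mem_wordGE_iff] at ha
    exact supported_mono (fun S hS => hS.2.2) (inclV_mem hpos ha)
  -- The part of `x` in the kernel of `projV` has a letter `r i` or `s i`, so that `L`, which counts
  -- these letters, is invertible on it.
  have hX : x - inclV 𝒲 (projV 𝒲 x) ∈ (cylBasis B hpos).supported p := by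
    refine (cylBasis B hpos).mem_supported_and ?_ (sub_mem hx (hinclV _ ?_))
    · refine supported_mono ?_ (sub_inclV_projV_mem B hpos x)
      rintro S (⟨i, hi⟩ | ⟨i, hi⟩)
      · have h : 1 ∈ S.map w := Multiset.mem_map.2 ⟨Sum.inl i, hi, rfl⟩
        exact Multiset.le_sum_of_mem h
      · have h : 1 ∈ S.map w := Multiset.mem_map.2 ⟨Sum.inr (Sum.inl i), hi, rfl⟩
        exact Multiset.le_sum_of_mem h
    · rw [B.mem_wordGE_iff]
      exact projV_mem (p := fun S => q ≤ S.card) hx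
  have hdX : (diff hpos d).toLin (x - inclV 𝒲 (projV 𝒲 x)) = 0 := by
    rw [map_sub, hdx, diff_inclV, hxy, d.sq_zero, map_zero, sub_zero]
  obtain ⟨X, hX', e⟩ := triangular_surjective (T := L) wf (fun _ _ _ h => h.elim) hc
    (fun l _ => hL l) hX
  have hDX : (diff hpos d).toLin X ∈ (cylBasis B hpos).supported p := by
    have hw : ∀ S T : Multiset (I ⊕ (I ⊕ I)),
        ((S + T).map w).sum = (S.map w).sum + (T.map w).sum := by simp
    have hv : ∀ S T : Multiset (I ⊕ (I ⊕ I)), (fiberPart (fiberPart (S + T))).card =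
      (fiberPart (fiberPart S)).card + (fiberPart (fiberPart T)).card := by simp
    refine (diff hpos d).isSkewDerivation.map_mem (ρ := fun a T =>
      (({a} : Multiset (I ⊕ (I ⊕ I))).map w).sum ≤ (T.map w).sum ∧
      (fiberPart (fiberPart {a})).card ≤ (fiberPart (fiberPart T)).card) ?_ ?_ hX'
    · have hf : ∀ c : I ⊕ I, fiberPart ({Sum.inr c} : Multiset (I ⊕ (I ⊕ I))) = {c} := fun c => by
        rw [← Multiset.cons_zero, fiberPart_cons_inr]; rfl
      have hr : ∀ j, fiberPart ({Sum.inl j} : Multiset (I ⊕ (I ⊕ I))) = 0 := fun j => by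
        rw [← Multiset.cons_zero, fiberPart_cons_inl]; rfl
      have hf' : ∀ c : I, fiberPart ({Sum.inr c} : Multiset (I ⊕ I)) = {c} := fun c => by
        rw [← Multiset.cons_zero, fiberPart_cons_inr]; rfl
      have hr' : ∀ j, fiberPart ({Sum.inl j} : Multiset (I ⊕ I)) = 0 := fun j => by
        rw [← Multiset.cons_zero, fiberPart_cons_inl]; rfl
      rintro (i | i | i)
      · rw [diff_x]
        refine (cylBasis B hpos).ι_mem_supported ?_
        rintro (j | j | j) hj
        · simp [w, hr]
        · simp [GradedBasis.sum] at hj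
        · simp [GradedBasis.sum] at hj
      · rw [diff_x]
        refine (cylBasis B hpos).ι_mem_supported ?_
        rintro (j | j | j) hj
        · simp [w, hr, hr', hf]
        · simp [w, hr', hf]
        · simp [GradedBasis.sum] at hj
      · rw [diff_x]
        refine supported_mono ?_ (inclV_mem hpos (differential_x_mem (B := B) d i))
        rintro S ⟨-, -, -, hS⟩
        simp only [w, hf, hf']
        exact ⟨by simp, hS⟩
    · intro S' S h h'
      have h1 := Step.le (ν := fun S => (S.map w).sum) hw (fun _ _ h => h.1) _ _ h
      have h2 := Step.le (ν := fun S => (fiberPart (fiberPart S)).card) hv (fun _ _ h => h.2) _ _ h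
      exact ⟨h'.1.trans h1, h'.2.trans h2⟩
  have hDX0 : (diff hpos d).toLin X = 0 := by
    refine triangular_injective (T := L) wf (fun _ _ _ h => h.elim) hc (fun l _ => hL l) hDX ?_
    have h1 := congrArg (diff hpos d).toLin e
    rw [hdX] at h1
    have h2 : (diff hpos d).toLin (L X) = L ((diff hpos d).toLin X) := by
      simp only [L, LinearMap.add_apply, LinearMap.comp_apply, map_add, diff_diff hpos d h𝒲,
        map_zero, add_zero, zero_add]
    rw [← h2, h1]
  have e' : x - inclV 𝒲 (projV 𝒲 x) = (diff hpos d).toLin ((suspR hpos).toLin X) := by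
    rw [← e]
    simp only [L, LinearMap.add_apply, LinearMap.comp_apply, hDX0, map_zero, add_zero]
  refine ⟨(suspR hpos).toLin X + inclV 𝒲 y, add_mem ?_ (hinclV y hy), ?_⟩
  · refine (suspR hpos).isSkewDerivation.map_mem (ρ := fun a _ => ∃ i, a = Sum.inl i) ?_ ?_ hX'
    · rintro (i | i)
      · exact supported_mono (fun _ _ => ⟨i, rfl⟩) ((cylBasis B hpos).mem_supported_true _)
      · rw [suspR_x]; exact zero_mem _
    · rintro _ _ ⟨_, S₀, T, rfl, rfl, i, rfl⟩ ⟨-, h⟩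
      rw [fiberPart_cons_inl] at h
      rw [fiberPart_add, fiberPart_add, Multiset.card_add]
      exact h.trans (Nat.le_add_left _ _)
  · rw [map_add, ← e', diff_inclV, ← hxy, sub_add_cancel]

end Cylinder

/-! #### Straightening the cylinder -/

namespace Cylinder

variable {k : Type u} [Field k] {W : Type u} [AddCommGroup W] [Module k W]
  {𝒲 : ℕ → Submodule k W} {I : Type u} {B : GradedBasis 𝒲 I} (hpos : ∀ i, 0 < B.deg i)
  {d : Differential 𝒲} {lev : I → ℕ}

theorem u_x_mem_degree {u : FreeCGA 𝒲 →ₐ[k] FreeCGA (cyl 𝒲)}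
    (hu : ∀ i, u (B.x i) - (cylBasis B hpos).x (Sum.inl i) -
      (cylBasis B hpos).x (Sum.inr (Sum.inr i)) ∈ (cylBasis B hpos).supported (Low hpos lev i))
    (i : I) : u (B.x i) ∈ degree (cyl 𝒲) (B.deg i) := by
  have h1 : u (B.x i) - (cylBasis B hpos).x (Sum.inl i) -
      (cylBasis B hpos).x (Sum.inr (Sum.inr i)) ∈ degree (cyl 𝒲) (B.deg i) := by
    rw [(cylBasis B hpos).degree_eq]
    exact supported_mono (fun S hS => hS.2.2) (hu i)
  have h2 : (cylBasis B hpos).x (Sum.inl i) ∈ degree (cyl 𝒲) (B.deg i) :=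
    ι_mem_degree ((cylBasis B hpos).mem (Sum.inl i))
  have h3 : (cylBasis B hpos).x (Sum.inr (Sum.inr i)) ∈ degree (cyl 𝒲) (B.deg i) :=
    ι_mem_degree ((cylBasis B hpos).mem (Sum.inr (Sum.inr i)))
  have h4 := add_mem (add_mem h1 h3) h2
  rwa [sub_add_cancel, sub_add_cancel] at h4

variable [CharZero k]

theorem diff_x_mem_degree (d : Differential 𝒲) (a : I ⊕ (I ⊕ I)) :
    (diff hpos d).toLin ((cylBasis B hpos).x a) ∈
      degree (cyl 𝒲) ((cylBasis B hpos).deg a + 1) := by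
  rw [diff_x]
  rcases a with i | i | i
  · exact ι_mem_degree ⟨B.linearDiff_mem d i, zero_mem _, zero_mem _⟩
  · have h1 := B.linearDiff_mem d i
    have h2 := B.mem i
    have e : B.deg i - 1 + 1 = B.deg i := Nat.sub_add_cancel (hpos i)
    have h3 : B.b i ∈ 𝒲 (B.deg i - 1 + 1) := by rw [e]; exact h2
    have h4 : B.linearDiff d (B.b i) ∈ 𝒲 (B.deg i - 1 + 1 + 1) := by rw [e]; exact h1
    exact ι_mem_degree ⟨h3, neg_mem h4, zero_mem _⟩
  · exact mem_degree_of_letters B (cylBasis B hpos) (inclV 𝒲) (inclV_x_mem_degree B hpos)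
      (d.degree_succ _ _ (ι_mem_degree (B.mem i)))

/-- The straightening automorphism, which sends the letter `r i` to `u (x i)`. -/
theorem exists_straightening {u : FreeCGA 𝒲 →ₐ[k] FreeCGA (cyl 𝒲)}
    (hu : ∀ i, u (B.x i) - (cylBasis B hpos).x (Sum.inl i) -
      (cylBasis B hpos).x (Sum.inr (Sum.inr i)) ∈ (cylBasis B hpos).supported (Low hpos lev i)) :
    ∃ Φ : FreeCGA (cyl 𝒲) ≃ₐ[k] FreeCGA (cyl 𝒲), (∀ a, Φ (inclBase 𝒲 _ a) = u a) ∧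
      (∀ c, Φ ((cylBasis B hpos).x (Sum.inr c)) = (cylBasis B hpos).x (Sum.inr c)) ∧
      (∀ q : ℕ, ∀ a ∈ (cylBasis B hpos).supported fun S => q ≤ (fiberPart (fiberPart S)).card,
        Φ a ∈ (cylBasis B hpos).supported (fun S => q ≤ (fiberPart (fiberPart S)).card) ∧
        Φ.symm a ∈ (cylBasis B hpos).supported fun S => q ≤ (fiberPart (fiberPart S)).card) ∧
      (∀ n, ∀ a ∈ degree (cyl 𝒲) n, Φ a ∈ degree (cyl 𝒲) n ∧ Φ.symm a ∈ degree (cyl 𝒲) n) ∧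
      ∀ i, ∀ a ∈ (cylBasis B hpos).supported (Low hpos lev i),
        Φ.symm a ∈ (cylBasis B hpos).supported (Low hpos lev i) := by
  let ρ : I ⊕ (I ⊕ I) → Multiset (I ⊕ (I ⊕ I)) → Prop := fun a T =>
    ∃ i, a = Sum.inl i ∧ (T = {Sum.inr (Sum.inr i)} ∨ Low hpos lev i T)
  let κ : I ⊕ (I ⊕ I) → ℕ := Sum.elim (fun i => 2 * lev i + 1)
    (Sum.elim (fun i => 2 * lev i) fun i => 2 * lev i)
  have hκ : ∀ a, κ a ≤ 2 * level lev a + 1 := by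
    rintro (i | i | i) <;> simp [κ, level]
  have wf : WellFounded (Relation.TransGen (Step ρ)) := by
    refine wellFounded_step κ ?_
    rintro _ T ⟨i, rfl, rfl | hT⟩ c hc
    · rw [Multiset.mem_singleton.1 hc]
      exact Nat.lt_succ_self _
    · exact hT.lt hpos hκ hc
  have hρ : ∀ a T, ρ a T → (∀ c ∈ T, level lev c ≤ level lev a) ∧ (∃ c ∈ T, IsRV c) ∧
      (T.map (cylBasis B hpos).deg).sum = (cylBasis B hpos).deg a := by
    rintro _ T ⟨i, rfl, hT⟩
    exact Low.of_letter hpos (Or.inl rfl) (Or.inr rfl) hT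
  let g : I ⊕ (I ⊕ I) → FreeCGA (cyl 𝒲) :=
    Sum.elim (fun i => u (B.x i)) fun c => (cylBasis B hpos).x (Sum.inr c)
  have hg : ∀ a, g a ∈ degree (cyl 𝒲) ((cylBasis B hpos).deg a) := by
    rintro (i | c)
    · exact u_x_mem_degree hpos hu i
    · exact ι_mem_degree ((cylBasis B hpos).mem (Sum.inr c))
  have hx : ∀ a, (cylBasis B hpos).liftDegree (cylBasis B hpos) g hg ((cylBasis B hpos).x a) =
    g a := fun a => lift_x _ _ _ a
  obtain ⟨Φ, hΦ, hmem⟩ := exists_algEquiv (B := cylBasis B hpos) (ρ := ρ)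
    ((cylBasis B hpos).liftDegree (cylBasis B hpos) g hg) (by
      rintro (i | c)
      · rw [hx]
        have h1 := supported_mono (q := ρ (Sum.inl i)) (fun S hS => ⟨i, rfl, Or.inr hS⟩) (hu i)
        have h2 : (cylBasis B hpos).x (Sum.inr (Sum.inr i)) ∈
            (cylBasis B hpos).supported (ρ (Sum.inl i)) :=
          (cylBasis B hpos).x_mem_supported ⟨i, rfl, Or.inl rfl⟩
        have h3 := add_mem h1 h2
        rwa [sub_add_cancel] at h3
      · rw [hx, show g (Sum.inr c) = (cylBasis B hpos).x (Sum.inr c) from rfl, sub_self]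
        exact zero_mem _) wf
  refine ⟨Φ, fun a => ?_, fun c => ?_, fun q a ha => ?_, fun n a ha => ?_, fun i a ha => ?_⟩
  · have h : ∀ i, (Φ.toAlgHom.comp (inclBase 𝒲 (sumGrading (susp 𝒲) 𝒲))) (B.x i) = u (B.x i) := by
      intro i
      rw [AlgHom.comp_apply, inclBase_x_r B hpos]
      exact (hΦ _).trans (hx _)
    exact B.algHom_ext h a
  · exact (hΦ _).trans (hx _)
  · refine hmem _ ?_ a ha
    rintro _ _ ⟨_, S₀, T, rfl, rfl, i, rfl, -⟩ h
    rw [fiberPart_cons_inl] at h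
    rw [fiberPart_add, fiberPart_add, Multiset.card_add]
    exact h.trans (Nat.le_add_left _ _)
  · rw [(cylBasis B hpos).degree_eq] at ha ⊢
    refine hmem _ ?_ a ha
    rintro _ _ ⟨b, S₀, T, rfl, rfl, hT⟩ h
    rw [Multiset.map_add, Multiset.sum_add, (hρ _ _ hT).2.2, ← h, Multiset.map_cons,
      Multiset.sum_cons]
  · exact (hmem _ (Low.of_step hpos hρ) a ha).2

/-- A cylinder of `(ΛW, d)`: a differential on `Λ(W ⊕ (sW ⊕ W))` for which both inclusions of `ΛW`
are morphisms of DG algebras and the fold map restricts, for every `q`, to a morphism which is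
injective on cohomology from the span of the monomials with at least `q` letters `v i` to
`Λ^{≥ q} W`. -/
structure IsCylinder (d : Differential 𝒲) (lev : I → ℕ) (D : Differential (cyl 𝒲)) : Prop where
  diff_base : ∀ a, D.toLin (inclBase 𝒲 _ a) = inclBase 𝒲 _ (d.toLin a)
  diff_inclV : ∀ a, D.toLin (inclV 𝒲 a) = inclV 𝒲 (d.toLin a)
  diff_susp : ∀ i, D.toLin ((cylBasis B hpos).x (Sum.inr (Sum.inl i))) -
    ((cylBasis B hpos).x (Sum.inl i) - (cylBasis B hpos).x (Sum.inr (Sum.inr i)) -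
      ι (cyl 𝒲) (0, B.linearDiff d (B.b i), 0)) ∈ (cylBasis B hpos).supported (Low hpos lev i)
  fold_diff : ∀ a, fold 𝒲 (D.toLin a) = d.toLin (fold 𝒲 a)
  exists_eq : ∀ q : ℕ,
    ∀ x ∈ (cylBasis B hpos).supported fun S => q ≤ (fiberPart (fiberPart S)).card,
      D.toLin x = 0 → ∀ y ∈ wordGE 𝒲 q, fold 𝒲 x = d.toLin y →
        ∃ t ∈ (cylBasis B hpos).supported fun S => q ≤ (fiberPart (fiberPart S)).card,
          x = D.toLin t

/-- The cylinder arises by transporting the differential `diff` along the straightening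
automorphism. -/
theorem exists_cylinder (h𝒲 : DirectSum.IsInternal 𝒲)
    (hlev : ∀ i, d.toLin (B.x i) ∈ B.supported fun S => ∀ j ∈ S, lev j < lev i) :
    ∃ D : Differential (cyl 𝒲), IsCylinder hpos d lev D := by
  obtain ⟨u, hud, hup, hu⟩ := exists_deformation hpos h𝒲 hlev
  obtain ⟨Φ, hΦu, hΦx, hΦq, hΦd, hΦl⟩ := exists_straightening hpos hu
  let D₀ : Differential (cyl 𝒲) := (diff hpos d).toDifferential (diff_x_mem_degree hpos d)
    fun i => diff_diff hpos d h𝒲 _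
  have hsgn : ∀ a, (cylBasis B hpos).sgn (Φ a) = Φ ((cylBasis B hpos).sgn a) := fun a =>
    map_sgn (cylBasis B hpos) (cylBasis B hpos) Φ.toAlgHom
      (fun c => (hΦd _ _ (ι_mem_degree ((cylBasis B hpos).mem c))).1) a
  let θ : (cylBasis B hpos).OddDerivation :=
    { toLin := Φ.symm.toLinearMap ∘ₗ (diff hpos d).toLin ∘ₗ Φ.toLinearMap
      map_mul := fun a b => by
        simp only [LinearMap.comp_apply, AlgEquiv.toLinearMap_apply, map_mul,
          (diff hpos d).map_mul, map_add, AlgEquiv.symm_apply_apply, hsgn]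
      sgn_map := fun a => by
        simp only [LinearMap.comp_apply, AlgEquiv.toLinearMap_apply]
        apply Φ.injective
        rw [← hsgn, map_neg, AlgEquiv.apply_symm_apply, AlgEquiv.apply_symm_apply, ← hsgn,
          (diff hpos d).sgn_map] }
  have hθ : ∀ a, Φ (θ.toLin a) = (diff hpos d).toLin (Φ a) := fun a => Φ.apply_symm_apply _
  let D : Differential (cyl 𝒲) := θ.toDifferential
    (fun c => (hΦd _ _ (D₀.degree_succ _ _
      (hΦd _ _ (ι_mem_degree ((cylBasis B hpos).mem c))).1)).2)
    fun c => by
      apply Φ.injective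
      rw [hθ, hθ, diff_diff hpos d h𝒲, map_zero]
  have hD : ∀ a, Φ (D.toLin a) = (diff hpos d).toLin (Φ a) := hθ
  have hΦV : ∀ a, Φ (inclV 𝒲 a) = inclV 𝒲 a := fun a =>
    B.algHom_ext (f := Φ.toAlgHom.comp (inclV 𝒲)) (g := inclV 𝒲) (fun i => by
      rw [AlgHom.comp_apply, inclV_x B hpos]
      exact hΦx _) a
  have hΦs : ∀ w, Φ (ι (cyl 𝒲) (0, w, 0)) = ι (cyl 𝒲) (0, w, 0) := by
    intro w
    have e : Φ.toLinearMap ∘ₗ ι (cyl 𝒲) ∘ₗ LinearMap.inr k W (W × W) ∘ₗ LinearMap.inl k W W =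
        ι (cyl 𝒲) ∘ₗ LinearMap.inr k W (W × W) ∘ₗ LinearMap.inl k W W :=
      B.b.ext fun i => by
        have h1 := hΦx (Sum.inl i)
        rw [x_s] at h1
        exact h1
    exact LinearMap.congr_fun e w
  -- After straightening, the fold map is the projection which kills the letters `r i` and `s i`.
  have hfold : ∀ a, fold 𝒲 a = projV 𝒲 (Φ a) := fun a =>
    (cylBasis B hpos).algHom_ext (f := fold 𝒲) (g := (projV 𝒲).comp Φ.toAlgHom) (by
      rintro (i | i | i)
      · rw [AlgHom.comp_apply, ← inclBase_x_r B hpos, fold_inclBase B]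
        exact (hup _).symm.trans (congrArg _ (hΦu _).symm)
      · rw [AlgHom.comp_apply]
        refine Eq.trans ?_ (congrArg (projV 𝒲) (hΦx (Sum.inl i)).symm)
        rw [x_s, fold_ι, projV_ι, add_zero]
      · rw [AlgHom.comp_apply]
        refine Eq.trans ?_ (congrArg (projV 𝒲) (hΦx (Sum.inr i)).symm)
        rw [x_v, fold_ι, projV_ι, zero_add]) a
  refine ⟨D, fun a => ?_, fun a => ?_, fun i => ?_, fun a => ?_, fun q x hx hdx y hy hxy => ?_⟩
  · apply Φ.injective
    rw [hD, hΦu, hΦu, hud]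
  · apply Φ.injective
    rw [hD, hΦV, hΦV, diff_inclV]
  · have h1 := neg_mem (hΦl i _ (hu i))
    have e : D.toLin ((cylBasis B hpos).x (Sum.inr (Sum.inl i))) =
        Φ.symm ((cylBasis B hpos).x (Sum.inl i) - ι (cyl 𝒲) (0, B.linearDiff d (B.b i), 0)) := by
      apply Φ.injective
      rw [hD, hΦx, diff_x, AlgEquiv.apply_symm_apply, x_r, ← map_sub]
      simp
    have e1 : Φ.symm (u (B.x i)) = (cylBasis B hpos).x (Sum.inl i) := by
      rw [← hΦu, AlgEquiv.symm_apply_apply, inclBase_x_r B hpos]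
    have e2 : Φ.symm ((cylBasis B hpos).x (Sum.inr (Sum.inr i))) =
        (cylBasis B hpos).x (Sum.inr (Sum.inr i)) := by
      rw [AlgEquiv.symm_apply_eq, hΦx]
    have e3 : Φ.symm (ι (cyl 𝒲) (0, B.linearDiff d (B.b i), 0)) =
        ι (cyl 𝒲) (0, B.linearDiff d (B.b i), 0) := by
      rw [AlgEquiv.symm_apply_eq, hΦs]
    have ea : ∀ {R : Type u} [AddCommGroup R] (a b c t : R),
        t - c - (a - b - c) = -(a - t - b) := by intros; abel
    rw [map_sub, map_sub, e1, e2] at h1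
    rw [e, map_sub, e3, ea]
    exact h1
  · rw [hfold, hfold, hD, projV_diff]
  · have h1 : (diff hpos d).toLin (Φ x) = 0 := by rw [← hD, hdx, map_zero]
    obtain ⟨t, ht, e⟩ := exists_eq_diff hpos h𝒲 (hΦq q x hx).1 h1 hy (by rw [← hfold, hxy])
    refine ⟨Φ.symm t, (hΦq q t ht).2, ?_⟩
    apply Φ.injective
    rw [hD, AlgEquiv.apply_symm_apply, e]

end Cylinder

/-! ### The Toomer invariant -/

section Toomer

variable {k : Type u} [Field k] {V : Type u} [AddCommGroup V] [Module k V]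
  {𝒱 : ℕ → Submodule k V}

theorem wordSubmodule_anti {i j : ℕ} (h : i ≤ j) (P : Type u) [AddCommGroup P]
    [Module (FreeCGA 𝒱) P] : wordSubmodule 𝒱 j P ≤ wordSubmodule 𝒱 i P := by
  refine Submodule.span_mono ?_
  rintro _ ⟨a, ha, x, rfl⟩
  have h' : wordGE 𝒱 j ≤ wordGE 𝒱 i := Ideal.span_mono fun x ⟨l, hl, hx⟩ => ⟨l, h.trans hl, hx⟩
  exact ⟨a, h' ha, x, rfl⟩

theorem map_mem_wordSubmodule {P M : Type u} [AddCommGroup P] [Module (FreeCGA 𝒱) P]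
    [AddCommGroup M] [Module (FreeCGA 𝒱) M] (f : P →ₗ[FreeCGA 𝒱] M) {q : ℕ} {x : P}
    (hx : x ∈ wordSubmodule 𝒱 q P) : f x ∈ wordSubmodule 𝒱 q M := by
  have h : wordSubmodule 𝒱 q P ≤ (wordSubmodule 𝒱 q M).comap f := by
    refine Submodule.span_le.2 ?_
    rintro _ ⟨a, ha, x, rfl⟩
    exact Submodule.subset_span ⟨a, ha, f x, f.map_smul a x⟩
  exact h hx

/-- A bound for the Toomer invariant of `M` applies to every semifree resolution of `M`: it is the
supremum of the invariants of the resolutions. -/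
theorem projectionInjective_of_toomer_le {d : Differential 𝒱} {P M : Type u} [AddCommGroup P]
    [Module k P] [Module (FreeCGA 𝒱) P] [AddCommGroup M] [Module k M] [Module (FreeCGA 𝒱) M]
    {𝒢 : ℤ → Submodule k P} {dP : P →ₗ[k] P} {ℳ : ℤ → Submodule k M} {dM : M →ₗ[k] M}
    {f : P →ₗ[FreeCGA 𝒱] M} (hP : IsSemifree d 𝒢 dP) (hf : IsQuasiIso 𝒢 dP ℳ dM f) {n : ℕ}
    (h : toomer d ℳ dM ≤ (n : ℕ∞)) : ProjectionInjective 𝒱 n dP := by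
  have h1 : semifreeToomer 𝒱 dP ≤ (n : ℕ∞) :=
    (le_sSup ⟨P, _, _, _, 𝒢, dP, f, hP, hf, rfl⟩ : _ ≤ toomer d ℳ dM).trans h
  have hne : {e | ∃ m : ℕ, e = (m : ℕ∞) ∧ ProjectionInjective 𝒱 m dP}.Nonempty := by
    by_contra hne
    rw [Set.not_nonempty_iff_eq_empty] at hne
    unfold semifreeToomer at h1
    rw [hne, sInf_empty, top_le_iff] at h1
    exact ENat.natCast_ne_top n h1
  obtain ⟨m, hm, hm'⟩ := csInf_mem hne
  have h2 : m ≤ n := by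
    unfold semifreeToomer at h1
    rw [hm] at h1
    exact_mod_cast h1
  rintro x hx ⟨y, hy⟩
  exact hm' x hx ⟨y, wordSubmodule_anti (Nat.succ_le_succ h2) P hy⟩

/-- A bound for `e_{ΛV}(ΛV)` may be checked on `ΛV` itself: a quasi-isomorphism `P → ΛV` reflects
coboundaries. -/
theorem toomerSelf_le {d : Differential 𝒱} {n : ℕ}
    (h : ∀ x ∈ wordGE 𝒱 (n + 1), d.toLin x = 0 → ∃ z, x = d.toLin z) :
    toomerSelf d ≤ (n : ℕ∞) := by
  refine sSup_le ?_
  rintro _ ⟨P, _, _, _, 𝒢, dP, f, -, hf, rfl⟩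
  refine sInf_le ⟨n, rfl, ?_⟩
  rintro x hx ⟨y, hy⟩
  refine hf.injective x hx ?_
  have h1 := map_mem_wordSubmodule f hy
  have h2 : wordSubmodule 𝒱 (n + 1) (FreeCGA 𝒱) ≤ wordGE 𝒱 (n + 1) := by
    refine Submodule.span_le.2 ?_
    rintro _ ⟨a, ha, x, rfl⟩
    have h0 : (1 : FreeCGA 𝒱) ∈ wordGE 𝒱 0 :=
      Ideal.subset_span ⟨0, le_rfl, by unfold word; exact Submodule.one_le.1 le_rfl⟩
    have h1 := wordGE_mul ha (Ideal.mul_mem_left _ x h0)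
    rwa [mul_one] at h1
  obtain ⟨z, hz⟩ := h _ (h2 h1) (by
    rw [map_sub, map_sub, ← hf.comm, hx, hf.comm, d.sq_zero, map_zero, sub_zero])
  exact ⟨z + f y, by rw [map_add, ← hz, map_sub, hf.comm, sub_add_cancel]⟩

end Toomer

section FiberSpan

attribute [local instance] baseModule

variable {k : Type u} [Field k] {Z Y : Type u} [AddCommGroup Z] [Module k Z]
  [AddCommGroup Y] [Module k Y] {𝒵 : ℕ → Submodule k Z} {𝒴 : ℕ → Submodule k Y} {I J : Type u}

theorem projFiber_eq_zero {BZ : GradedBasis 𝒵 I} {BY : GradedBasis 𝒴 J}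
    {a : FreeCGA (sumGrading 𝒵 𝒴)}
    (ha : a ∈ (BZ.sum BY).supported fun S => 1 ≤ (basePart S).card) : projFiber 𝒵 𝒴 a = 0 := by
  have h1 : projFiber 𝒵 𝒴 a ∈ BY.supported fun _ => False :=
    supported_mono (fun T hT => by simp at hT) (projFiber_mem ha)
  have h2 : (BY.supported fun _ => False) ≤ (⊥ : Submodule k (FreeCGA 𝒴)) :=
    BY.supported_le fun l hl => hl.elim
  exact (Submodule.mem_bot k).1 (h2 h1)

/-- The fiber of a differential which restricts to the base has square zero. -/
theorem fiber_differential_sq (BZ : GradedBasis 𝒵 I) (BY : GradedBasis 𝒴 J) (dZ : Differential 𝒵)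
    (d : Differential (sumGrading 𝒵 𝒴))
    (hbase : ∀ a, d.toLin (inclBase 𝒵 𝒴 a) = inclBase 𝒵 𝒴 (dZ.toLin a)) (a : FreeCGA 𝒴) :
    projFiber 𝒵 𝒴 (d.toLin (inclFiber 𝒵 𝒴 (projFiber 𝒵 𝒴 (d.toLin (inclFiber 𝒵 𝒴 a))))) = 0 := by
  have h1 := projFiber_eq_zero (differential_mem_base dZ d hbase
    (sub_inclFiber_projFiber_mem BZ BY (d.toLin (inclFiber 𝒵 𝒴 a))))
  rwa [map_sub, d.sq_zero, zero_sub, map_neg, neg_eq_zero] at h1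

variable [CharZero k]

/-- The elements of base wordlength at least `q` in the span of monomials of the fiber lie in
`Λ^{≥ q} Z` times this span. -/
theorem mem_wordSubmodule_fiberSpan (BZ : GradedBasis 𝒵 I) (BY : GradedBasis 𝒴 J)
    {p : Multiset J → Prop} {q : ℕ} {a : FreeCGA (sumGrading 𝒵 𝒴)} (ha : a ∈ fiberSpan 𝒵 BY p)
    (hq : a ∈ (BZ.sum BY).supported fun S => q ≤ (basePart S).card) :
    (⟨a, ha⟩ : fiberSpan 𝒵 BY p) ∈ wordSubmodule 𝒵 q (fiberSpan 𝒵 BY p) := by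
  have h1 := (BZ.sum BY).mem_supported_and ((mem_fiberSpan_iff BZ BY).1 ha) hq
  have h2 : ((BZ.sum BY).supported fun S => p (fiberPart S) ∧ q ≤ (basePart S).card) ≤
      (((wordSubmodule 𝒵 q (fiberSpan 𝒵 BY p)).map (fiberSpan 𝒵 BY p).subtype).restrictScalars
        k) := by
    refine (BZ.sum BY).supported_le fun l hl => ?_
    obtain ⟨ε, l₁, l₂, e₁, e₂, e⟩ := exists_listProd_sum BZ BY l
    rw [e]
    refine Submodule.smul_mem _ _ ?_
    have hm : inclFiber 𝒵 𝒴 (BY.listProd l₂) ∈ fiberSpan 𝒵 BY p := by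
      rw [mem_fiberSpan_iff BZ BY]
      refine supported_mono ?_ (inclFiber_mem BZ (listProd_mem (p := p) (e₂ ▸ hl.1)))
      rintro S ⟨-, hS⟩
      exact hS
    refine ⟨BZ.listProd l₁ • ⟨_, hm⟩, Submodule.subset_span ⟨BZ.listProd l₁, ?_, _, rfl⟩, rfl⟩
    rw [BZ.mem_wordGE_iff]
    exact listProd_mem (e₁ ▸ hl.2)
  obtain ⟨b, hb, rfl⟩ := h2 h1
  exact hb

end FiberSpan

/-! ### The fiber of the cylinder -/

namespace Cylinder

variable {k : Type u} [Field k] {W : Type u} [AddCommGroup W] [Module k W]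
  {𝒲 : ℕ → Submodule k W} {I : Type u} {B : GradedBasis 𝒲 I} (hpos : ∀ i, 0 < B.deg i)

theorem sv_x_s (i : I) :
    (svBasis B hpos).x (Sum.inl i) = ι (sumGrading (susp 𝒲) 𝒲) (B.b i, 0) := by
  simp [x, GradedBasis.sum]; rfl

theorem sv_x_v (i : I) :
    (svBasis B hpos).x (Sum.inr i) = ι (sumGrading (susp 𝒲) 𝒲) (0, B.b i) := by
  simp [x, GradedBasis.sum]

/-- The derivation of `Λ(sW ⊕ W)` with `v i ↦ - s i`. -/
def contraction : (svBasis B hpos).OddDerivation :=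
  (svBasis B hpos).oddDerivation
    (Sum.elim (fun _ => 0) fun i => -(svBasis B hpos).x (Sum.inl i)) <| by
    refine isOddFamily_of_degree
      (fun a => Sum.elim (fun i => B.deg i) (fun i => B.deg i - 1) a) ?_ ?_
    · rintro (i | i)
      · exact zero_mem _
      · exact neg_mem (ι_mem_degree ((svBasis B hpos).mem (Sum.inl i)))
    · rintro (i | i)
      · have e : B.deg i - 1 + 1 = B.deg i := Nat.sub_add_cancel (hpos i)
        change Even (B.deg i + (B.deg i - 1 + 1))
        rw [e]
        exact ⟨_, rfl⟩
      · exact even_pred_add (hpos i)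

theorem contraction_s (i : I) :
    (contraction hpos).toLin ((svBasis B hpos).x (Sum.inl i)) = 0 :=
  (svBasis B hpos).oddDerivation_x _ _ (Sum.inl i)

theorem contraction_v (i : I) : (contraction hpos).toLin ((svBasis B hpos).x (Sum.inr i)) =
    -(svBasis B hpos).x (Sum.inl i) :=
  (svBasis B hpos).oddDerivation_x _ _ (Sum.inr i)

theorem contraction_ι_s (w : W) :
    (contraction hpos).toLin (ι (sumGrading (susp 𝒲) 𝒲) (w, 0)) = 0 := by
  have e : (contraction hpos).toLin ∘ₗ ι (sumGrading (susp 𝒲) 𝒲) ∘ₗ LinearMap.inl k W W = 0 :=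
    B.b.ext fun i => by
      have h1 := contraction_s hpos i
      rw [sv_x_s] at h1
      exact h1
  exact LinearMap.congr_fun e w

theorem contraction_ι_v (w : W) :
    (contraction hpos).toLin (ι (sumGrading (susp 𝒲) 𝒲) (0, w)) =
      -ι (sumGrading (susp 𝒲) 𝒲) (w, 0) := by
  have e : (contraction hpos).toLin ∘ₗ ι (sumGrading (susp 𝒲) 𝒲) ∘ₗ LinearMap.inr k W W =
      -(ι (sumGrading (susp 𝒲) 𝒲) ∘ₗ LinearMap.inl k W W) :=
    B.b.ext fun i => by
      have h1 := contraction_v hpos i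
      rw [sv_x_s, sv_x_v] at h1
      exact h1
  exact LinearMap.congr_fun e w

theorem contraction_mem {p q : Multiset (I ⊕ I) → Prop}
    (hpq : ∀ i S, p (Sum.inr i ::ₘ S) → q (Sum.inl i ::ₘ S))
    {a : FreeCGA (sumGrading (susp 𝒲) 𝒲)} (ha : a ∈ (svBasis B hpos).supported p) :
    (contraction hpos).toLin a ∈ (svBasis B hpos).supported q := by
  refine (contraction hpos).isSkewDerivation.map_mem
    (ρ := fun a T => ∃ i, a = Sum.inr i ∧ T = {Sum.inl i}) ?_ ?_ ha
  · rintro (i | i)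
    · rw [contraction_s]; exact zero_mem _
    · rw [contraction_v]
      exact neg_mem ((svBasis B hpos).x_mem_supported ⟨i, rfl, rfl⟩)
  · rintro _ _ ⟨_, S₀, T, rfl, rfl, i, rfl, rfl⟩ h
    exact hpq i S₀ h

variable {d : Differential 𝒲} {lev : I → ℕ} {D : Differential (cyl 𝒲)}

variable (B D) in
/-- The differential of the fiber `Λ(sW ⊕ W)` of the cylinder over the letters `r i`. -/
def fiberDiff : (svBasis B hpos).OddDerivation :=
  ((cylBasis B hpos).ofDifferential D).fiber

theorem fiberDiff_apply (a : FreeCGA (sumGrading (susp 𝒲) 𝒲)) :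
    (fiberDiff B hpos D).toLin a = projFiber 𝒲 _ (D.toLin (inclFiber 𝒲 _ a)) := rfl

theorem Low.of_map_inr {i : I} {T : Multiset (I ⊕ I)} (hT : Low hpos lev i (T.map Sum.inr)) :
    (∀ c ∈ T, Sum.elim lev lev c < lev i) ∧ 1 ≤ (fiberPart T).card := by
  obtain ⟨h1, ⟨c, hc, hc'⟩, -⟩ := hT
  refine ⟨fun c hc => h1 _ (Multiset.mem_map_of_mem _ hc), ?_⟩
  obtain ⟨c, hcT, rfl⟩ := Multiset.mem_map.1 hc
  rcases c with j | j
  · exact hc'.elim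
  · exact Multiset.card_pos_iff_exists_mem.2 ⟨j, mem_fiberPart.2 hcT⟩

variable [CharZero k]

namespace IsCylinder

theorem fiberDiff_v (h : IsCylinder hpos d lev D) (i : I) :
    (fiberDiff B hpos D).toLin ((svBasis B hpos).x (Sum.inr i)) =
      inclFiber (susp 𝒲) 𝒲 (d.toLin (B.x i)) := by
  rw [fiberDiff_apply, inclFiber_x B (svBasis B hpos), ← inclV_x B hpos, h.diff_inclV]
  exact projFiber_inclFiber (svBasis B hpos) _

theorem fiberDiff_s (h : IsCylinder hpos d lev D) (i : I) :
    (fiberDiff B hpos D).toLin ((svBasis B hpos).x (Sum.inl i)) +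
      (svBasis B hpos).x (Sum.inr i) +
      ι (sumGrading (susp 𝒲) 𝒲) (B.linearDiff d (B.b i), 0) ∈
        (svBasis B hpos).supported fun T => Low hpos lev i (T.map Sum.inr) := by
  have h1 := projFiber_mem (h.diff_susp i)
  rw [map_sub, map_sub, map_sub, projFiber_x_inl, projFiber_x_inr] at h1
  have e : projFiber 𝒲 (sumGrading (susp 𝒲) 𝒲) (ι (cyl 𝒲) (0, B.linearDiff d (B.b i), 0)) =
      ι (sumGrading (susp 𝒲) 𝒲) (B.linearDiff d (B.b i), 0) := FreeCGA.map_ι ..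
  have ea : ∀ {R : Type u} [AddCommGroup R] (a b c : R), a - (0 - b - c) = a + b + c := by
    intros; abel
  rw [e, ea] at h1
  rw [fiberDiff_apply, inclFiber_x B (svBasis B hpos)]
  exact h1

/-- The commutator of the differential of the fiber with the contraction is the identity on the
letters, up to terms in letters of lower level. On the letters `v i` these terms contain a letter
`v j`: the linear parts of the two differentials cancel. -/
theorem commutator_sub_mem (h : IsCylinder hpos d lev D)
    (hlev : ∀ i, d.toLin (B.x i) ∈ B.supported fun S => ∀ j ∈ S, lev j < lev i) (a : I ⊕ I) :
    ((fiberDiff B hpos D).toLin ∘ₗ (contraction hpos).toLin +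
      (contraction hpos).toLin ∘ₗ (fiberDiff B hpos D).toLin) ((svBasis B hpos).x a) -
        ((1 : ℕ) : k) • (svBasis B hpos).x a ∈ (svBasis B hpos).supported fun T =>
          (∀ c ∈ T, Sum.elim lev lev c < Sum.elim lev lev a) ∧
            (fiberPart {a}).card ≤ (fiberPart T).card := by
  rw [Nat.cast_one, one_smul, LinearMap.add_apply, LinearMap.comp_apply, LinearMap.comp_apply]
  rcases a with i | i
  · have h1 := h.fiberDiff_s hpos i
    have h2 := contraction_mem hpos (q := fun T => (∀ c ∈ T, Sum.elim lev lev c < lev i) ∧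
      (fiberPart ({Sum.inl i} : Multiset (I ⊕ I))).card ≤ (fiberPart T).card) (fun j S hS => by
        have h3 := (Low.of_map_inr hpos hS).1
        refine ⟨fun c hc => ?_, Nat.zero_le _⟩
        rcases Multiset.mem_cons.1 hc with rfl | hc
        · exact h3 (Sum.inr j) (Multiset.mem_cons_self _ _)
        · exact h3 c (Multiset.mem_cons_of_mem hc)) h1
    rw [map_add, map_add, contraction_v, contraction_ι_s, add_zero] at h2
    rw [contraction_s, map_zero, zero_add, sub_eq_add_neg]
    exact h2
  · have h1 := h.fiberDiff_s hpos i
    have h2 : (fiberDiff B hpos D).toLin ((svBasis B hpos).x (Sum.inl i)) +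
        (svBasis B hpos).x (Sum.inr i) + ι (sumGrading (susp 𝒲) 𝒲) (B.linearDiff d (B.b i), 0) ∈
        (svBasis B hpos).supported fun T => (∀ c ∈ T, Sum.elim lev lev c < lev i) ∧
          (fiberPart ({Sum.inr i} : Multiset (I ⊕ I))).card ≤ (fiberPart T).card :=
      supported_mono (fun T hT => Low.of_map_inr hpos hT) h1
    have h3 := sub_linearPart_mem (B.mem_supported_and (hlev i) (differential_x_mem d i))
    have h4 := contraction_mem hpos (q := fun T => (∀ c ∈ T, Sum.elim lev lev c < lev i) ∧
      (fiberPart ({Sum.inr i} : Multiset (I ⊕ I))).card ≤ (fiberPart T).card) (fun j S hS => by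
        obtain ⟨hb, ⟨hl, -, hc1⟩, hc2⟩ := hS
        rw [basePart_cons_inr] at hb
        rw [fiberPart_cons_inr] at hl hc1 hc2
        rw [Multiset.card_cons] at hc1 hc2
        refine ⟨fun c hc => ?_, ?_⟩
        · rcases Multiset.mem_cons.1 hc with rfl | hc
          · exact hl j (Multiset.mem_cons_self _ _)
          · rcases c with l | l
            · have := mem_basePart.2 hc
              rw [hb] at this
              exact absurd this (Multiset.notMem_zero l)
            · exact hl l (Multiset.mem_cons_of_mem (mem_fiberPart.2 hc))
        · rw [fiberPart_cons_inl]
          change 1 ≤ _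
          omega) (inclFiber_mem (suspBasis B hpos) h3)
    have e : inclFiber (susp 𝒲) 𝒲 (ι 𝒲 (B.linearPart (d.toLin (B.x i)))) =
        ι (sumGrading (susp 𝒲) 𝒲) (0, B.linearDiff d (B.b i)) := FreeCGA.map_ι ..
    rw [map_sub, map_sub, e, contraction_ι_v] at h4
    have h5 := sub_mem h4 h2
    have ea : ∀ {R : Type u} [AddCommGroup R] (a b c l : R),
        a - -l - (b + c + l) = -b + a - c := by intros; abel
    rw [ea] at h5
    rw [contraction_v, map_neg, h.fiberDiff_v hpos]
    exact h5

theorem fiberDiff_mem (h : IsCylinder hpos d lev D) {t : ℕ}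
    {x : FreeCGA (sumGrading (susp 𝒲) 𝒲)}
    (hx : x ∈ (svBasis B hpos).supported fun T => t ≤ (fiberPart T).card) :
    (fiberDiff B hpos D).toLin x ∈ (svBasis B hpos).supported fun T => t ≤ (fiberPart T).card := by
  refine (fiberDiff B hpos D).isSkewDerivation.map_mem (ρ := fun a T =>
    (fiberPart ({a} : Multiset (I ⊕ I))).card ≤ (fiberPart T).card) ?_ ?_ hx
  · rintro (i | i)
    · exact supported_mono (fun _ _ => Nat.zero_le _) ((svBasis B hpos).mem_supported_true _)
    · rw [h.fiberDiff_v hpos]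
      refine supported_mono ?_ (inclFiber_mem (suspBasis B hpos) (differential_x_mem d i))
      rintro S ⟨-, -, hS⟩
      exact hS
  · intro S' S hS hp
    exact hp.trans (Step.le (ν := fun T : Multiset (I ⊕ I) => (fiberPart T).card) (by simp)
      (fun _ _ h => h) _ _ hS)

/-- In the fiber of the cylinder a cocycle with at least `t + 1` letters `v i` is the coboundary of
an element with at least `t` of them. -/
theorem exists_fiberDiff_eq (h : IsCylinder hpos d lev D)
    (hlev : ∀ i, d.toLin (B.x i) ∈ B.supported fun S => ∀ j ∈ S, lev j < lev i) {t : ℕ}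
    {x : FreeCGA (sumGrading (susp 𝒲) 𝒲)}
    (hx : x ∈ (svBasis B hpos).supported fun T => t + 1 ≤ (fiberPart T).card)
    (hdx : (fiberDiff B hpos D).toLin x = 0) :
    ∃ y ∈ (svBasis B hpos).supported fun T => t ≤ (fiberPart T).card,
      (fiberDiff B hpos D).toLin y = x := by
  let ρ : I ⊕ I → Multiset (I ⊕ I) → Prop := fun a T =>
    (∀ c ∈ T, Sum.elim lev lev c < Sum.elim lev lev a) ∧
      (fiberPart ({a} : Multiset (I ⊕ I))).card ≤ (fiberPart T).card
  let L := (fiberDiff B hpos D).toLin ∘ₗ (contraction hpos).toLin +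
    (contraction hpos).toLin ∘ₗ (fiberDiff B hpos D).toLin
  have hsq : ∀ a, (fiberDiff B hpos D).toLin ((fiberDiff B hpos D).toLin a) = 0 :=
    fiber_differential_sq B (svBasis B hpos) d D h.diff_base
  have hL : ∀ l : List (I ⊕ I), L ((svBasis B hpos).listProd l) -
      ((((l : Multiset (I ⊕ I)).map fun _ => 1).sum : ℕ) : k) • (svBasis B hpos).listProd l ∈
        (svBasis B hpos).supported fun S => Relation.TransGen (Step ρ) S l := fun l =>
    supported_mono (fun _ h => Relation.TransGen.single h)
      (((fiberDiff B hpos D).isSkewDerivation_comm (contraction hpos)).sub_weight_mem (fun _ => 1)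
        (h.commutator_sub_mem hpos hlev) l)
  have wf : WellFounded (Relation.TransGen (Step ρ)) :=
    Step.wellFounded (r := fun a b => Sum.elim lev lev a < Sum.elim lev lev b)
      (InvImage.wf _ wellFounded_lt) fun _ _ h => h.1
  have hc : ∀ S : Multiset (I ⊕ I), t + 1 ≤ (fiberPart S).card →
      (((S.map fun _ => 1).sum : ℕ) : k) ≠ 0 := by
    intro S hS
    have h1 := card_parts S
    rw [Nat.cast_ne_zero]
    simp only [Multiset.map_const', Multiset.sum_replicate, smul_eq_mul, mul_one]
    omega
  have hcl : ∀ S' S : Multiset (I ⊕ I), Step ρ S' S → t + 1 ≤ (fiberPart S).card →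
      t + 1 ≤ (fiberPart S').card := fun S' S h' hS => hS.trans
    (Step.le (ν := fun T : Multiset (I ⊕ I) => (fiberPart T).card) (by simp)
      (fun _ _ h => h.2) _ _ h')
  obtain ⟨X, hX, e⟩ := triangular_surjective (T := L)
    (p := fun T => t + 1 ≤ (fiberPart T).card) wf
    (fun _ _ hS h' => Step.transGen_of_closed hcl h' hS) hc (fun l _ => hL l) hx
  have hDX : (fiberDiff B hpos D).toLin X = 0 := by
    refine triangular_injective (T := L) wf (fun _ _ _ => Relation.TransGen.trans) hc
      (fun l _ => hL l) (h.fiberDiff_mem hpos hX) ?_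
    have h1 := congrArg (fiberDiff B hpos D).toLin e
    rw [hdx] at h1
    rw [← h1]
    simp only [L, LinearMap.add_apply, LinearMap.comp_apply, map_add, hsq, map_zero, add_zero,
      zero_add]
  refine ⟨(contraction hpos).toLin X, contraction_mem hpos (fun i S hS => ?_) hX, ?_⟩
  · rw [fiberPart_cons_inr, Multiset.card_cons] at hS
    rw [fiberPart_cons_inl]
    exact Nat.le_of_succ_le_succ hS
  · rw [← e]
    simp only [L, LinearMap.add_apply, LinearMap.comp_apply, hDX, map_zero, add_zero]

end IsCylinder

end Cylinder

/-! ### Semifree resolutions of `Λ^{≥ q} W` -/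

theorem FreeCGA.GradedBasis.mem_degreeInt_of_letters {k : Type u} [Field k] {V V' : Type u}
    [AddCommGroup V] [Module k V] [AddCommGroup V'] [Module k V'] {𝒱 : ℕ → Submodule k V}
    {𝒱' : ℕ → Submodule k V'} {I I' : Type u} (B : GradedBasis 𝒱 I) (B' : GradedBasis 𝒱' I')
    (φ : FreeCGA 𝒱 →ₐ[k] FreeCGA 𝒱') (hφ : ∀ i, φ (B.x i) ∈ degree 𝒱' (B.deg i)) {i : ℤ}
    {a : FreeCGA 𝒱} (ha : a ∈ degreeInt 𝒱 i) : φ a ∈ degreeInt 𝒱' i := by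
  have h : degreeInt 𝒱 i ≤ (degreeInt 𝒱' i).comap φ.toLinearMap :=
    iSup₂_le fun n hn a ha => (le_iSup₂ (f := fun (n : ℕ) (_ : (n : ℤ) = i) => degree 𝒱' n) n hn)
      (B.mem_degree_of_letters B' φ hφ ha)
  exact h ha

namespace Cylinder

attribute [local instance] baseModule

variable {k : Type u} [Field k] {W : Type u} [AddCommGroup W] [Module k W]
  {𝒲 : ℕ → Submodule k W} {I : Type u} {B : GradedBasis 𝒲 I} (hpos : ∀ i, 0 < B.deg i)

theorem fold_x_mem_degree (a : I ⊕ (I ⊕ I)) :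
    fold 𝒲 ((cylBasis B hpos).x a) ∈ degree 𝒲 ((cylBasis B hpos).deg a) := by
  rcases a with i | i | i
  · rw [x_r, fold_ι, add_zero]
    exact ι_mem_degree (B.mem i)
  · rw [x_s, fold_ι, add_zero, map_zero]
    exact zero_mem _
  · rw [x_v, fold_ι, zero_add]
    exact ι_mem_degree (B.mem i)

theorem fold_mem {q : ℕ} {a : FreeCGA (cyl 𝒲)}
    (ha : a ∈ (cylBasis B hpos).supported fun S => q ≤ (fiberPart (fiberPart S)).card) :
    fold 𝒲 a ∈ wordGE 𝒲 q := by
  have h : ∀ l : List (I ⊕ (I ⊕ I)), fold 𝒲 ((cylBasis B hpos).listProd l) ∈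
      wordGE 𝒲 (fiberPart (fiberPart (l : Multiset (I ⊕ (I ⊕ I))))).card := by
    intro l
    induction l with
    | nil => exact Ideal.subset_span ⟨0, le_rfl, by
        unfold word
        rw [GradedBasis.listProd_nil, map_one]
        exact Submodule.one_le.1 le_rfl⟩
    | cons a l ih =>
      rw [GradedBasis.listProd_cons, map_mul, ← Multiset.cons_coe]
      rcases a with i | i | i
      · rw [fiberPart_cons_inl]
        exact Ideal.mul_mem_left _ _ ih
      · rw [fiberPart_cons_inr, fiberPart_cons_inl]
        exact Ideal.mul_mem_left _ _ ih
      · rw [fiberPart_cons_inr, fiberPart_cons_inr, Multiset.card_cons, add_comm]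
        refine wordGE_mul ?_ ih
        rw [x_v, fold_ι]
        exact Ideal.subset_span ⟨1, le_rfl, by unfold word; rw [pow_one]; exact ⟨_, rfl⟩⟩
  refine map_mem_of_listProd (fold 𝒲).toLinearMap
    (N := (wordGE 𝒲 q).restrictScalars k) (fun l hl => ?_) ha
  have h' : wordGE 𝒲 (fiberPart (fiberPart (l : Multiset (I ⊕ (I ⊕ I))))).card ≤ wordGE 𝒲 q :=
    Ideal.span_mono fun x ⟨j, hj, hx⟩ => ⟨j, hl.trans hj, hx⟩
  exact h' (h l)

theorem fold_smul (B : GradedBasis 𝒲 I) (c : FreeCGA 𝒲) (a : FreeCGA (cyl 𝒲)) :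
    fold 𝒲 (c • a) = c * fold 𝒲 a := by
  rw [base_smul_def, map_mul, fold_inclBase B]

variable [CharZero k] {d : Differential 𝒲} {lev : I → ℕ} {D : Differential (cyl 𝒲)}

theorem fold_mem_of_mem_fiberSpan {q : ℕ} {a : FreeCGA (cyl 𝒲)}
    (ha : a ∈ fiberSpan 𝒲 (svBasis B hpos) fun T => q ≤ (fiberPart T).card) :
    fold 𝒲 a ∈ wordGE 𝒲 q := by
  have h := (mem_fiberSpan_iff B (svBasis B hpos)).1 ha
  exact fold_mem hpos h

theorem inclV_mem_fiberSpan {q : ℕ} {a : FreeCGA 𝒲} (ha : a ∈ wordGE 𝒲 q) :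
    inclV 𝒲 a ∈ fiberSpan 𝒲 (svBasis B hpos) fun T => q ≤ (fiberPart T).card := by
  rw [mem_fiberSpan_iff B (svBasis B hpos)]
  rw [B.mem_wordGE_iff] at ha
  have h := inclV_mem hpos ha
  exact supported_mono (fun S hS => hS.2.2) h

/-- The fold map on the monomials with at least `q` letters `v i`. -/
def foldMap (hpos : ∀ i, 0 < B.deg i) (q : ℕ) :
    fiberSpan 𝒲 (svBasis B hpos) (fun T => q ≤ (fiberPart T).card) →ₗ[FreeCGA 𝒲] wordGE 𝒲 q where
  toFun a := ⟨fold 𝒲 a.1, fold_mem_of_mem_fiberSpan hpos a.2⟩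
  map_add' a b := Subtype.ext (map_add (fold 𝒲) a.1 b.1)
  map_smul' c a := Subtype.ext (fold_smul B c a.1)

namespace IsCylinder

theorem diff_mem (h : IsCylinder hpos d lev D) {q : ℕ} {x : FreeCGA (cyl 𝒲)}
    (hx : x ∈ (cylBasis B hpos).supported fun S => q ≤ (fiberPart (fiberPart S)).card) :
    D.toLin x ∈ (cylBasis B hpos).supported fun S => q ≤ (fiberPart (fiberPart S)).card := by
  refine ((cylBasis B hpos).ofDifferential D).isSkewDerivation.map_mem (ρ := fun a T =>
    (fiberPart (fiberPart ({a} : Multiset (I ⊕ (I ⊕ I))))).card ≤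
      (fiberPart (fiberPart T)).card) ?_ ?_ hx
  · rintro (i | i | i)
    · exact supported_mono (fun _ _ => Nat.zero_le _) ((cylBasis B hpos).mem_supported_true _)
    · exact supported_mono (fun _ _ => Nat.zero_le _) ((cylBasis B hpos).mem_supported_true _)
    · have h1 : D.toLin ((cylBasis B hpos).x (Sum.inr (Sum.inr i))) =
          inclV 𝒲 (d.toLin (B.x i)) := by
        rw [← inclV_x B hpos, h.diff_inclV]
      change D.toLin _ ∈ _
      rw [h1]
      refine supported_mono ?_ (inclV_mem hpos (differential_x_mem d i))
      rintro S ⟨-, -, -, hS⟩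
      exact hS
  · intro S' S hS hp
    exact hp.trans (Step.le (ν := fun T : Multiset (I ⊕ (I ⊕ I)) =>
      (fiberPart (fiberPart T)).card) (by simp) (fun _ _ h => h) _ _ hS)

/-- Modulo coboundaries a cocycle of `Λ^{≥ q + a} W` can be moved, through the cylinder, to an
element with at least `a` letters `r i` and at least `q` letters `v i`. -/
theorem exists_sub_diff_mem (h : IsCylinder hpos d lev D)
    (hlev : ∀ i, d.toLin (B.x i) ∈ B.supported fun S => ∀ j ∈ S, lev j < lev i) {q a : ℕ}
    {x : FreeCGA 𝒲} (hx : x ∈ wordGE 𝒲 (q + a)) (hdx : d.toLin x = 0) (i : ℕ) (hi : i ≤ a) :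
    ∃ t ∈ (cylBasis B hpos).supported fun S => q ≤ (fiberPart (fiberPart S)).card,
      inclV 𝒲 x - D.toLin t ∈ ((cylBasis B hpos).supported fun S => i ≤ (basePart S).card) ∧
      inclV 𝒲 x - D.toLin t ∈
        (cylBasis B hpos).supported fun S => q + (a - i) ≤ (fiberPart (fiberPart S)).card := by
  induction i with
  | zero =>
    refine ⟨0, zero_mem _, ?_, ?_⟩
    · exact supported_mono (fun _ _ => Nat.zero_le _) ((cylBasis B hpos).mem_supported_true _)
    · rw [map_zero, sub_zero]
      rw [B.mem_wordGE_iff] at hx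
      have h1 := inclV_mem hpos hx
      exact supported_mono (fun S hS => hS.2.2) h1
  | succ i ih =>
    obtain ⟨t, ht, h1, h2⟩ := ih (Nat.le_of_succ_le hi)
    have e : q + (a - i) = q + (a - (i + 1)) + 1 := by omega
    rw [e] at h2
    have hsq : ∀ b, (fiberDiff B hpos D).toLin ((fiberDiff B hpos D).toLin b) = 0 :=
      fiber_differential_sq B (svBasis B hpos) d D h.diff_base
    obtain ⟨g, hg⟩ := exists_homotopy (fiberDiff B hpos D).toLin hsq
      (B' := (svBasis B hpos).supported fun T => q + (a - (i + 1)) + 1 ≤ (fiberPart T).card)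
      (B := (svBasis B hpos).supported fun T => q + (a - (i + 1)) ≤ (fiberPart T).card)
      (supported_mono fun S hS => Nat.le_of_succ_le hS) (fun b hb => h.fiberDiff_mem hpos hb)
      fun b hb hdb => h.exists_fiberDiff_eq hpos hlev hb hdb
    have hdy : D.toLin (inclV 𝒲 x - D.toLin t) = 0 := by
      rw [map_sub, D.sq_zero, h.diff_inclV, hdx, map_zero, sub_zero]
    have h2' : inclV 𝒲 x - D.toLin t ∈ (cylBasis B hpos).supported fun S =>
        (basePart S).card = i → q + (a - (i + 1)) + 1 ≤ (fiberPart (fiberPart S)).card :=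
      by
      refine supported_mono ?_ h2
      intro S hS _
      exact hS
    have h3 := exists_sub_differential_mem d D h.diff_base
      (p := fun T => q + (a - (i + 1)) ≤ (fiberPart T).card)
      (p' := fun T => q + (a - (i + 1)) + 1 ≤ (fiberPart T).card)
      (fiberDiff B hpos D).toLin (fun _ => rfl) g hg h1 h2' hdy
    obtain ⟨t', ht', h3⟩ := h3
    have ht'' : t' ∈ (cylBasis B hpos).supported fun S =>
        q + (a - (i + 1)) ≤ (fiberPart (fiberPart S)).card := supported_mono (fun S hS => hS.2) ht'
    have e' : inclV 𝒲 x - D.toLin (t + t') = inclV 𝒲 x - D.toLin t - D.toLin t' := by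
      rw [map_add, sub_add_eq_sub_sub]
    refine ⟨t + t', add_mem ht ?_, ?_, ?_⟩
    · exact supported_mono (fun S hS => (Nat.le_add_right _ _).trans hS) ht''
    · rw [e']; exact h3
    · rw [e']
      have h4 : inclV 𝒲 x - D.toLin t ∈ (cylBasis B hpos).supported fun S =>
          q + (a - (i + 1)) ≤ (fiberPart (fiberPart S)).card :=
        supported_mono (fun S hS => Nat.le_of_succ_le hS) h2
      have h5 := h.diff_mem hpos ht''
      exact sub_mem h4 h5

theorem diff_mem_fiberSpan (h : IsCylinder hpos d lev D) (q : ℕ) :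
    ∀ a ∈ fiberSpan 𝒲 (svBasis B hpos) (fun T => q ≤ (fiberPart T).card),
      D.toLin a ∈ fiberSpan 𝒲 (svBasis B hpos) fun T => q ≤ (fiberPart T).card := by
  intro a ha
  rw [mem_fiberSpan_iff B] at ha ⊢
  exact h.diff_mem hpos ha

/-- The monomials with at least `q` letters `v i` span a semifree module over `ΛW`, which acts
through the letters `r i`. The letters are ordered by their levels, with `v i` placed before
`s i`. -/
theorem isSemifree (h : IsCylinder hpos d lev D)
    (hlev : ∀ i, d.toLin (B.x i) ∈ B.supported fun S => ∀ j ∈ S, lev j < lev i) (q : ℕ) :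
    IsSemifree d (fiberSpanGrading 𝒲 (svBasis B hpos) fun T => q ≤ (fiberPart T).card)
      (fiberSpanDiff (svBasis B hpos) _ D (h.diff_mem_fiberSpan hpos q)) := by
  -- The differential of `s i` contains `v i`, so the level of `s i` has to exceed that of `v i`.
  refine isSemifree_fiberSpan B (svBasis B hpos) _ d D h.diff_base _
    (Sum.elim (fun i => 2 * lev i + 1) fun i => 2 * lev i) ?_
  rintro (i | i)
  · have h0 : ∀ c : I ⊕ I, Sum.elim lev lev c < lev i →
        Sum.elim (fun i => 2 * lev i + 1) (fun i => 2 * lev i) c < 2 * lev i + 1 := by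
      rintro (j | j) hj <;> simp only [Sum.elim_inl, Sum.elim_inr] at hj ⊢ <;> omega
    have h1 := h.diff_susp i
    have h2 : D.toLin ((cylBasis B hpos).x (Sum.inr (Sum.inl i))) -
        ((cylBasis B hpos).x (Sum.inl i) - (cylBasis B hpos).x (Sum.inr (Sum.inr i)) -
          ι (cyl 𝒲) (0, B.linearDiff d (B.b i), 0)) ∈ (cylBasis B hpos).supported fun S =>
            ∀ c ∈ fiberPart S, Sum.elim (fun i => 2 * lev i + 1) (fun i => 2 * lev i) c <
              2 * lev i + 1 :=
      supported_mono (fun S hS c hc => h0 c (hS.1 _ (mem_fiberPart.1 hc))) h1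
    have h3 : ι (cyl 𝒲) (0, B.linearDiff d (B.b i), 0) ∈ (cylBasis B hpos).supported fun S =>
            ∀ c ∈ fiberPart S, Sum.elim (fun i => 2 * lev i + 1) (fun i => 2 * lev i) c <
              2 * lev i + 1 := by
      refine supported_mono (fun S hS c hc => ?_) (linearDiff_low hpos d (hlev i))
      obtain ⟨j, hj, hj'⟩ := hS _ (mem_fiberPart.1 hc)
      obtain rfl := Sum.inr_injective hj
      exact h0 _ hj'
    have h4 : (cylBasis B hpos).x (Sum.inl i) ∈ (cylBasis B hpos).supported fun S =>
            ∀ c ∈ fiberPart S, Sum.elim (fun i => 2 * lev i + 1) (fun i => 2 * lev i) c <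
              2 * lev i + 1 := by
      refine (cylBasis B hpos).x_mem_supported fun c hc => ?_
      have := mem_fiberPart.1 hc
      rw [Multiset.mem_singleton] at this
      exact absurd this Sum.inr_ne_inl
    have h5 : (cylBasis B hpos).x (Sum.inr (Sum.inr i)) ∈ (cylBasis B hpos).supported fun S =>
            ∀ c ∈ fiberPart S, Sum.elim (fun i => 2 * lev i + 1) (fun i => 2 * lev i) c <
              2 * lev i + 1 := by
      refine (cylBasis B hpos).x_mem_supported fun c hc => ?_
      have := mem_fiberPart.1 hc
      rw [Multiset.mem_singleton] at this
      obtain rfl := Sum.inr_injective this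
      exact Nat.lt_succ_self _
    have h6 := add_mem h2 (sub_mem (sub_mem h4 h5) h3)
    rw [sub_add_cancel] at h6
    exact h6
  · have h1 : D.toLin ((cylBasis B hpos).x (Sum.inr (Sum.inr i))) = inclV 𝒲 (d.toLin (B.x i)) := by
      rw [← inclV_x B hpos, h.diff_inclV]
    rw [h1]
    refine supported_mono ?_ (inclV_mem hpos (hlev i))
    rintro S ⟨-, hb, hS⟩ (c | c) hc
    · have := mem_basePart.2 hc
      rw [hb] at this
      exact absurd this (Multiset.notMem_zero c)
    · have := hS c (mem_fiberPart.2 hc)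
      simp only [Sum.elim_inr]
      omega

/-- The fold map is a semifree resolution of `Λ^{≥ q} W`. -/
theorem isQuasiIso (h : IsCylinder hpos d lev D) (h𝒲 : DirectSum.IsInternal 𝒲) (q : ℕ) :
    IsQuasiIso (fiberSpanGrading 𝒲 (svBasis B hpos) fun T => q ≤ (fiberPart T).card)
      (fiberSpanDiff (svBasis B hpos) _ D (h.diff_mem_fiberSpan hpos q))
      (fun i => (degreeInt 𝒲 i).comap ((wordGE 𝒲 q).subtype.restrictScalars k))
      (d.toLin.restrict (p := (wordGE 𝒲 q).restrictScalars k)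
        (q := (wordGE 𝒲 q).restrictScalars k) (d.mem_wordGE h𝒲 q)) (foldMap hpos q) := by
  constructor
  · intro i x hx
    have h1 : x.1 ∈ degreeInt (cyl 𝒲) i := hx
    exact (cylBasis B hpos).mem_degreeInt_of_letters B (fold 𝒲) (fold_x_mem_degree hpos) h1
  · intro x
    exact Subtype.ext (h.fold_diff x.1)
  · rintro ⟨x, hx⟩ hdx ⟨y, hy⟩
    have h1 := (mem_fiberSpan_iff B (svBasis B hpos)).1 hx
    have h2 : D.toLin x = 0 := congrArg Subtype.val hdx
    have h3 : fold 𝒲 x = d.toLin y.1 := congrArg Subtype.val hy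
    obtain ⟨t, ht, e⟩ := h.exists_eq q x h1 h2 y.1 y.2 h3
    exact ⟨⟨t, (mem_fiberSpan_iff B (svBasis B hpos)).2 ht⟩, Subtype.ext e⟩
  · rintro ⟨y, hy⟩ hdy
    have hdy' : d.toLin y = 0 := congrArg Subtype.val hdy
    have hm := inclV_mem_fiberSpan hpos hy
    have hd : D.toLin (inclV 𝒲 y) = 0 := by rw [h.diff_inclV, hdy', map_zero]
    refine ⟨⟨inclV 𝒲 y, hm⟩, 0, Subtype.ext hd, Subtype.ext ?_⟩
    change y = fold 𝒲 (inclV 𝒲 y) + d.toLin 0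
    rw [map_zero, add_zero, fold_inclV B]

end IsCylinder

end Cylinder

open Cylinder in
/-- If `e_{ΛW}(Λ^{≥ q} W) ≤ n`, then every cocycle of wordlength at least `q + n + 1` is the
coboundary of an element of wordlength at least `q`. -/
theorem exists_eq_differential_of_toomerWordGE_le {k : Type u} [Field k] [CharZero k] {W : Type u}
    [AddCommGroup W] [Module k W] {𝒲 : ℕ → Submodule k W} {I : Type u} {B : GradedBasis 𝒲 I}
    (hpos : ∀ i, 0 < B.deg i) {d : Differential 𝒲} {lev : I → ℕ}
    (hlev : ∀ i, d.toLin (B.x i) ∈ B.supported fun S => ∀ j ∈ S, lev j < lev i)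
    (h𝒲 : DirectSum.IsInternal 𝒲) {q n : ℕ} (hn : toomerWordGE h𝒲 d q ≤ (n : ℕ∞))
    {x : FreeCGA 𝒲} (hx : x ∈ wordGE 𝒲 (q + (n + 1))) (hdx : d.toLin x = 0) :
    ∃ z ∈ wordGE 𝒲 q, d.toLin z = x := by
  obtain ⟨D, h⟩ := exists_cylinder hpos h𝒲 hlev
  have hinj : ProjectionInjective 𝒲 n
      (fiberSpanDiff (svBasis B hpos) _ D (h.diff_mem_fiberSpan hpos q)) :=
    projectionInjective_of_toomer_le (h.isSemifree hpos hlev q) (h.isQuasiIso hpos h𝒲 q) hn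
  obtain ⟨t, ht, h1, h2⟩ := h.exists_sub_diff_mem hpos hlev hx hdx (n + 1) le_rfl
  have ht' : t ∈ fiberSpan 𝒲 (svBasis B hpos) fun T => q ≤ (fiberPart T).card := by
    rw [mem_fiberSpan_iff B (svBasis B hpos)]
    exact ht
  have hxq : x ∈ wordGE 𝒲 q := by
    have h' : wordGE 𝒲 (q + (n + 1)) ≤ wordGE 𝒲 q :=
      Ideal.span_mono fun x ⟨j, hj, hx⟩ => ⟨j, (Nat.le_add_right _ _).trans hj, hx⟩
    exact h' hx
  have hX := inclV_mem_fiberSpan hpos hxq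
  have hdX : D.toLin (inclV 𝒲 x) = 0 := by rw [h.diff_inclV, hdx, map_zero]
  have hw := mem_wordSubmodule_fiberSpan B (svBasis B hpos)
    (sub_mem hX (h.diff_mem_fiberSpan hpos q t ht')) h1
  have hz := hinj ⟨inclV 𝒲 x, hX⟩ (Subtype.ext hdX) ⟨⟨t, ht'⟩, hw⟩
  obtain ⟨⟨z, hz⟩, e⟩ := hz
  have e' : inclV 𝒲 x = D.toLin z := congrArg Subtype.val e
  refine ⟨fold 𝒲 z, fold_mem_of_mem_fiberSpan hpos hz, ?_⟩
  rw [← h.fold_diff, ← e', fold_inclV B]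

/-! ### Relative Sullivan algebras -/

section RelativeSullivan

attribute [local instance] baseModule

variable {k : Type u} [Field k] {Z W : Type u} [AddCommGroup Z] [Module k Z] [AddCommGroup W]
  [Module k W] {𝒵 : ℕ → Submodule k Z} {𝒲 : ℕ → Submodule k W} {I J : Type u}

theorem FreeCGA.GradedBasis.differential_mem_card {V : Type u} [AddCommGroup V] [Module k V]
    {𝒱 : ℕ → Submodule k V} {B : GradedBasis 𝒱 I} (d : Differential 𝒱) {c : ℕ}
    (hd : ∀ i, d.toLin (B.x i) ∈ B.supported fun S => c + 1 ≤ S.card) {q : ℕ} {a : FreeCGA 𝒱}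
    (ha : a ∈ B.supported fun S => q ≤ S.card) :
    d.toLin a ∈ B.supported fun S => q + c ≤ S.card := by
  refine (B.ofDifferential d).isSkewDerivation.map_mem (ρ := fun _ T => c + 1 ≤ T.card) hd ?_ ha
  rintro _ _ ⟨i, S, T, rfl, rfl, hT⟩ h
  rw [Multiset.card_cons] at h
  rw [Multiset.card_add]
  omega

/-- A basis adapted to the filtration of a relative Sullivan algebra. -/
theorem IsRelativeSullivan.exists_fiber_basis {dZ : Differential 𝒵}
    {d : Differential (sumGrading 𝒵 𝒲)} {dW : Differential 𝒲} (hV : IsRelativeSullivan dZ d dW)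
    (h𝒲 : DirectSum.IsInternal 𝒲) : ∃ (J : Type u) (BW : GradedBasis 𝒲 J) (lev : J → ℕ),
      (∀ j, 0 < BW.deg j) ∧
      (∀ {I : Type u} (BZ : GradedBasis 𝒵 I) (j : J), d.toLin ((BZ.sum BW).x (Sum.inr j)) ∈
        (BZ.sum BW).supported fun S => ∀ i ∈ fiberPart S, lev i < lev j) := by
  obtain ⟨F, hF, hdF⟩ := hV.filtration
  obtain ⟨J, BW, lev, h1, h2⟩ := exists_gradedBasis h𝒲 hF
  refine ⟨J, BW, lev, fun j => ?_, fun {I} BZ j => ?_⟩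
  · by_contra hj
    have h3 := BW.mem j
    rw [Nat.eq_zero_of_not_pos hj, hV.pos, Submodule.mem_bot] at h3
    exact BW.b.ne_zero j h3
  · have h3 := hdF (lev j) (BW.b j) (h1 j)
    have e : (BZ.sum BW).x (Sum.inr j) = ι (sumGrading 𝒵 𝒲) (0, BW.b j) := by
      simp [x, GradedBasis.sum]
    rw [e]
    have hle : baseReduced 𝒵 𝒲 *
        (subLambda (sumGrading 𝒵 𝒲) ((F (lev j)).map (LinearMap.inr k Z W))).toSubmodule ≤
        (BZ.sum BW).supported fun S => ∀ i ∈ fiberPart S, lev i < lev j := by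
      refine Submodule.mul_le.2 ?_
      rintro _ ⟨a, -, rfl⟩ b hb
      have ha : inclBase 𝒵 𝒲 a ∈ (BZ.sum BW).supported fun S => fiberPart S = 0 :=
        supported_mono (fun S hS => hS.1) (inclBase_mem BW (BZ.mem_supported_true a))
      have hb' := (BZ.sum BW).subLambda_le (p := fun c => ∀ i, c = Sum.inr i → lev i < lev j)
        (by
          rintro _ ⟨w, hw, rfl⟩ _ hi i rfl
          refine h2 _ w hw i ?_
          simpa [GradedBasis.sum] using hi) hb
      refine mul_mem_supported ?_ ha hb'
      intro S T hS hT i hi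
      rw [fiberPart_add, hS, zero_add] at hi
      exact hT _ (mem_fiberPart.1 hi) i rfl
    exact hle h3

variable [CharZero k] {BZ : GradedBasis 𝒵 I} {BW : GradedBasis 𝒲 J} {dZ : Differential 𝒵}
  {d : Differential (sumGrading 𝒵 𝒲)} {dW : Differential 𝒲} {lev : J → ℕ}

/-- If `e_{ΛZ}(ΛV) ≤ m`, then every cocycle with more than `m` letters of the base is a
coboundary. -/
theorem exists_eq_differential_of_toomerOverBase_le
    (hbase : ∀ a, d.toLin (inclBase 𝒵 𝒲 a) = inclBase 𝒵 𝒲 (dZ.toLin a))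
    (hlev : ∀ j, d.toLin ((BZ.sum BW).x (Sum.inr j)) ∈
      (BZ.sum BW).supported fun S => ∀ i ∈ fiberPart S, lev i < lev j) {m : ℕ}
    (hm : toomerOverBase dZ d ≤ (m : ℕ∞)) {x : FreeCGA (sumGrading 𝒵 𝒲)}
    (hx : x ∈ (BZ.sum BW).supported fun S => m + 1 ≤ (basePart S).card) (hdx : d.toLin x = 0) :
    ∃ z, x = d.toLin z := by
  have htop : ∀ a, a ∈ fiberSpan 𝒵 BW fun _ => True := fun a =>
    (mem_fiberSpan_iff BZ BW).2 ((BZ.sum BW).mem_supported_true a)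
  have hsf := isSemifree_fiberSpan BZ BW (fun _ => True) dZ d hbase (fun a _ => htop _) lev hlev
  have hq : IsQuasiIso (fiberSpanGrading 𝒵 BW fun _ => True)
      (fiberSpanDiff BW (fun _ => True) d fun a _ => htop _) (degreeInt (sumGrading 𝒵 𝒲)) d.toLin
      (fiberSpan 𝒵 BW fun _ => True).subtype := by
    constructor
    · intro i x hx
      exact hx
    · intro x
      rfl
    · rintro ⟨x, hx⟩ - ⟨y, hy⟩
      exact ⟨⟨y, htop y⟩, Subtype.ext hy⟩
    · intro y hy
      refine ⟨⟨y, htop y⟩, 0, Subtype.ext hy, ?_⟩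
      rw [map_zero, add_zero]
      rfl
  have hinj := projectionInjective_of_toomer_le hsf hq hm
  have hw := mem_wordSubmodule_fiberSpan BZ BW (htop x) hx
  have hz := hinj ⟨x, htop x⟩ (Subtype.ext hdx) ⟨0, by rwa [map_zero, sub_zero]⟩
  obtain ⟨⟨z, hz⟩, e⟩ := hz
  exact ⟨z, congrArg Subtype.val e⟩

/-- The component of base wordlength `p` of a cocycle can be removed at the cost of `n + 1` letters
of the fiber. -/
theorem exists_sub_differential_mem_of_fiber (h𝒲 : DirectSum.IsInternal 𝒲)
    (hbase : ∀ a, d.toLin (inclBase 𝒵 𝒲 a) = inclBase 𝒵 𝒲 (dZ.toLin a))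
    (hfib : ∀ a, dW.toLin a = projFiber 𝒵 𝒲 (d.toLin (inclFiber 𝒵 𝒲 a))) {q n : ℕ}
    (hex : ∀ b ∈ wordGE 𝒲 (q + (n + 1)), dW.toLin b = 0 → ∃ c ∈ wordGE 𝒲 q, dW.toLin c = b)
    {p : ℕ} {y : FreeCGA (sumGrading 𝒵 𝒲)}
    (hy : y ∈ (BZ.sum BW).supported fun S => p ≤ (basePart S).card)
    (hy' : y ∈ (BZ.sum BW).supported fun S => q + p + (n + 1) ≤ S.card) (hdy : d.toLin y = 0) :
    ∃ t ∈ (BZ.sum BW).supported fun S => q + p ≤ S.card,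
      y - d.toLin t ∈ (BZ.sum BW).supported fun S => p + 1 ≤ (basePart S).card := by
  obtain ⟨g, hg⟩ := exists_homotopy dW.toLin dW.sq_zero
    (B' := BW.supported fun T => q + (n + 1) ≤ T.card) (B := BW.supported fun T => q ≤ T.card)
    (supported_mono fun S hS => (Nat.le_add_right _ _).trans hS)
    (fun b hb => by
      rw [← BW.mem_wordGE_iff] at hb ⊢
      exact dW.mem_wordGE h𝒲 _ b hb)
    (fun b hb hdb => by
      rw [← BW.mem_wordGE_iff] at hb
      obtain ⟨c, hc, e⟩ := hex b hb hdb
      exact ⟨c, BW.mem_wordGE_iff.1 hc, e⟩)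
  have hy'' : y ∈ (BZ.sum BW).supported fun S =>
      (basePart S).card = p → q + (n + 1) ≤ (fiberPart S).card := by
    refine supported_mono ?_ hy'
    intro S hS hp
    have := card_parts S
    omega
  have h := exists_sub_differential_mem dZ d hbase (p := fun T => q ≤ T.card)
    (p' := fun T => q + (n + 1) ≤ T.card) dW.toLin hfib g hg hy hy'' hdy
  obtain ⟨t, ht, h⟩ := h
  refine ⟨t, supported_mono ?_ ht, h⟩
  rintro S ⟨h1, h2⟩
  have := card_parts S
  omega

/-- Every cocycle of wordlength at least `m * (s + 1) + n + 1` is a coboundary, if the differential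
raises the wordlength by `c` and `s + c = n + 1`. Removing the components of base wordlength
`0, …, m` costs `n + 1` letters of the fiber each time, of which the differential gives `c` back. -/
theorem exists_eq_differential_of_card (h𝒲 : DirectSum.IsInternal 𝒲)
    (hbase : ∀ a, d.toLin (inclBase 𝒵 𝒲 a) = inclBase 𝒵 𝒲 (dZ.toLin a))
    (hfib : ∀ a, dW.toLin a = projFiber 𝒵 𝒲 (d.toLin (inclFiber 𝒵 𝒲 a)))
    {m n s c : ℕ} (hs : s + c = n + 1)
    (hd : ∀ i, d.toLin ((BZ.sum BW).x i) ∈ (BZ.sum BW).supported fun S => c + 1 ≤ S.card)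
    (hex : ∀ q, ∀ b ∈ wordGE 𝒲 (q + (n + 1)), dW.toLin b = 0 →
      ∃ c ∈ wordGE 𝒲 q, dW.toLin c = b)
    (hm : ∀ x ∈ (BZ.sum BW).supported fun S => m + 1 ≤ (basePart S).card, d.toLin x = 0 →
      ∃ z, x = d.toLin z) {x : FreeCGA (sumGrading 𝒵 𝒲)}
    (hx : x ∈ wordGE (sumGrading 𝒵 𝒲) (m * (s + 1) + n + 1)) (hdx : d.toLin x = 0) :
    ∃ z, x = d.toLin z := by
  have key : ∀ p, p ≤ m → ∃ t,
      x - d.toLin t ∈ ((BZ.sum BW).supported fun S => p ≤ (basePart S).card) ∧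
      x - d.toLin t ∈
        (BZ.sum BW).supported fun S => (m - p) * (s + 1) + p + (n + 1) ≤ S.card := by
    intro p
    induction p with
    | zero =>
      intro _
      refine ⟨0, supported_mono (fun _ _ => Nat.zero_le _) ((BZ.sum BW).mem_supported_true _), ?_⟩
      rw [(BZ.sum BW).mem_wordGE_iff] at hx
      rw [map_zero, sub_zero]
      exact hx
    | succ p ih =>
      intro hp
      obtain ⟨t, h1, h2⟩ := ih (Nat.le_of_succ_le hp)
      obtain ⟨t', ht', h3⟩ := exists_sub_differential_mem_of_fiber h𝒲 hbase hfib (hex _) h1 h2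
        (by rw [map_sub, d.sq_zero, hdx, sub_zero])
      have e : x - d.toLin (t + t') = x - d.toLin t - d.toLin t' := by
        rw [map_add, sub_add_eq_sub_sub]
      have h4 := differential_mem_card d hd ht'
      -- The bound on the wordlength drops by `s`: the fiber loses `s + 1` letters, and the base
      -- gains one.
      have e1 : (m - p) * (s + 1) = (m - (p + 1)) * (s + 1) + (s + 1) := by
        rw [← Nat.succ_mul]
        congr 1
        omega
      have h5 : x - d.toLin t ∈ (BZ.sum BW).supported fun S =>
          (m - (p + 1)) * (s + 1) + (p + 1) + (n + 1) ≤ S.card := by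
        refine supported_mono ?_ h2
        intro S hS
        omega
      have h6 : d.toLin t' ∈ (BZ.sum BW).supported fun S =>
          (m - (p + 1)) * (s + 1) + (p + 1) + (n + 1) ≤ S.card := by
        refine supported_mono ?_ h4
        intro S hS
        omega
      refine ⟨t + t', ?_, ?_⟩
      · rw [e]; exact h3
      · rw [e]; exact sub_mem h5 h6
  obtain ⟨t, h1, h2⟩ := key m le_rfl
  obtain ⟨t', -, h3⟩ := exists_sub_differential_mem_of_fiber h𝒲 hbase hfib (hex _) h1 h2
    (by rw [map_sub, d.sq_zero, hdx, sub_zero])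
  obtain ⟨z, hz⟩ := hm _ h3 (by
    rw [map_sub, map_sub, d.sq_zero, d.sq_zero, hdx, sub_zero, sub_zero])
  exact ⟨z + t' + t, by rw [map_add, map_add, ← hz, sub_add_cancel, sub_add_cancel]⟩

end RelativeSullivan

theorem theorem1p3 {k : Type u} [Field k] [CharZero k]
    {Z W : Type u} [AddCommGroup Z] [Module k Z] [AddCommGroup W] [Module k W]
    {𝒵 : ℕ → Submodule k Z} {𝒲 : ℕ → Submodule k W}
    (h𝒵 : DirectSum.IsInternal 𝒵) (h𝒲 : DirectSum.IsInternal 𝒲)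
    (dZ : FreeCGA.Differential 𝒵) (dV : FreeCGA.Differential (sumGrading 𝒵 𝒲))
    (dW : FreeCGA.Differential 𝒲) (hV : IsRelativeSullivan dZ dV dW)
    (m n : ℕ) (hm : toomerOverBase dZ dV = (m : ℕ∞))
    (hn : ∀ q : ℕ, toomerWordGE h𝒲 dW q ≤ (n : ℕ∞)) :
    toomerSelf dV ≤ (((m + 1) * (n + 2) - 2 : ℕ) : ℕ∞) ∧
      (IsMinimalSullivan dV → toomerSelf dV ≤ (((m + 1) * (n + 1) - 1 : ℕ) : ℕ∞)) := by
  -- Of the filtration of `Z` only the existence of a homogeneous basis is used.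
  obtain ⟨F, hF, -⟩ := hV.base_ks
  obtain ⟨I, BZ, -⟩ := exists_gradedBasis h𝒵 hF
  obtain ⟨J, BW, lev, hpos, hlev⟩ := hV.exists_fiber_basis h𝒲
  have hlevW : ∀ j, dW.toLin (BW.x j) ∈ BW.supported fun S => ∀ i ∈ S, lev i < lev j := by
    intro j
    rw [hV.fiber, inclFiber_x BZ BW]
    have h := projFiber_mem (hlev BZ j)
    simpa only [fiberPart_map_inr] using h
  have hex : ∀ q, ∀ b ∈ wordGE 𝒲 (q + (n + 1)), dW.toLin b = 0 →
      ∃ c ∈ wordGE 𝒲 q, dW.toLin c = b := fun q b hb hdb =>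
    exists_eq_differential_of_toomerWordGE_le hpos hlevW h𝒲 (hn q) hb hdb
  have hm' : ∀ x ∈ (BZ.sum BW).supported fun S => m + 1 ≤ (basePart S).card, dV.toLin x = 0 →
      ∃ z, x = dV.toLin z := fun x hx hdx =>
    exists_eq_differential_of_toomerOverBase_le hV.base (hlev BZ) hm.le hx hdx
  refine ⟨toomerSelf_le fun x hx hdx => ?_, fun hmin => toomerSelf_le fun x hx hdx => ?_⟩
  · have e : (m + 1) * (n + 2) - 2 + 1 = m * (n + 1 + 1) + n + 1 := by
      change _ = m * (n + 2) + n + 1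
      rw [add_mul]
      omega
    rw [e] at hx
    exact exists_eq_differential_of_card (c := 0) h𝒲 hV.base hV.fiber rfl
      (fun i => supported_mono (fun S hS => hS.2) (differential_x_mem dV i)) hex hm' hx hdx
  · have e : (m + 1) * (n + 1) - 1 + 1 = m * (n + 1) + n + 1 := by
      rw [add_mul]
      omega
    rw [e] at hx
    exact exists_eq_differential_of_card (c := 1) h𝒲 hV.base hV.fiber rfl
      (fun i => (BZ.sum BW).mem_wordGE_iff.1 (hmin.minimal _)) hex hm' hx hdx
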